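/- Conventions. $\|\cdot\|_{q,I}$ ($0<q\le\infty$) is the usual (quasi-)norm of $L_q(I)$ with respect to Lebesgue measure on an interval $I\subset(0,\infty)$, and $1/\infty=0$. For positive functions, $f\approx g$ means $cg\le f\le Cg$ with constants $0<c\le C<\infty$. A positive Lebesgue measurable function $b$ on $(0,\infty)$ is slowly varying, $b\in SV$, if for each $\varepsilon>0$ the function $t^{\varepsilon}b(t)$ is equivalent ($\approx$) to a non-decreasing function and $t^{-\varepsilon}b(t)$ is equivalent to a non-increasing function on $(0,\infty)$. For (quasi-)normed spaces, $X=Y$ means equality of sets with equivalent (quasi-)norms. For a couple $\bar X=(X_0,X_1)$ of (quasi-)normed spaces contained in a common vector space put $K(t,f;\bar X)=\inf\{\|f_0\|_{X_0}+t\|f_1\|_{X_1}: f=f_0+f_1,\ f_i\in X_i\}$ for $t>0$, $f\in X_0+X_1$. For $0\le\theta\le1$, $0<s,r,q\le\infty$ and positive functions $a,b,c$ on $(0,\infty)$ define the following spaces as the sets of those $f\in X_0+X_1$ for which the indicated (quasi-)norm is finite, where $K(u,f)=K(u,f;\bar X)$: $$\bar X_{\theta,q;b}:\ \|u^{-\theta-1/q}b(u)K(u,f)\|_{q,(0,\infty)},$$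 $$\bar X^{\mathcal L}_{\theta,r,b,q,a}:\ \Big\|t^{-1/r}b(t)\,\|u^{-\theta-1/q}a(u)K(u,f)\|_{q,(0,t)}\Big\|_{r,(0,\infty)},$$ $$\bar X^{\mathcal R}_{\theta,r,b,q,a}:\ \Big\|t^{-1/r}b(t)\,\|u^{-\theta-1/q}a(u)K(u,f)\|_{q,(t,\infty)}\Big\|_{r,(0,\infty)},$$ $$\bar X^{\mathcal L,\mathcal L}_{\theta,s,c,r,b,q,a}:\ \Big\|t^{-1/s}c(t)\Big\|u^{-1/r}b(u)\,\|v^{-\theta-1/q}a(v)K(v,f)\|_{q,(0,u)}\Big\|_{r,(0,t)}\Big\|_{s,(0,\infty)},$$ $$\bar X^{\mathcal R,\mathcal R}_{\theta,s,c,r,b,q,a}:\ \Big\|t^{-1/s}c(t)\Big\|u^{-1/r}b(u)\,\|v^{-\theta-1/q}a(v)K(v,f)\|_{q,(u,\infty)}\Big\|_{r,(t,\infty)}\Big\|_{s,(0,\infty)}.$$ Theorem. Let $\bar A=(A_0,A_1)$ be a compatible couple of (quasi-)Banach spaces (that is, both are continuously embedded in one Hausdorff topological vector space) with $A_0\cap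 A_1\ne\{0\}$. Let $0<\theta_0<1$, $0<r,r_0,q_0,r_1,q_1\le\infty$, $a,a_0,b_0,a_1,b_1\in SV$, $$\|s^{-1/r_0}b_0(s)\|_{r_0,(1,\infty)}<\infty,\qquad \Big\|s^{-1/r_1}b_1(s)\,\|u^{-1/q_1}a_1(u)\|_{q_1,(s,1)}\Big\|_{r_1,(0,1)}<\infty .$$ Put $$\chi_0(t)=a_0(t)\,\|s^{-1/r_0}b_0(s)\|_{r_0,(t,\infty)},\qquad \chi_1(t)=\Big\|s^{-1/r_1}b_1(s)\,\|u^{-1/q_1}a_1(u)\|_{q_1,(s,t)}\Big\|_{r_1,(0,t)},\qquad \rho(t)=t^{1-\theta_0}\frac{\chi_0(t)}{\chi_1(t)},$$ and, for $0\le\theta\le1$, $a^{\#}=\chi_0^{1-\theta}\chi_1^{\theta}\,(a\circ\rho)$ and $\eta=(1-\theta)\theta_0+\theta$. Write $\bar X=\big(\bar A^{\mathcal L}_{\theta_0,r_0,b_0,q_0,a_0},\,\bar A^{\mathcal R}_{1,r_1,b_1,q_1,a_1}\big)$. (i) If $0<\theta<1$, then $\bar X_{\theta,r;a}=\bar A_{\eta,r;a^{\#}}$.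 (ii) If $\|s^{-1/r}a(s)\|_{r,(1,\infty)}<\infty$, then $$\bar X_{0,r;a}=\bar A^{\mathcal L}_{\theta_0,r,B_0,q_0,a_0}\cap\bar A^{\mathcal L,\mathcal L}_{\theta_0,r,a\circ\rho,r_0,b_0,q_0,a_0},\qquad B_0(t)=\|s^{-1/r_0}b_0(s)\|_{r_0,(t,\infty)}\,a(\rho(t)).$$ (iii) If $\|s^{-1/r}a(s)\|_{r,(0,1)}<\infty$, then, with $a^{\#}=\chi_1\,(a\circ\rho)$ (the case $\theta=1$), $$\bar X_{1,r;a}=\bar A_{1,r;a^{\#}}\cap\bar A^{\mathcal R}_{1,r,B_1,q_1,a_1}\cap\bar A^{\mathcal R,\mathcal R}_{1,r,a\circ\rho,r_1,b_1,q_1,a_1},\qquad B_1(t)=\|s^{-1/r_1}b_1(s)\|_{r_1,(0,t)}\,a(\rho(t)).$$ -/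

import Mathlib

open Set Filter Topology MeasureTheory
open scoped ENNReal NNReal

noncomputable section

/-! Quasi-normed spaces `X` contained in an ambient vector space `V` are recorded by their extended
quasi-norm `V → ℝ≥0∞`, which is `‖f‖_X` for `f ∈ X` and `∞` for `f ∉ X`; so `f ∈ X` means that the
value at `f` is finite. -/

/-- The extended quasi-norm `N` defines a quasi-Banach space `{x | N x < ∞}` that is continuously
embedded in the topological vector space `V`. Two such spaces in the same Hausdorff topological
vector space form a compatible couple. -/
structure IsQuasiBanachIn (𝕜 : Type*) [RCLike 𝕜] {V : Type*} [AddCommGroup V] [Module 𝕜 V]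
    [TopologicalSpace V] (N : V → ℝ≥0∞) : Prop where
  eq_zero_iff : ∀ x : V, N x = 0 ↔ x = 0
  smul : ∀ (c : 𝕜) (x : V), N (c • x) = ‖c‖ₑ * N x
  add_le : ∃ C : ℝ≥0, ∀ x y : V, N (x + y) ≤ C * (N x + N y)
  complete : ∀ u : ℕ → V, (∀ n, N (u n) < ∞) →
    (∀ ε : ℝ≥0∞, 0 < ε → ∃ M : ℕ, ∀ m ≥ M, ∀ n ≥ M, N (u m - u n) < ε) →
    ∃ x : V, N x < ∞ ∧ Tendsto (fun n => N (u n - x)) atTop (𝓝 0)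
  continuous_embedding : ∀ U ∈ 𝓝 (0 : V), ∃ ε : ℝ≥0∞, 0 < ε ∧ ∀ x : V, N x < ε → x ∈ U

/-- `f ≈ g` on `(0, ∞)`. -/
def EquivOnPos (f g : ℝ → ℝ) : Prop :=
  ∃ c C : ℝ, 0 < c ∧ 0 < C ∧ ∀ t : ℝ, 0 < t → c * g t ≤ f t ∧ f t ≤ C * g t

/-- Slowly varying functions on `(0, ∞)` (the values outside `(0, ∞)` are irrelevant).
Almost everywhere measurability is Lebesgue measurability. -/
structure SlowlyVarying (b : ℝ → ℝ) : Prop where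
  pos : ∀ t : ℝ, 0 < t → 0 < b t
  measurable : AEMeasurable b (volume.restrict (Ioi 0))
  equiv_increasing : ∀ ε : ℝ, 0 < ε →
    ∃ g : ℝ → ℝ, MonotoneOn g (Ioi 0) ∧ EquivOnPos (fun t => t ^ ε * b t) g
  equiv_decreasing : ∀ ε : ℝ, 0 < ε →
    ∃ g : ℝ → ℝ, AntitoneOn g (Ioi 0) ∧ EquivOnPos (fun t => t ^ (-ε) * b t) g

/-- `‖u ^ (α - 1/q) w(u) F(u)‖_{q, I}`, the `L_q` quasi-norm on `I` with `0 < q ≤ ∞`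
and the convention `1/∞ = 0`. -/
def weightedNorm (q : ℝ≥0∞) (α : ℝ) (w : ℝ → ℝ) (F : ℝ → ℝ≥0∞) (I : Set ℝ) : ℝ≥0∞ :=
  eLpNorm (fun u : ℝ => ENNReal.ofReal (u ^ (α - (q⁻¹).toReal) * w u) * F u) q
    (volume.restrict I)

section Spaces

variable {V : Type*} [AddCommGroup V]

/-- Peetre's K-functional `K(t, f; X₀, X₁)` (it is `∞` if `f ∉ X₀ + X₁`). -/
def peetreK (X₀ X₁ : V → ℝ≥0∞) (t : ℝ) (f : V) : ℝ≥0∞ :=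
  ⨅ (f₀ : V) (f₁ : V) (_ : f = f₀ + f₁), (X₀ f₀ + ENNReal.ofReal t * X₁ f₁)

/-- The standard space `(X₀, X₁)_{θ,q;b}`. -/
def standardSpace (X₀ X₁ : V → ℝ≥0∞) (θ : ℝ) (q : ℝ≥0∞) (b : ℝ → ℝ) : V → ℝ≥0∞ :=
  fun f => weightedNorm q (-θ) b (fun u => peetreK X₀ X₁ u f) (Ioi 0)

/-- The limiting space `(X₀, X₁)^L_{θ,r,b,q,a}`. -/
def spaceL (X₀ X₁ : V → ℝ≥0∞) (θ : ℝ) (r : ℝ≥0∞) (b : ℝ → ℝ) (q : ℝ≥0∞) (a : ℝ → ℝ) :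
    V → ℝ≥0∞ :=
  fun f => weightedNorm r 0 b
    (fun t => weightedNorm q (-θ) a (fun u => peetreK X₀ X₁ u f) (Ioo 0 t)) (Ioi 0)

/-- The limiting space `(X₀, X₁)^R_{θ,r,b,q,a}`. -/
def spaceR (X₀ X₁ : V → ℝ≥0∞) (θ : ℝ) (r : ℝ≥0∞) (b : ℝ → ℝ) (q : ℝ≥0∞) (a : ℝ → ℝ) :
    V → ℝ≥0∞ :=
  fun f => weightedNorm r 0 b
    (fun t => weightedNorm q (-θ) a (fun u => peetreK X₀ X₁ u f) (Ioi t)) (Ioi 0)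

/-- The extremal space `(X₀, X₁)^{L,L}_{θ,s,c,r,b,q,a}`. -/
def spaceLL (X₀ X₁ : V → ℝ≥0∞) (θ : ℝ) (s : ℝ≥0∞) (c : ℝ → ℝ) (r : ℝ≥0∞) (b : ℝ → ℝ)
    (q : ℝ≥0∞) (a : ℝ → ℝ) : V → ℝ≥0∞ :=
  fun f => weightedNorm s 0 c
    (fun t => weightedNorm r 0 b
      (fun u => weightedNorm q (-θ) a (fun v => peetreK X₀ X₁ v f) (Ioo 0 u)) (Ioo 0 t)) (Ioi 0)

/-- The extremal space `(X₀, X₁)^{R,R}_{θ,s,c,r,b,q,a}`. -/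
def spaceRR (X₀ X₁ : V → ℝ≥0∞) (θ : ℝ) (s : ℝ≥0∞) (c : ℝ → ℝ) (r : ℝ≥0∞) (b : ℝ → ℝ)
    (q : ℝ≥0∞) (a : ℝ → ℝ) : V → ℝ≥0∞ :=
  fun f => weightedNorm s 0 c
    (fun t => weightedNorm r 0 b
      (fun u => weightedNorm q (-θ) a (fun v => peetreK X₀ X₁ v f) (Ioi u)) (Ioi t)) (Ioi 0)

/-- The intersection `X ∩ Y`. -/
def interSpace (X Y : V → ℝ≥0∞) : V → ℝ≥0∞ := fun f => max (X f) (Y f)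

/-- Continuous embedding `X ⊂ Y`: finiteness of `X f` forces finiteness of `Y f`, and
`‖f‖_Y ≤ C ‖f‖_X`. -/
def ContEmbedded (X Y : V → ℝ≥0∞) : Prop := ∃ C : ℝ≥0, ∀ f : V, Y f ≤ C * X f

/-- `X = Y` as sets, with equivalent quasi-norms. -/
def SameSpace (X Y : V → ℝ≥0∞) : Prop := ContEmbedded X Y ∧ ContEmbedded Y X

end Spaces

/-- `‖s ^ (-1/r) b(s)‖_{r,(t,∞)}` as a real number (used only when it is finite). -/
def tailAt (r : ℝ≥0∞) (b : ℝ → ℝ) (t : ℝ) : ℝ := (weightedNorm r 0 b (fun _ => 1) (Ioi t)).toReal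

/-- `‖s ^ (-1/r) b(s)‖_{r,(0,t)}` as a real number (used only when it is finite). -/
def headAt (r : ℝ≥0∞) (b : ℝ → ℝ) (t : ℝ) : ℝ :=
  (weightedNorm r 0 b (fun _ => 1) (Ioo 0 t)).toReal

/-- `‖s ^ (-1/r) b(s) ‖u ^ (-1/q) a(u)‖_{q,(s,t)}‖_{r,(0,t)}`. -/
def nestedHead (r : ℝ≥0∞) (b : ℝ → ℝ) (q : ℝ≥0∞) (a : ℝ → ℝ) (t : ℝ) : ℝ≥0∞ :=
  weightedNorm r 0 b (fun s => weightedNorm q 0 a (fun _ => 1) (Ioo s t)) (Ioo 0 t)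

/-- `χ₀(t) = a₀(t) ‖s ^ (-1/r₀) b₀(s)‖_{r₀,(t,∞)}`. -/
def chiZero (r₀ : ℝ≥0∞) (b₀ a₀ : ℝ → ℝ) (t : ℝ) : ℝ := a₀ t * tailAt r₀ b₀ t

/-- `χ₁(t) = ‖s ^ (-1/r₁) b₁(s) ‖u ^ (-1/q₁) a₁(u)‖_{q₁,(s,t)}‖_{r₁,(0,t)}` as a real number
(used only when it is finite). -/
def chiOne (r₁ : ℝ≥0∞) (b₁ : ℝ → ℝ) (q₁ : ℝ≥0∞) (a₁ : ℝ → ℝ) (t : ℝ) : ℝ :=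
  (nestedHead r₁ b₁ q₁ a₁ t).toReal

/-- `ρ(t) = t ^ (1 - θ₀) χ₀(t) / χ₁(t)`. -/
def rhoFun (θ₀ : ℝ) (χ₀ χ₁ : ℝ → ℝ) (t : ℝ) : ℝ := t ^ (1 - θ₀) * (χ₀ t / χ₁ t)

/-- `a# = χ₀ ^ (1 - θ) χ₁ ^ θ (a ∘ ρ)`. -/
def aSharp (θ : ℝ) (χ₀ χ₁ a ρ : ℝ → ℝ) (t : ℝ) : ℝ := χ₀ t ^ (1 - θ) * χ₁ t ^ θ * a (ρ t)

end

/-! Everything is reduced to sequences over ℤ. Slowly varying functions and the K-functional change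
by at most a bounded factor on a dyadic interval, so each weighted `L_q` quasi-norm is equivalent to
an `ℓ_q` quasi-norm of dyadic samples, and norms over `(0,t)` and `(t,∞)` become head and tail
norms. All constants must be uniform in `f`; hence estimates are relations (`Dom`, `Dom₂`,
`CellEqv`) between families indexed by vectors, pairs of vectors or decompositions. Slow variation
is used in Potter form: `w(t)/w(s)` is at most a constant times `(t/s)^p` times an arbitrarily small
power of `max(t/s, s/t)`. A nonzero index `p` then gives geometric sums and Hardy inequalities valid
for all `0 < q ≤ ∞`.

The core is a Holmstedt formula (`HolmstedtWeights.peetreK_domEqv_holm`). Write `T = ‖b₀‖_{(t,∞)}`,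
`H = ‖b₁‖_{(0,t)}`, `X = χ₁`, with the measure `ds/s` understood. Then `K(ρ(t), f; X̄)` is
equivalent to the sum of five pieces: two head pieces, namely the norm of the first space truncated
to `(0,t)` and `T` times its inner norm; and `ρ(t)` times a middle piece `X(t) K(t,f)/t` plus two
tail pieces, namely `H` times the inner norm of the second space and that space's norm truncated to
`(t,∞)`. The upper bound tests a decomposition `f = f₀ + f₁` nearly optimal for `K(t,f;Ā)`:
`K(·,f₀)` saturates beyond `t`, and `K(s,f₁)/s` saturates below `t`. The lower bound holds because
the right-hand side is quasi-subadditive in `f`, is bounded by the first norm alone, and also by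
`ρ(t)` times the second norm alone (`holm_dom_left`, `holm_dom_right`).

Since `ρ` has positive index `1 - θ₀`, the norm of `X̄_{θ,r;a}` can be computed along the points
`ρ(2^k)` (`seqNorm_weightedSeq_domEqv_comp`), where Holmstedt's formula is inserted. The weight `ω =
ρ^{-θ} (a ∘ ρ)` has index `-θ(1-θ₀)`, and `ωρ` has index `(1-θ)(1-θ₀)`. For `θ > 0` Hardy's
inequality absorbs the head pieces into the middle piece, for `θ < 1` it absorbs the tail pieces,
and the middle piece is exactly the norm of `Ā_{η,r;a#}`. At `θ = 0` the head pieces survive and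
dominate the middle piece, which gives the `L` and `L,L` spaces; at `θ = 1` the middle and tail
pieces survive, which gives the three-fold intersection. -/

/-! ### Domination up to a constant -/

/-- `x i ≤ C y i` with a constant `C` that does not depend on the index. -/
def Dom {κ : Type*} (x y : κ → ℝ≥0∞) : Prop := ∃ C : ℝ≥0, ∀ i, x i ≤ C * y i

/-- `x i k ≤ C y i k` with a constant `C` that does not depend on the indices. -/
def Dom₂ {ι κ : Type*} (x y : ι → κ → ℝ≥0∞) : Prop := ∃ C : ℝ≥0, ∀ i k, x i k ≤ C * y i k

section Dom

variable {ι κ : Type*}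

theorem Dom.of_le {x y : κ → ℝ≥0∞} (h : ∀ i, x i ≤ y i) : Dom x y :=
  ⟨1, fun i => by simpa using h i⟩

theorem Dom.refl (x : κ → ℝ≥0∞) : Dom x x := Dom.of_le fun _ => le_rfl

theorem Dom.trans {x y z : κ → ℝ≥0∞} (h : Dom x y) (h' : Dom y z) : Dom x z := by
  obtain ⟨C, hC⟩ := h
  obtain ⟨D, hD⟩ := h'
  refine ⟨C * D, fun i => (hC i).trans ?_⟩
  rw [ENNReal.coe_mul, mul_assoc]
  gcongr
  exact hD i

theorem Dom.mul {x y x' y' : κ → ℝ≥0∞} (h : Dom x y) (h' : Dom x' y') :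
    Dom (fun i => x i * x' i) (fun i => y i * y' i) := by
  obtain ⟨C, hC⟩ := h
  obtain ⟨D, hD⟩ := h'
  refine ⟨C * D, fun i => (mul_le_mul' (hC i) (hD i)).trans_eq ?_⟩
  rw [ENNReal.coe_mul]
  ring

theorem Dom.add {x y z : κ → ℝ≥0∞} (h : Dom x z) (h' : Dom y z) :
    Dom (fun i => x i + y i) z := by
  obtain ⟨C, hC⟩ := h
  obtain ⟨D, hD⟩ := h'
  refine ⟨C + D, fun i => (add_le_add (hC i) (hD i)).trans_eq ?_⟩
  rw [ENNReal.coe_add, add_mul]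

theorem Dom.comp {x y : κ → ℝ≥0∞} (h : Dom x y) (e : ι → κ) :
    Dom (fun i => x (e i)) (fun i => y (e i)) :=
  h.imp fun _ hC i => hC (e i)

theorem Dom.max {x y z : κ → ℝ≥0∞} (h : Dom x z) (h' : Dom y z) :
    Dom (fun i => max (x i) (y i)) z :=
  (Dom.of_le fun _ => max_le_add_of_nonneg zero_le zero_le).trans (h.add h')

theorem Dom₂.dom {x y : ι → κ → ℝ≥0∞} (h : Dom₂ x y) :
    Dom (fun p : ι × κ => x p.1 p.2) (fun p => y p.1 p.2) := h.imp fun _ hC p => hC p.1 p.2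

theorem Dom.dom₂ {x y : ι → κ → ℝ≥0∞}
    (h : Dom (fun p : ι × κ => x p.1 p.2) (fun p => y p.1 p.2)) : Dom₂ x y :=
  h.imp fun _ hC i k => hC (i, k)

theorem Dom₂.of_le {x y : ι → κ → ℝ≥0∞} (h : ∀ i k, x i k ≤ y i k) : Dom₂ x y :=
  ⟨1, fun i k => by simpa using h i k⟩

theorem Dom₂.refl (x : ι → κ → ℝ≥0∞) : Dom₂ x x := Dom₂.of_le fun _ _ => le_rfl

theorem Dom₂.trans {x y z : ι → κ → ℝ≥0∞} (h : Dom₂ x y) (h' : Dom₂ y z) : Dom₂ x z :=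
  (h.dom.trans h'.dom).dom₂

theorem Dom₂.mul {x y x' y' : ι → κ → ℝ≥0∞} (h : Dom₂ x y) (h' : Dom₂ x' y') :
    Dom₂ (fun i k => x i k * x' i k) (fun i k => y i k * y' i k) := (h.dom.mul h'.dom).dom₂

theorem Dom₂.add {x y z : ι → κ → ℝ≥0∞} (h : Dom₂ x z) (h' : Dom₂ y z) :
    Dom₂ (fun i k => x i k + y i k) z := (h.dom.add h'.dom).dom₂

theorem Dom₂.const_mul {x y : ι → κ → ℝ≥0∞} (h : Dom₂ x y) (c : ι → κ → ℝ≥0∞) :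
    Dom₂ (fun i k => c i k * x i k) (fun i k => c i k * y i k) := (Dom₂.refl c).mul h

end Dom

/-! ### Sequence quasi-norms -/

/-- The `ℓ_q` quasi-norm of a sequence over `ℤ`. -/
noncomputable def seqNorm (q : ℝ≥0∞) (x : ℤ → ℝ≥0∞) : ℝ≥0∞ :=
  if q = ∞ then ⨆ k, x k else (∑' k, x k ^ q.toReal) ^ (q.toReal)⁻¹

/-- The `ℓ_q` quasi-norm over the indices `j ≤ k`. -/
noncomputable def headNorm (q : ℝ≥0∞) (x : ℤ → ℝ≥0∞) (k : ℤ) : ℝ≥0∞ :=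
  seqNorm q ((Iic k).indicator x)

/-- The `ℓ_q` quasi-norm over the indices `j ≥ k`. -/
noncomputable def tailNorm (q : ℝ≥0∞) (x : ℤ → ℝ≥0∞) (k : ℤ) : ℝ≥0∞ :=
  seqNorm q ((Ici k).indicator x)

section SeqNorm

variable {q : ℝ≥0∞}

theorem seqNorm_mono {x y : ℤ → ℝ≥0∞} (h : ∀ k, x k ≤ y k) : seqNorm q x ≤ seqNorm q y := by
  unfold seqNorm
  split_ifs
  · exact iSup_mono h
  · gcongr with k
    exact h k

theorem seqNorm_const_mul (hq : 0 < q) (c : ℝ≥0∞) (x : ℤ → ℝ≥0∞) :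
    seqNorm q (fun k => c * x k) = c * seqNorm q x := by
  unfold seqNorm
  split_ifs with h
  · rw [ENNReal.mul_iSup]
  · have hp : 0 < q.toReal := ENNReal.toReal_pos hq.ne' h
    simp_rw [ENNReal.mul_rpow_of_nonneg _ _ hp.le]
    rw [ENNReal.tsum_mul_left, ENNReal.mul_rpow_of_nonneg _ _ (inv_nonneg.2 hp.le),
      ENNReal.rpow_rpow_inv hp.ne']

theorem le_seqNorm (hq : 0 < q) (x : ℤ → ℝ≥0∞) (k : ℤ) : x k ≤ seqNorm q x := by
  unfold seqNorm
  split_ifs with h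
  · exact le_iSup x k
  · have hp : 0 < q.toReal := ENNReal.toReal_pos hq.ne' h
    rw [ENNReal.le_rpow_inv_iff hp]
    exact ENNReal.le_tsum k

theorem seqNorm_comp_add (x : ℤ → ℝ≥0∞) (m : ℤ) : seqNorm q (fun k => x (k + m)) = seqNorm q x := by
  unfold seqNorm
  split_ifs
  · exact (Equiv.addRight m).iSup_comp (g := x)
  · congr 1
    exact (Equiv.addRight m).tsum_eq (fun k => x k ^ q.toReal)

/-- A sum is at most twice its larger term, which treats `p < 1` and `p ≥ 1` at once. -/
theorem exists_add_rpow_le {p : ℝ} (hp : 0 ≤ p) :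
    ∃ C : ℝ≥0, ∀ a b : ℝ≥0∞, (a + b) ^ p ≤ C * (a ^ p + b ^ p) := by
  refine ⟨2 ^ p, fun a b => ?_⟩
  have h2 : ((2 ^ p : ℝ≥0) : ℝ≥0∞) = (2 : ℝ≥0∞) ^ p := by
    rw [ENNReal.coe_rpow_of_nonneg _ hp]; rfl
  rw [h2]
  rcases le_total a b with h | h
  · calc (a + b) ^ p ≤ (2 * b) ^ p := by gcongr; rw [two_mul]; gcongr
      _ = 2 ^ p * b ^ p := ENNReal.mul_rpow_of_nonneg _ _ hp
      _ ≤ _ := by gcongr; exact le_add_self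
  · calc (a + b) ^ p ≤ (2 * a) ^ p := by gcongr; rw [two_mul]; gcongr
      _ = 2 ^ p * a ^ p := ENNReal.mul_rpow_of_nonneg _ _ hp
      _ ≤ _ := by gcongr; exact le_self_add

theorem exists_seqNorm_add_le (q : ℝ≥0∞) :
    ∃ C : ℝ≥0, ∀ x y : ℤ → ℝ≥0∞,
      seqNorm q (fun k => x k + y k) ≤ C * (seqNorm q x + seqNorm q y) := by
  by_cases h : q = ∞
  · refine ⟨1, fun x y => ?_⟩
    simp only [seqNorm, h, if_true, ENNReal.coe_one, one_mul]
    exact iSup_le fun k => add_le_add (le_iSup x k) (le_iSup y k)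
  · have hp : 0 ≤ q.toReal := ENNReal.toReal_nonneg
    obtain ⟨C, hC⟩ := exists_add_rpow_le hp
    obtain ⟨D, hD⟩ := exists_add_rpow_le (inv_nonneg.2 hp)
    refine ⟨C ^ (q.toReal)⁻¹ * D, fun x y => ?_⟩
    simp only [seqNorm, h, if_false]
    calc (∑' k, (x k + y k) ^ q.toReal) ^ (q.toReal)⁻¹
        ≤ (C * (∑' k, x k ^ q.toReal + ∑' k, y k ^ q.toReal)) ^ (q.toReal)⁻¹ := by
          gcongr
          rw [← ENNReal.tsum_add, ← ENNReal.tsum_mul_left]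
          exact ENNReal.tsum_le_tsum fun k => hC _ _
      _ = (C : ℝ≥0∞) ^ (q.toReal)⁻¹ *
            (∑' k, x k ^ q.toReal + ∑' k, y k ^ q.toReal) ^ (q.toReal)⁻¹ :=
          ENNReal.mul_rpow_of_nonneg _ _ (inv_nonneg.2 hp)
      _ ≤ _ := by
          rw [ENNReal.coe_mul, mul_assoc, ENNReal.coe_rpow_of_nonneg _ (inv_nonneg.2 hp)]
          gcongr
          exact hD _ _

theorem seqNorm_zero (hq : 0 < q) : seqNorm q (fun _ => 0) = 0 := by
  simpa using seqNorm_const_mul hq 0 (fun _ => 0)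

/-- Quasi-norms of compositions with maps whose fibres have bounded size. -/
theorem exists_seqNorm_comp_le (q : ℝ≥0∞) (φ : ℤ → ℤ) (N : ℕ)
    (hφ : ∀ j k, φ j = φ k → |j - k| ≤ N) :
    ∃ C : ℝ≥0, ∀ x : ℤ → ℝ≥0∞, seqNorm q (fun k => x (φ k)) ≤ C * seqNorm q x := by
  by_cases h : q = ∞
  · refine ⟨1, fun x => ?_⟩
    simp only [seqNorm, h, if_true, ENNReal.coe_one, one_mul]
    exact iSup_le fun k => le_iSup x (φ k)
  · have hp : 0 ≤ q.toReal := ENNReal.toReal_nonneg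
    -- A fibre through `m` lies in `[m - N, m + N]`, which has `2N + 1` integers, so each term of
    -- `x` is repeated at most that often.
    refine ⟨((2 * N + 1 : ℕ) : ℝ≥0) ^ (q.toReal)⁻¹, fun x => ?_⟩
    simp only [seqNorm, h, if_false]
    rw [ENNReal.coe_rpow_of_nonneg _ (inv_nonneg.2 hp),
      ← ENNReal.mul_rpow_of_nonneg _ _ (inv_nonneg.2 hp)]
    gcongr
    set y : ℤ → ℝ≥0∞ := fun n => x n ^ q.toReal
    calc ∑' k, y (φ k) = ∑' k, ∑' n, if φ k = n then y n else 0 := by simp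
      _ = ∑' n, ∑' k, if φ k = n then y n else 0 := ENNReal.tsum_comm
      _ ≤ ∑' n, ((2 * N + 1 : ℕ) : ℝ≥0∞) * y n := by
          refine ENNReal.tsum_le_tsum fun n => ?_
          by_cases hn : ∃ k, φ k = n
          · obtain ⟨m, hm⟩ := hn
            calc ∑' k, (if φ k = n then y n else 0)
                ≤ ∑' k, (if k ∈ Finset.Icc (m - N) (m + N) then y n else 0) := by
                  refine ENNReal.tsum_le_tsum fun k => ?_
                  split_ifs with h1 h2
                  · exact le_rfl
                  · have := hφ k m (h1.trans hm.symm)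
                    rw [abs_le] at this
                    exact absurd (Finset.mem_Icc.2 ⟨by linarith, by linarith⟩) h2
                  · exact zero_le
                  · exact le_rfl
              _ = ∑ k ∈ Finset.Icc (m - N) (m + N), y n := by
                  rw [tsum_eq_sum (s := Finset.Icc (m - (N : ℤ)) (m + N))]
                  · exact Finset.sum_congr rfl fun k hk => if_pos hk
                  · intro k hk; exact if_neg hk
              _ = ((2 * N + 1 : ℕ) : ℝ≥0∞) * y n := by
                  rw [Finset.sum_const, Int.card_Icc, nsmul_eq_mul]
                  congr 2
                  omega
          · push Not at hn
            simp [hn]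
      _ = _ := by rw [ENNReal.tsum_mul_left]; rfl

/-! ### Geometric kernels and Hardy's inequality. -/

/-- The kernel `2 ^ (-ε |m|)`. -/
noncomputable def expKernel (ε : ℝ) (m : ℤ) : ℝ≥0∞ := (2 : ℝ≥0∞) ^ (-(ε * |(m : ℝ)|))

theorem expKernel_neg (ε : ℝ) (m : ℤ) : expKernel ε (-m) = expKernel ε m := by
  simp [expKernel]

theorem expKernel_add (ε δ : ℝ) (m : ℤ) :
    expKernel (ε + δ) m = expKernel ε m * expKernel δ m := by
  simp only [expKernel]
  rw [← ENNReal.rpow_add _ _ (by norm_num) (by norm_num)]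
  congr 1; ring

theorem expKernel_rpow (ε p : ℝ) (m : ℤ) : expKernel ε m ^ p = expKernel (ε * p) m := by
  simp only [expKernel]
  rw [← ENNReal.rpow_mul]
  congr 1; ring

theorem expKernel_le_one {ε : ℝ} (hε : 0 ≤ ε) (m : ℤ) : expKernel ε m ≤ 1 := by
  rw [expKernel, ← ENNReal.rpow_zero (x := 2)]
  exact ENNReal.rpow_le_rpow_of_exponent_le (by norm_num)
    (neg_nonpos.2 (mul_nonneg hε (abs_nonneg _)))

theorem tsum_expKernel_lt_top {ε : ℝ} (hε : 0 < ε) : ∑' m, expKernel ε m < ∞ := by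
  have key : ∑' n : ℕ, expKernel ε (n : ℤ) < ∞ := by
    have h1 : ∀ n : ℕ, expKernel ε (n : ℤ) = ((2 : ℝ≥0∞) ^ (-ε)) ^ n := by
      intro n
      rw [expKernel, ← ENNReal.rpow_natCast, ← ENNReal.rpow_mul]
      congr 1
      simp
    simp_rw [h1]
    rw [ENNReal.tsum_geometric]
    rw [ENNReal.inv_lt_top, tsub_pos_iff_lt]
    exact ENNReal.rpow_lt_one_of_one_lt_of_neg (by norm_num) (by linarith)
  have h2 : ∑' m, expKernel ε m ≤ ∑' n : ℕ, expKernel ε (n : ℤ) + ∑' n : ℕ, expKernel ε (n : ℤ) := by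
    rw [tsum_of_nat_of_neg_add_one ENNReal.summable ENNReal.summable]
    gcongr with n
    simp only [expKernel]
    apply ENNReal.rpow_le_rpow_of_exponent_le (by norm_num)
    rw [neg_le_neg_iff]
    refine mul_le_mul_of_nonneg_left ?_ hε.le
    push_cast
    rw [abs_of_nonneg (by positivity), show -((n : ℝ) + 1) = -(n + 1) by ring, abs_neg,
      abs_of_nonneg (by positivity)]
    linarith
  exact h2.trans_lt (ENNReal.add_lt_top.2 ⟨key, key⟩)

theorem seqNorm_expKernel_lt_top (hq : 0 < q) {ε : ℝ} (hε : 0 < ε) :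
    seqNorm q (expKernel ε) < ∞ := by
  unfold seqNorm
  split_ifs with h
  · exact (iSup_le fun k => expKernel_le_one hε.le k).trans_lt ENNReal.one_lt_top
  · have hp : 0 < q.toReal := ENNReal.toReal_pos hq.ne' h
    simp_rw [expKernel_rpow]
    exact ENNReal.rpow_lt_top_of_nonneg (inv_nonneg.2 hp.le)
      (tsum_expKernel_lt_top (mul_pos hε hp)).ne

/-- The maximal operator with exponentially decaying kernel is bounded on `ℓ_q`. -/
theorem exists_seqNorm_iSup_expKernel_le (hq : 0 < q) {ε : ℝ} (hε : 0 < ε) :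
    ∃ C : ℝ≥0, ∀ x : ℤ → ℝ≥0∞,
      seqNorm q (fun k => ⨆ j, expKernel ε (j - k) * x j) ≤ C * seqNorm q x := by
  by_cases h : q = ∞
  · refine ⟨1, fun x => ?_⟩
    simp only [seqNorm, h, if_true, ENNReal.coe_one, one_mul]
    refine iSup_le fun k => iSup_mono fun j => ?_
    exact (mul_le_mul_left (expKernel_le_one hε.le _) _).trans_eq (one_mul _)
  · have hp : 0 < q.toReal := ENNReal.toReal_pos hq.ne' h
    have hf := tsum_expKernel_lt_top (mul_pos hε hp)
    refine ⟨(∑' m, expKernel (ε * q.toReal) m).toNNReal ^ (q.toReal)⁻¹, fun x => ?_⟩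
    simp only [seqNorm, h, if_false]
    rw [ENNReal.coe_rpow_of_nonneg _ (inv_nonneg.2 hp.le), ENNReal.coe_toNNReal hf.ne,
      ← ENNReal.mul_rpow_of_nonneg _ _ (inv_nonneg.2 hp.le)]
    gcongr
    -- The power of a supremum is at most the sum of the powers, for every finite `q` including `q <
    -- 1`; after exchanging sums, the kernel's mass no longer depends on `j`.
    calc ∑' k, (⨆ j, expKernel ε (j - k) * x j) ^ q.toReal
        ≤ ∑' k, ∑' j, expKernel (ε * q.toReal) (j - k) * x j ^ q.toReal := by
          refine ENNReal.tsum_le_tsum fun k => ?_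
          rw [← ENNReal.le_rpow_inv_iff hp]
          refine iSup_le fun j => ?_
          rw [ENNReal.le_rpow_inv_iff hp, ENNReal.mul_rpow_of_nonneg _ _ hp.le, expKernel_rpow]
          exact ENNReal.le_tsum (f := fun j => expKernel (ε * q.toReal) (j - k) * x j ^ q.toReal) j
      _ = ∑' j, ∑' k, expKernel (ε * q.toReal) (j - k) * x j ^ q.toReal := ENNReal.tsum_comm
      _ = ∑' j, (∑' m, expKernel (ε * q.toReal) m) * x j ^ q.toReal := by
          refine tsum_congr fun j => ?_
          rw [ENNReal.tsum_mul_right]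
          congr 1
          exact (Equiv.subLeft j).tsum_eq (fun m => expKernel (ε * q.toReal) m)
      _ = _ := ENNReal.tsum_mul_left

theorem indicator_comp_le {S : Set ℤ} (x : ℤ → ℝ≥0∞) (k : ℤ) : S.indicator x k ≤ x k :=
  Set.indicator_le_self' (fun _ _ => zero_le) k

theorem le_headNorm (hq : 0 < q) (x : ℤ → ℝ≥0∞) {j k : ℤ} (h : j ≤ k) : x j ≤ headNorm q x k := by
  have := le_seqNorm hq ((Iic k).indicator x) j
  rwa [indicator_of_mem (show j ∈ Iic k from h)] at this

theorem le_tailNorm (hq : 0 < q) (x : ℤ → ℝ≥0∞) {j k : ℤ} (h : k ≤ j) : x j ≤ tailNorm q x k := by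
  have := le_seqNorm hq ((Ici k).indicator x) j
  rwa [indicator_of_mem (show j ∈ Ici k from h)] at this

theorem seqNorm_indicator_mono {S T : Set ℤ} (x y : ℤ → ℝ≥0∞) (hST : S ⊆ T)
    (h : ∀ k ∈ S, x k ≤ y k) : seqNorm q (S.indicator x) ≤ seqNorm q (T.indicator y) :=
  seqNorm_mono fun k => by
    by_cases hk : k ∈ S
    · simpa [hk, hST hk] using h k hk
    · simp [hk]

theorem seqNorm_indicator_const_mul (hq : 0 < q) (S : Set ℤ) (c : ℝ≥0∞) (x : ℤ → ℝ≥0∞) :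
    seqNorm q (S.indicator fun k => c * x k) = c * seqNorm q (S.indicator x) := by
  rw [← seqNorm_const_mul hq]
  congr 1
  ext k
  by_cases hk : k ∈ S <;> simp [hk]

theorem headNorm_mono_right (x : ℤ → ℝ≥0∞) : Monotone (headNorm q x) := fun _ _ h =>
  seqNorm_indicator_mono x x (Iic_subset_Iic.2 h) fun _ _ => le_rfl

theorem tailNorm_anti_right (x : ℤ → ℝ≥0∞) : Antitone (tailNorm q x) := fun _ _ h =>
  seqNorm_indicator_mono x x (Ici_subset_Ici.2 h) fun _ _ => le_rfl

theorem headNorm_const_mul (hq : 0 < q) (c : ℝ≥0∞) (x : ℤ → ℝ≥0∞) (k : ℤ) :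
    headNorm q (fun j => c * x j) k = c * headNorm q x k := seqNorm_indicator_const_mul hq _ c x

theorem tailNorm_const_mul (hq : 0 < q) (c : ℝ≥0∞) (x : ℤ → ℝ≥0∞) (k : ℤ) :
    tailNorm q (fun j => c * x j) k = c * tailNorm q x k := seqNorm_indicator_const_mul hq _ c x

theorem headNorm_le_seqNorm (x : ℤ → ℝ≥0∞) (k : ℤ) : headNorm q x k ≤ seqNorm q x :=
  seqNorm_mono fun j => indicator_comp_le x j

theorem tailNorm_le_seqNorm (x : ℤ → ℝ≥0∞) (k : ℤ) : tailNorm q x k ≤ seqNorm q x :=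
  seqNorm_mono fun j => indicator_comp_le x j

theorem seqNorm_indicator_comp_add (S T : Set ℤ) (x : ℤ → ℝ≥0∞) (m : ℤ)
    (h : ∀ j, j ∈ S ↔ j + m ∈ T) :
    seqNorm q (S.indicator fun j => x (j + m)) = seqNorm q (T.indicator x) := by
  rw [← seqNorm_comp_add (T.indicator x) m]
  congr 1
  ext j
  by_cases hj : j ∈ S
  · simp [hj, (h j).1 hj]
  · have : j + m ∉ T := fun h' => hj ((h j).2 h')
    simp [hj, this]

theorem headNorm_comp_add (x : ℤ → ℝ≥0∞) (k m : ℤ) :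
    headNorm q (fun j => x (j + m)) k = headNorm q x (k + m) :=
  seqNorm_indicator_comp_add _ _ x m fun j => by simp

theorem tailNorm_comp_add (x : ℤ → ℝ≥0∞) (k m : ℤ) :
    tailNorm q (fun j => x (j + m)) k = tailNorm q x (k + m) :=
  seqNorm_indicator_comp_add _ _ x m fun j => by simp

theorem exists_seqNorm_indicator_add_le (q : ℝ≥0∞) :
    ∃ C : ℝ≥0, ∀ (S : Set ℤ) (x y : ℤ → ℝ≥0∞),
      seqNorm q (S.indicator fun k => x k + y k) ≤
        C * (seqNorm q (S.indicator x) + seqNorm q (S.indicator y)) := by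
  obtain ⟨C, hC⟩ := exists_seqNorm_add_le q
  refine ⟨C, fun S x y => le_trans (le_of_eq ?_) (hC _ _)⟩
  congr 1
  exact Set.indicator_add S x y

section Dom

variable {ι : Type*}

theorem Dom₂.seqNorm (hq : 0 < q) {x y : ι → ℤ → ℝ≥0∞} (h : Dom₂ x y) :
    Dom (fun i => seqNorm q (x i)) (fun i => seqNorm q (y i)) := by
  obtain ⟨C, hC⟩ := h
  exact ⟨C, fun i => (seqNorm_mono (hC i)).trans_eq (seqNorm_const_mul hq _ _)⟩

theorem Dom₂.headNorm (hq : 0 < q) {x y : ι → ℤ → ℝ≥0∞} (h : Dom₂ x y) :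
    Dom₂ (fun i k => headNorm q (x i) k) (fun i k => headNorm q (y i) k) := by
  obtain ⟨C, hC⟩ := h
  exact ⟨C, fun i k => (seqNorm_indicator_mono _ _ subset_rfl fun j _ => hC i j).trans_eq
    (seqNorm_indicator_const_mul hq _ _ _)⟩

theorem Dom₂.tailNorm (hq : 0 < q) {x y : ι → ℤ → ℝ≥0∞} (h : Dom₂ x y) :
    Dom₂ (fun i k => tailNorm q (x i) k) (fun i k => tailNorm q (y i) k) := by
  obtain ⟨C, hC⟩ := h
  exact ⟨C, fun i k => (seqNorm_indicator_mono _ _ subset_rfl fun j _ => hC i j).trans_eq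
    (seqNorm_indicator_const_mul hq _ _ _)⟩

end Dom

/-- Geometric sums: if `A j ≤ c 2 ^ (-ε |j - k|) A k` for `j ∈ S`, then the `ℓ_q` quasi-norm of `A`
over `S` is controlled by `A k`. -/
theorem seqNorm_indicator_le_of_expKernel (hq : 0 < q) {ε : ℝ} {S : Set ℤ} {A : ℤ → ℝ≥0∞}
    {c B : ℝ≥0∞} {k : ℤ} (h : ∀ j ∈ S, A j ≤ c * expKernel ε (j - k) * B) :
    seqNorm q (S.indicator A) ≤ c * seqNorm q (expKernel ε) * B := by
  calc seqNorm q (S.indicator A) ≤ seqNorm q (fun j => (c * B) * expKernel ε (j + -k)) := by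
        refine seqNorm_mono fun j => ?_
        by_cases hj : j ∈ S
        · rw [indicator_of_mem hj]
          exact (h j hj).trans_eq (by rw [sub_eq_add_neg]; ring)
        · simp [hj]
    _ = c * seqNorm q (expKernel ε) * B := by
        rw [seqNorm_const_mul hq, seqNorm_comp_add (expKernel ε) (-k)]
        ring

/-- Hardy's inequality for exponentially growing or decaying weights. -/
theorem exists_hardy {r : ℝ≥0∞} (hq : 0 < q) (hr : 0 < r) {ε : ℝ} (hε : 0 < ε) (c : ℝ≥0)
    (S : ℤ → Set ℤ) (A : ℤ → ℝ≥0∞)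
    (hA : ∀ k, ∀ j ∈ S k, A k ≤ c * expKernel ε (j - k) * A j) :
    ∃ C : ℝ≥0, ∀ x : ℤ → ℝ≥0∞,
      seqNorm r (fun k => A k * seqNorm q ((S k).indicator x)) ≤
        C * seqNorm r (fun k => A k * x k) := by
  -- Half of the decay makes the inner `ℓ_q` sum converge; the other half feeds the maximal operator
  -- acting on `A j * x j`.
  have hε2 : 0 < ε / 2 := half_pos hε
  obtain ⟨D, hD⟩ := exists_seqNorm_iSup_expKernel_le hr hε2
  have hfin := (seqNorm_expKernel_lt_top hq hε2).ne
  refine ⟨c * (seqNorm q (expKernel (ε / 2))).toNNReal * D, fun x => ?_⟩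
  have step : ∀ k, A k * seqNorm q ((S k).indicator x) ≤
      (c * seqNorm q (expKernel (ε / 2))) *
        ⨆ j, expKernel (ε / 2) (j - k) * (A j * x j) := by
    intro k
    rw [← seqNorm_indicator_const_mul hq]
    refine seqNorm_indicator_le_of_expKernel (k := k) hq fun j hj => ?_
    calc A k * x j ≤ (c * expKernel ε (j - k) * A j) * x j := by gcongr; exact hA k j hj
      _ = c * expKernel (ε / 2) (j - k) * (expKernel (ε / 2) (j - k) * (A j * x j)) := by
          nth_rewrite 1 [← add_halves ε]
          rw [expKernel_add]
          ring
      _ ≤ _ := by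
          gcongr
          exact le_iSup (fun j => expKernel (ε / 2) (j - k) * (A j * x j)) j
  calc seqNorm r (fun k => A k * seqNorm q ((S k).indicator x))
      ≤ seqNorm r (fun k => (c * seqNorm q (expKernel (ε / 2))) *
        ⨆ j, expKernel (ε / 2) (j - k) * (A j * x j)) := seqNorm_mono step
    _ = (c * seqNorm q (expKernel (ε / 2))) *
        seqNorm r (fun k => ⨆ j, expKernel (ε / 2) (j - k) * (A j * x j)) :=
        seqNorm_const_mul hr _ _
    _ ≤ (c * seqNorm q (expKernel (ε / 2))) * (D * seqNorm r (fun k => A k * x k)) := by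
        gcongr
        exact hD _
    _ = _ := by
        rw [ENNReal.coe_mul, ENNReal.coe_mul, ENNReal.coe_toNNReal hfin]
        ring

end SeqNorm

/-! ### Regularly varying weights -/

/-- Weights on `(0, ∞)` that are a power `t ^ p` times a slowly varying function. -/
def RegVar (p : ℝ) (w : ℝ → ℝ) : Prop :=
  (∀ t, 0 < t → 0 < w t) ∧ ∀ ε : ℝ, 0 < ε → ∃ C : ℝ, 0 < C ∧ ∀ s t : ℝ, 0 < s → 0 < t →
    w t ≤ C * (t / s) ^ p * max (t / s) (s / t) ^ ε * w s

theorem one_le_max_div {s t : ℝ} (hs : 0 < s) (ht : 0 < t) : 1 ≤ max (t / s) (s / t) := by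
  rcases le_total s t with h | h
  · exact le_max_of_le_left ((one_le_div hs).2 h)
  · exact le_max_of_le_right ((one_le_div ht).2 h)

theorem rpow_div_le_max_rpow {s t : ℝ} (hs : 0 < s) (ht : 0 < t) (p : ℝ) :
    (t / s) ^ p ≤ max (t / s) (s / t) ^ |p| := by
  have h1 : 0 < t / s := div_pos ht hs
  rcases le_total 0 p with h | h
  · rw [abs_of_nonneg h]
    exact Real.rpow_le_rpow h1.le (le_max_left _ _) h
  · rw [abs_of_nonpos h, show (t / s) ^ p = (s / t) ^ (-p) by
      rw [Real.rpow_neg (div_pos hs ht).le, ← Real.inv_rpow (div_pos hs ht).le, inv_div]]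
    exact Real.rpow_le_rpow (div_pos hs ht).le (le_max_right _ _) (neg_nonneg.2 h)

theorem EquivOnPos.almost_monotone {f g : ℝ → ℝ} (hg : MonotoneOn g (Ioi 0))
    (h : EquivOnPos f g) :
    ∃ C : ℝ, 0 < C ∧ ∀ s t : ℝ, 0 < s → s ≤ t → f s ≤ C * f t := by
  obtain ⟨c, C, hc, hC, H⟩ := h
  refine ⟨C / c, div_pos hC hc, fun s t hs hst => ?_⟩
  have ht := hs.trans_le hst
  calc f s ≤ C * g s := (H s hs).2
    _ ≤ C * g t := by gcongr; exact hg hs ht hst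
    _ = C / c * (c * g t) := by field_simp
    _ ≤ _ := by gcongr; exact (H t ht).1

theorem EquivOnPos.almost_antitone {f g : ℝ → ℝ} (hg : AntitoneOn g (Ioi 0))
    (h : EquivOnPos f g) :
    ∃ C : ℝ, 0 < C ∧ ∀ s t : ℝ, 0 < s → s ≤ t → f t ≤ C * f s := by
  obtain ⟨c, C, hc, hC, H⟩ := h
  refine ⟨C / c, div_pos hC hc, fun s t hs hst => ?_⟩
  have ht := hs.trans_le hst
  calc f t ≤ C * g t := (H t ht).2
    _ ≤ C * g s := by gcongr; exact hg hs ht hst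
    _ = C / c * (c * g s) := by field_simp
    _ ≤ _ := by gcongr; exact (H s hs).1

/-- For `s ≤ t` the almost decreasing function `t^{-ε} b` gives `b t / b s ≲ (t/s)^ε`; for `t ≤ s`
the almost increasing `t^ε b` gives `(s/t)^ε`. -/
theorem SlowlyVarying.regVar {b : ℝ → ℝ} (hb : SlowlyVarying b) : RegVar 0 b := by
  refine ⟨hb.pos, fun ε hε => ?_⟩
  obtain ⟨g, hg, hgb⟩ := hb.equiv_increasing ε hε
  obtain ⟨C, hC, H⟩ := hgb.almost_monotone hg
  obtain ⟨g', hg', hgb'⟩ := hb.equiv_decreasing ε hε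
  obtain ⟨D, hD, H'⟩ := hgb'.almost_antitone hg'
  refine ⟨max C D, lt_max_of_lt_left hC, fun s t hs ht => ?_⟩
  have hbs := hb.pos s hs
  have hbt := hb.pos t ht
  rw [Real.rpow_zero, mul_one]
  rcases le_total s t with hst | hst
  · have h1 := H' s t hs hst
    have : b t ≤ D * (t / s) ^ ε * b s := by
      rw [Real.rpow_neg hs.le, Real.rpow_neg ht.le] at h1
      rw [Real.div_rpow ht.le hs.le]
      have hse := Real.rpow_pos_of_pos hs ε
      have hte := Real.rpow_pos_of_pos ht ε
      have := mul_le_mul_of_nonneg_left h1 hte.le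
      calc b t = t ^ ε * ((t ^ ε)⁻¹ * b t) := by field_simp
        _ ≤ _ := this
        _ = _ := by field_simp
    refine this.trans ?_
    gcongr
    · exact le_max_right _ _
    · exact le_max_left _ _
  · have h1 := H t s ht hst
    have : b t ≤ C * (s / t) ^ ε * b s := by
      rw [Real.div_rpow hs.le ht.le]
      have hte := Real.rpow_pos_of_pos ht ε
      calc b t = (t ^ ε * b t) / t ^ ε := by field_simp
        _ ≤ (C * (s ^ ε * b s)) / t ^ ε := by gcongr
        _ = _ := by field_simp
    refine this.trans ?_
    gcongr
    · exact le_max_left _ _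
    · exact le_max_right _ _

namespace RegVar

variable {p p' : ℝ} {w w' : ℝ → ℝ}

theorem congr (h : RegVar p w) (hw : ∀ t, 0 < t → w' t = w t) : RegVar p w' := by
  refine ⟨fun t ht => (hw t ht).symm ▸ h.1 t ht, fun ε hε => ?_⟩
  obtain ⟨C, hC, H⟩ := h.2 ε hε
  refine ⟨C, hC, fun s t hs ht => ?_⟩
  rw [hw s hs, hw t ht]
  exact H s t hs ht

theorem of_eq (h : RegVar p w) (hp : p' = p) : RegVar p' w := hp ▸ h

theorem mul (h : RegVar p w) (h' : RegVar p' w') : RegVar (p + p') (fun t => w t * w' t) := by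
  refine ⟨fun t ht => mul_pos (h.1 t ht) (h'.1 t ht), fun ε hε => ?_⟩
  obtain ⟨C, hC, H⟩ := h.2 (ε / 2) (half_pos hε)
  obtain ⟨D, hD, H'⟩ := h'.2 (ε / 2) (half_pos hε)
  refine ⟨C * D, mul_pos hC hD, fun s t hs ht => ?_⟩
  have hm : 0 < max (t / s) (s / t) := one_pos.trans_le (one_le_max_div hs ht)
  refine (mul_le_mul (H s t hs ht) (H' s t hs ht) (h'.1 t ht).le ?_).trans_eq ?_
  · exact (h.1 t ht).le.trans (H s t hs ht)
  · rw [Real.rpow_add (div_pos ht hs)]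
    nth_rewrite 3 [← add_halves ε]
    rw [Real.rpow_add hm]
    ring

theorem inv (h : RegVar p w) : RegVar (-p) (fun t => (w t)⁻¹) := by
  refine ⟨fun t ht => inv_pos.2 (h.1 t ht), fun ε hε => ?_⟩
  obtain ⟨C, hC, H⟩ := h.2 ε hε
  refine ⟨C, hC, fun s t hs ht => ?_⟩
  have h1 := H t s ht hs
  have hws := h.1 s hs
  have hwt := h.1 t ht
  have hd := div_pos ht hs
  rw [max_comm] at h1
  have h2 : (s / t) ^ p = (t / s) ^ (-p) := by
    rw [Real.rpow_neg hd.le, ← Real.inv_rpow hd.le, inv_div]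
  rw [h2] at h1
  beta_reduce
  rw [← div_eq_mul_inv, inv_eq_one_div, div_le_div_iff₀ hwt hws, one_mul]
  exact h1

theorem rpow_nonneg (h : RegVar p w) {c : ℝ} (hc : 0 ≤ c) : RegVar (c * p) (fun t => w t ^ c) := by
  refine ⟨fun t ht => Real.rpow_pos_of_pos (h.1 t ht) c, fun ε hε => ?_⟩
  -- Raising to the power `c` turns this exponent into `cε/(c + 1) ≤ ε`; the `+ 1` admits `c = 0`.
  obtain ⟨C, hC, H⟩ := h.2 (ε / (c + 1)) (div_pos hε (by linarith))
  refine ⟨C ^ c, Real.rpow_pos_of_pos hC c, fun s t hs ht => ?_⟩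
  have hm := one_le_max_div hs ht
  have hm0 : 0 < max (t / s) (s / t) := one_pos.trans_le hm
  have hd := div_pos ht hs
  refine (Real.rpow_le_rpow (h.1 t ht).le (H s t hs ht) hc).trans ?_
  have hws := (h.1 s hs).le
  rw [Real.mul_rpow (by positivity) hws, Real.mul_rpow (by positivity) (by positivity),
    Real.mul_rpow (by positivity) (by positivity), ← Real.rpow_mul hd.le, ← Real.rpow_mul hm0.le,
    mul_comm p c]
  gcongr ?_ * ?_ * _
  · refine Real.rpow_le_rpow_of_exponent_le hm ?_
    rw [div_mul_eq_mul_div, div_le_iff₀ (by linarith)]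
    nlinarith

theorem rpow (h : RegVar p w) (c : ℝ) : RegVar (c * p) (fun t => w t ^ c) := by
  rcases le_total 0 c with hc | hc
  · exact h.rpow_nonneg hc
  · refine ((h.rpow_nonneg (neg_nonneg.2 hc)).inv.congr fun t ht => ?_).of_eq (by ring)
    rw [Real.rpow_neg (h.1 t ht).le, inv_inv]

theorem id_rpow (c : ℝ) : RegVar c (fun t => t ^ c) := by
  refine ⟨fun t ht => Real.rpow_pos_of_pos ht c, fun ε hε => ⟨1, one_pos, fun s t hs ht => ?_⟩⟩
  have hm := Real.one_le_rpow (one_le_max_div hs ht) hε.le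
  rw [one_mul, Real.div_rpow ht.le hs.le]
  have hsc := Real.rpow_pos_of_pos hs c
  have htc := Real.rpow_pos_of_pos ht c
  calc t ^ c = t ^ c / s ^ c * 1 * s ^ c := by field_simp
    _ ≤ _ := by gcongr

theorem exists_le_of_ratio (h : RegVar p w) {Λ : ℝ} (hΛ : 1 ≤ Λ) :
    ∃ C : ℝ, 0 < C ∧ ∀ s t : ℝ, 0 < s → 0 < t → t ≤ Λ * s → s ≤ Λ * t → w t ≤ C * w s := by
  obtain ⟨C, hC, H⟩ := h.2 1 one_pos
  have hΛ0 : 0 < Λ := one_pos.trans_le hΛ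
  refine ⟨C * Λ ^ |p| * Λ, by positivity, fun s t hs ht h1 h2 => (H s t hs ht).trans ?_⟩
  have hws := (h.1 s hs).le
  have hm : max (t / s) (s / t) ≤ Λ := max_le ((div_le_iff₀ hs).2 h1) ((div_le_iff₀ ht).2 h2)
  have hm0 : 0 < max (t / s) (s / t) := one_pos.trans_le (one_le_max_div hs ht)
  have := rpow_div_le_max_rpow hs ht p
  rw [Real.rpow_one]
  gcongr
  exact this.trans (Real.rpow_le_rpow hm0.le hm (abs_nonneg p))

/-- Ratios of values of `ρ` are at most a fixed power `β = |p| + 1` of the ratio of arguments, so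
the bound for `a` with exponent `ε/β` suffices. -/
theorem comp {a ρ : ℝ → ℝ} (ha : RegVar 0 a) (hρ : RegVar p ρ) :
    RegVar 0 (fun t => a (ρ t)) := by
  refine ⟨fun t ht => ha.1 _ (hρ.1 t ht), fun ε hε => ?_⟩
  set β := |p| + 1 with hβ
  have hβ0 : 0 < β := by positivity
  obtain ⟨C, hC, H⟩ := ha.2 (ε / β) (div_pos hε hβ0)
  obtain ⟨D, hD, H'⟩ := hρ.2 1 one_pos
  refine ⟨C * D ^ (ε / β), by positivity, fun s t hs ht => ?_⟩
  have key : ∀ s t : ℝ, 0 < s → 0 < t → ρ t / ρ s ≤ D * max (t / s) (s / t) ^ β := by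
    intro s t hs ht
    have hm0 : 0 < max (t / s) (s / t) := one_pos.trans_le (one_le_max_div hs ht)
    rw [div_le_iff₀ (hρ.1 s hs)]
    refine (H' s t hs ht).trans ?_
    have := hρ.1 s hs
    rw [hβ, Real.rpow_add hm0, mul_assoc D]
    rw [Real.rpow_one]
    exact mul_le_mul_of_nonneg_right (mul_le_mul_of_nonneg_left (mul_le_mul_of_nonneg_right
      (rpow_div_le_max_rpow hs ht p) hm0.le) hD.le) this.le
  have hm0 : 0 < max (t / s) (s / t) := one_pos.trans_le (one_le_max_div hs ht)
  have hR : max (ρ t / ρ s) (ρ s / ρ t) ≤ D * max (t / s) (s / t) ^ β := by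
    refine max_le (key s t hs ht) ?_
    rw [max_comm]
    exact key t s ht hs
  refine (H _ _ (hρ.1 s hs) (hρ.1 t ht)).trans ?_
  have hpos := ha.1 _ (hρ.1 s hs)
  have hR0 := one_pos.trans_le (one_le_max_div (hρ.1 s hs) (hρ.1 t ht))
  rw [Real.rpow_zero, Real.rpow_zero, mul_one, mul_one]
  gcongr ?_ * _
  calc C * max (ρ t / ρ s) (ρ s / ρ t) ^ (ε / β)
      ≤ C * (D * max (t / s) (s / t) ^ β) ^ (ε / β) := by gcongr
    _ = _ := by
        rw [Real.mul_rpow hD.le (by positivity), ← Real.rpow_mul hm0.le,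
          mul_div_cancel₀ _ hβ0.ne', mul_assoc]

end RegVar

/-! ### Dyadic samples -/

/-- The sequence of dyadic samples `w(2 ^ k)`. -/
noncomputable def sample (w : ℝ → ℝ) (k : ℤ) : ℝ≥0∞ := ENNReal.ofReal (w (2 ^ k))

/-- The dyadic interval `[2 ^ k, 2 ^ (k + 1))`. -/
def cell (k : ℤ) : Set ℝ := Ico ((2 : ℝ) ^ k) (2 ^ (k + 1))

theorem pos_of_mem_cell {k : ℤ} {t : ℝ} (ht : t ∈ cell k) : 0 < t :=
  (zpow_pos (by norm_num) k).trans_le ht.1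

theorem exists_mem_cell {t : ℝ} (ht : 0 < t) : ∃ k, t ∈ cell k :=
  exists_mem_Ico_zpow ht (by norm_num)

theorem zpow_mem_cell (k : ℤ) : (2 : ℝ) ^ k ∈ cell k :=
  ⟨le_rfl, zpow_lt_zpow_right₀ (by norm_num) (by omega)⟩

theorem lt_two_mul_of_mem_cell {k : ℤ} {t : ℝ} (ht : t ∈ cell k) : t < 2 * 2 ^ k := by
  have := ht.2
  rwa [zpow_add_one₀ (by norm_num), mul_comm] at this

theorem le_of_cell {j k : ℤ} {s t : ℝ} (hs : s ∈ cell j) (ht : t ∈ cell k) (h : s ≤ t) : j ≤ k := by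
  have h1 := (hs.1.trans h).trans_lt ht.2
  have := (zpow_lt_zpow_iff_right₀ (by norm_num : (1 : ℝ) < 2)).1 h1
  omega

theorem lt_of_cell {j k : ℤ} {s t : ℝ} (hs : s ∈ cell j) (ht : t ∈ cell k) (h : j < k) : s < t :=
  (hs.2.trans_le (zpow_le_zpow_right₀ (by norm_num) (by omega))).trans_le ht.1

theorem sample_mul {w w' : ℝ → ℝ} {k : ℤ} (h : 0 ≤ w (2 ^ k)) :
    sample (fun t => w t * w' t) k = sample w k * sample w' k := ENNReal.ofReal_mul h

namespace RegVar

variable {p : ℝ} {w : ℝ → ℝ}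

theorem sample_pos (h : RegVar p w) (k : ℤ) : 0 < sample w k :=
  ENNReal.ofReal_pos.2 (h.1 _ (zpow_pos (by norm_num) k))

theorem max_zpow (j k : ℤ) :
    max ((2 : ℝ) ^ j / 2 ^ k) (2 ^ k / 2 ^ j) = (2 : ℝ) ^ |((j - k : ℤ) : ℝ)| := by
  rw [← zpow_sub₀ two_ne_zero, ← zpow_sub₀ two_ne_zero, ← Real.rpow_intCast, ← Real.rpow_intCast,
    abs_eq_max_neg, (Real.monotone_rpow_of_base_ge_one (by norm_num)).map_max]
  push_cast
  rw [neg_sub]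

theorem exists_sample_le (h : RegVar p w) {ε : ℝ} (hε : 0 < ε) :
    ∃ C : ℝ≥0, ∀ j k : ℤ, sample w j ≤
      C * (2 : ℝ≥0∞) ^ (p * ((j - k : ℤ) : ℝ) + ε * |((j - k : ℤ) : ℝ)|) * sample w k := by
  obtain ⟨C, hC, H⟩ := h.2 ε hε
  refine ⟨C.toNNReal, fun j k => ?_⟩
  have h1 := H (2 ^ k) (2 ^ j) (zpow_pos (by norm_num) k) (zpow_pos (by norm_num) j)
  rw [max_zpow, ← zpow_sub₀ two_ne_zero, ← Real.rpow_intCast 2 (j - k), ← Real.rpow_mul (by norm_num),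
    ← Real.rpow_mul (by norm_num), mul_assoc C, ← Real.rpow_add (by norm_num),
    mul_comm _ p, mul_comm _ ε] at h1
  refine (ENNReal.ofReal_le_ofReal h1).trans_eq ?_
  rw [ENNReal.ofReal_mul (by positivity), ENNReal.ofReal_mul hC.le,
    ← ENNReal.ofReal_rpow_of_pos (by norm_num)]
  simp [sample, ENNReal.ofReal]

/-- Half of the exponent `|p|` pays for the slowly varying factor; the other half remains as
geometric decay. The sign condition says that moving from `k` to `j` goes in the direction in which
`t^p` decreases. -/
theorem exists_sample_le_expKernel (h : RegVar p w) (hp : p ≠ 0) :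
    ∃ C : ℝ≥0, ∀ j k : ℤ, 0 ≤ p * ((k - j : ℤ) : ℝ) →
      sample w j ≤ C * expKernel (|p| / 2) (j - k) * sample w k := by
  obtain ⟨C, H⟩ := h.exists_sample_le (ε := |p| / 2) (by positivity)
  refine ⟨C, fun j k hjk => (H j k).trans_eq ?_⟩
  rw [expKernel]
  congr 3
  have h1 : p * ((j - k : ℤ) : ℝ) = -(|p| * |((j - k : ℤ) : ℝ)|) := by
    rw [← abs_mul, abs_of_nonpos]
    · ring
    · push_cast at hjk ⊢; linarith
  rw [h1]; ring

theorem exists_sample_le_sv (h : RegVar 0 w) {ε : ℝ} (hε : 0 < ε) :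
    ∃ C : ℝ≥0, ∀ j k : ℤ, sample w j ≤ C * (expKernel ε (j - k))⁻¹ * sample w k := by
  obtain ⟨C, H⟩ := h.exists_sample_le hε
  refine ⟨C, fun j k => (H j k).trans_eq ?_⟩
  rw [expKernel, ← ENNReal.rpow_neg, zero_mul, zero_add, neg_neg]

theorem exists_headNorm_sample_le {q : ℝ≥0∞} (hq : 0 < q) (h : RegVar p w) (hp : 0 < p) :
    ∃ C : ℝ≥0, ∀ k, headNorm q (sample w) k ≤ C * sample w k := by
  obtain ⟨C, H⟩ := h.exists_sample_le_expKernel hp.ne'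
  have hfin := (seqNorm_expKernel_lt_top hq (ε := |p| / 2) (by positivity)).ne
  refine ⟨C * (seqNorm q (expKernel (|p| / 2))).toNNReal, fun k => ?_⟩
  rw [ENNReal.coe_mul, ENNReal.coe_toNNReal hfin]
  refine seqNorm_indicator_le_of_expKernel hq fun j hj => H j k ?_
  have : (j : ℝ) ≤ k := by exact_mod_cast hj
  push_cast
  exact mul_nonneg hp.le (by linarith)

theorem exists_tailNorm_sample_le {q : ℝ≥0∞} (hq : 0 < q) (h : RegVar p w) (hp : p < 0) :
    ∃ C : ℝ≥0, ∀ k, tailNorm q (sample w) k ≤ C * sample w k := by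
  obtain ⟨C, H⟩ := h.exists_sample_le_expKernel hp.ne
  have hfin := (seqNorm_expKernel_lt_top hq (ε := |p| / 2) (by simpa using hp.ne)).ne
  refine ⟨C * (seqNorm q (expKernel (|p| / 2))).toNNReal, fun k => ?_⟩
  rw [ENNReal.coe_mul, ENNReal.coe_toNNReal hfin]
  refine seqNorm_indicator_le_of_expKernel hq fun j hj => H j k ?_
  have : (k : ℝ) ≤ j := by exact_mod_cast hj
  push_cast
  exact mul_nonneg_of_nonpos_of_nonpos hp.le (by linarith)

/-- Hardy's inequality for the head norm, with a decaying outer weight. -/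
theorem exists_hardy_head {q r : ℝ≥0∞} (hq : 0 < q) (hr : 0 < r) (h : RegVar p w) (hp : p < 0) :
    ∃ C : ℝ≥0, ∀ x : ℤ → ℝ≥0∞, seqNorm r (fun k => sample w k * headNorm q x k) ≤
      C * seqNorm r (fun k => sample w k * x k) := by
  obtain ⟨C, H⟩ := h.exists_sample_le_expKernel hp.ne
  refine exists_hardy hq hr (ε := |p| / 2) (by simpa using hp.ne) C Iic (sample w)
    fun k j hj => ?_
  have h1 : (j : ℝ) ≤ k := by exact_mod_cast hj
  have := H k j (by push_cast; exact mul_nonneg_of_nonpos_of_nonpos hp.le (by linarith))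
  rwa [← expKernel_neg, neg_sub] at this

/-- Hardy's inequality for the tail norm, with a growing outer weight. -/
theorem exists_hardy_tail {q r : ℝ≥0∞} (hq : 0 < q) (hr : 0 < r) (h : RegVar p w) (hp : 0 < p) :
    ∃ C : ℝ≥0, ∀ x : ℤ → ℝ≥0∞, seqNorm r (fun k => sample w k * tailNorm q x k) ≤
      C * seqNorm r (fun k => sample w k * x k) := by
  obtain ⟨C, H⟩ := h.exists_sample_le_expKernel hp.ne'
  refine exists_hardy hq hr (ε := |p| / 2) (by positivity) C Ici (sample w)
    fun k j hj => ?_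
  have h1 : (k : ℝ) ≤ j := by exact_mod_cast hj
  have := H k j (by push_cast; exact mul_nonneg hp.le (by linarith))
  rwa [← expKernel_neg, neg_sub] at this

end RegVar

/-! ### Comparison of functions with sequences on dyadic intervals. -/

/-- The family `F` is comparable with `x i k` on the dyadic interval of index `k`. -/
def CellEqv {ι : Type*} (F : ι → ℝ → ℝ≥0∞) (x : ι → ℤ → ℝ≥0∞) : Prop :=
  ∃ C : ℝ≥0, ∀ i k, ∀ t ∈ cell k, F i t ≤ C * x i k ∧ x i k ≤ C * F i t

/-- Neighbouring terms are comparable. -/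
def Doubling {ι : Type*} (x : ι → ℤ → ℝ≥0∞) : Prop :=
  ∃ C : ℝ≥0, ∀ i k, x i (k + 1) ≤ C * x i k ∧ x i k ≤ C * x i (k + 1)

section CellEqv

variable {ι : Type*} {F G : ι → ℝ → ℝ≥0∞} {x y : ι → ℤ → ℝ≥0∞}

theorem CellEqv.mul (h : CellEqv F x) (h' : CellEqv G y) :
    CellEqv (fun i t => F i t * G i t) (fun i k => x i k * y i k) := by
  obtain ⟨C, hC⟩ := h
  obtain ⟨D, hD⟩ := h'
  refine ⟨C * D, fun i k t ht => ⟨?_, ?_⟩⟩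
  · refine (mul_le_mul' (hC i k t ht).1 (hD i k t ht).1).trans_eq ?_
    rw [ENNReal.coe_mul]; ring
  · refine (mul_le_mul' (hC i k t ht).2 (hD i k t ht).2).trans_eq ?_
    rw [ENNReal.coe_mul]; ring

theorem Doubling.mul (h : Doubling x) (h' : Doubling y) :
    Doubling (fun i k => x i k * y i k) := by
  obtain ⟨C, hC⟩ := h
  obtain ⟨D, hD⟩ := h'
  refine ⟨C * D, fun i k => ⟨?_, ?_⟩⟩
  · refine (mul_le_mul' (hC i k).1 (hD i k).1).trans_eq ?_
    rw [ENNReal.coe_mul]; ring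
  · refine (mul_le_mul' (hC i k).2 (hD i k).2).trans_eq ?_
    rw [ENNReal.coe_mul]; ring

theorem RegVar.cellEqv {p : ℝ} {w : ℝ → ℝ} (h : RegVar p w) :
    CellEqv (fun (_ : ι) t => ENNReal.ofReal (w t)) (fun _ => sample w) := by
  obtain ⟨C, hC, H⟩ := h.exists_le_of_ratio (Λ := 2) (by norm_num)
  refine ⟨C.toNNReal, fun _ k t ht => ?_⟩
  have h0 := pos_of_mem_cell ht
  have h1 := ht.1
  have h2 := (lt_two_mul_of_mem_cell ht).le
  have hk : (0 : ℝ) < 2 ^ k := zpow_pos (by norm_num) k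
  have e : ((C.toNNReal : ℝ≥0) : ℝ≥0∞) = ENNReal.ofReal C := rfl
  constructor
  · unfold sample
    rw [e, ← ENNReal.ofReal_mul hC.le]
    exact ENNReal.ofReal_le_ofReal (H _ _ hk h0 h2 (by linarith))
  · unfold sample
    rw [e, ← ENNReal.ofReal_mul hC.le]
    exact ENNReal.ofReal_le_ofReal (H _ _ h0 hk (by linarith) h2)

theorem RegVar.doubling {p : ℝ} {w : ℝ → ℝ} (h : RegVar p w) :
    Doubling (fun (_ : ι) => sample w) := by
  obtain ⟨C, hC, H⟩ := h.exists_le_of_ratio (Λ := 2) (by norm_num)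
  refine ⟨C.toNNReal, fun _ k => ?_⟩
  have hk : (0 : ℝ) < 2 ^ k := zpow_pos (by norm_num) k
  have hk' : (2 : ℝ) ^ (k + 1) = 2 * 2 ^ k := by rw [zpow_add_one₀ (by norm_num), mul_comm]
  have e : ((C.toNNReal : ℝ≥0) : ℝ≥0∞) = ENNReal.ofReal C := rfl
  constructor
  · unfold sample
    rw [e, ← ENNReal.ofReal_mul hC.le]
    exact ENNReal.ofReal_le_ofReal (H _ _ hk (by positivity) (by linarith) (by linarith))
  · unfold sample
    rw [e, ← ENNReal.ofReal_mul hC.le]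
    exact ENNReal.ofReal_le_ofReal (H _ _ (by positivity) hk (by linarith) (by linarith))

/-- The head up to `k + 1` is the head up to `k` of the shifted sequence, whose terms are comparable
with the original ones; the reverse bound is monotonicity. -/
theorem Doubling.headNorm {q : ℝ≥0∞} (hq : 0 < q) (h : Doubling x) :
    Doubling (fun i => headNorm q (x i)) := by
  obtain ⟨C, hC⟩ := h
  refine ⟨max C 1, fun i k => ⟨?_, ?_⟩⟩
  · beta_reduce
    rw [← headNorm_comp_add, ← headNorm_const_mul hq]
    refine seqNorm_indicator_mono _ _ subset_rfl fun j _ => (hC i j).1.trans ?_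
    gcongr
    exact le_max_left _ _
  · refine (headNorm_mono_right (x i) (by omega : k ≤ k + 1)).trans ?_
    exact le_mul_of_one_le_left' (by exact_mod_cast le_max_right C 1)

theorem Doubling.tailNorm {q : ℝ≥0∞} (hq : 0 < q) (h : Doubling x) :
    Doubling (fun i => tailNorm q (x i)) := by
  obtain ⟨C, hC⟩ := h
  refine ⟨max C 1, fun i k => ⟨?_, ?_⟩⟩
  · refine (tailNorm_anti_right (x i) (by omega : k ≤ k + 1)).trans ?_
    exact le_mul_of_one_le_left' (by exact_mod_cast le_max_right C 1)
  · beta_reduce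
    rw [← tailNorm_comp_add, ← tailNorm_const_mul hq]
    refine seqNorm_indicator_mono _ _ subset_rfl fun j _ => (hC i j).2.trans ?_
    gcongr
    exact le_max_left _ _

end CellEqv

/-! ### Discretization of weighted Lebesgue quasi-norms -/

theorem volume_cell (k : ℤ) : volume (cell k) = ENNReal.ofReal (2 ^ k) := by
  rw [cell, Real.volume_Ico]
  congr 1
  rw [zpow_add_one₀ (by norm_num)]
  ring

theorem pairwise_disjoint_cell : Pairwise (Function.onFun Disjoint cell) := by
  intro j k hjk
  refine Set.disjoint_left.2 fun t hj hk => hjk ?_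
  exact le_antisymm (le_of_cell hj hk le_rfl) (le_of_cell hk hj le_rfl)

section Discretization

variable {q : ℝ≥0∞} {α : ℝ} {w : ℝ → ℝ} {F : ℝ → ℝ≥0∞} {I : Set ℝ}

/-- The exponent `-1/q` becomes the density `1/u`, so the norm is taken with respect to `du/u`, for
which all dyadic intervals have the same mass. -/
theorem weightedNorm_integrand_rpow (hq : 0 < q) (hq' : q ≠ ∞) {u : ℝ} (hu : 0 < u) :
    (ENNReal.ofReal (u ^ (α - (q⁻¹).toReal) * w u) * F u) ^ q.toReal =
      (ENNReal.ofReal u)⁻¹ * (ENNReal.ofReal (u ^ α * w u) * F u) ^ q.toReal := by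
  have hp : 0 < q.toReal := ENNReal.toReal_pos hq.ne' hq'
  rw [Real.rpow_sub hu, div_eq_inv_mul, mul_assoc, ENNReal.ofReal_mul (by positivity), mul_assoc,
    ENNReal.mul_rpow_of_nonneg _ _ hp.le]
  congr 1
  rw [ENNReal.toReal_inv, ← Real.rpow_neg hu.le, ← ENNReal.ofReal_rpow_of_pos hu,
    ← ENNReal.rpow_mul, neg_mul, inv_mul_cancel₀ hp.ne', ENNReal.rpow_neg_one]

/-- On the cell of index `k` the density is at most `2^{-k}` and the length is `2^k`, so the cell
contributes at most `x k ^ q`. Only comparison with constants on cells occurs, so measurability of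
`F` plays no role. -/
theorem weightedNorm_le_seqNorm (hq : 0 < q) (hI : MeasurableSet I) (hI0 : I ⊆ Ioi 0)
    (x : ℤ → ℝ≥0∞)
    (h : ∀ k, ∀ u ∈ cell k, u ∈ I → ENNReal.ofReal (u ^ α * w u) * F u ≤ x k) :
    weightedNorm q α w F I ≤ seqNorm q x := by
  unfold weightedNorm seqNorm
  split_ifs with hq'
  · subst hq'
    rw [eLpNorm_exponent_top, eLpNormEssSup]
    refine essSup_le_of_ae_le _ ((ae_restrict_iff' hI).2 (ae_of_all _ fun u hu => ?_))
    obtain ⟨k, hk⟩ := exists_mem_cell (hI0 hu)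
    simp only [ENNReal.inv_top, ENNReal.toReal_zero, sub_zero, enorm_eq_self]
    exact (h k u hk hu).trans (le_iSup x k)
  · have hp : 0 < q.toReal := ENNReal.toReal_pos hq.ne' hq'
    rw [eLpNorm_eq_lintegral_rpow_enorm_toReal hq.ne' hq', one_div]
    gcongr
    simp only [enorm_eq_self]
    calc ∫⁻ u in I, (ENNReal.ofReal (u ^ (α - (q⁻¹).toReal) * w u) * F u) ^ q.toReal
        ≤ ∫⁻ u in ⋃ k, cell k ∩ I,
            (ENNReal.ofReal (u ^ (α - (q⁻¹).toReal) * w u) * F u) ^ q.toReal := by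
          refine lintegral_mono_set fun u hu => ?_
          obtain ⟨k, hk⟩ := exists_mem_cell (hI0 hu)
          exact mem_iUnion.2 ⟨k, hk, hu⟩
      _ = ∑' k, ∫⁻ u in cell k ∩ I,
            (ENNReal.ofReal (u ^ (α - (q⁻¹).toReal) * w u) * F u) ^ q.toReal :=
          lintegral_iUnion (fun k => measurableSet_Ico.inter hI)
            (fun j k hjk => (pairwise_disjoint_cell hjk).mono inter_subset_left inter_subset_left) _
      _ ≤ ∑' k, x k ^ q.toReal := by
          refine ENNReal.tsum_le_tsum fun k => ?_
          calc ∫⁻ u in cell k ∩ I,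
                (ENNReal.ofReal (u ^ (α - (q⁻¹).toReal) * w u) * F u) ^ q.toReal
              ≤ ∫⁻ _ in cell k ∩ I, (ENNReal.ofReal (2 ^ k))⁻¹ * x k ^ q.toReal := by
                refine setLIntegral_mono' (measurableSet_Ico.inter hI) fun u hu => ?_
                rw [weightedNorm_integrand_rpow hq hq' (pos_of_mem_cell hu.1)]
                gcongr
                · exact hu.1.1
                · exact h k u hu.1 hu.2
            _ ≤ ∫⁻ _ in cell k, (ENNReal.ofReal (2 ^ k))⁻¹ * x k ^ q.toReal :=
                lintegral_mono_set inter_subset_left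
            _ = x k ^ q.toReal := by
                rw [setLIntegral_const, volume_cell, mul_comm, ← mul_assoc, ENNReal.mul_inv_cancel,
                  one_mul]
                · exact (ENNReal.ofReal_pos.2 (zpow_pos (by norm_num) k)).ne'
                · exact ENNReal.ofReal_ne_top

/-- The density is at least `2^{-(k+1)}` on a cell of length `2^k`; this mass `1/2` is the source of
the constant `2^{1/q}`. Indices with `x k = 0` are exempt, so that `x` can be cut off to the cells
contained in `I`. -/
theorem exists_seqNorm_le_weightedNorm (hq : 0 < q) :
    ∃ C : ℝ≥0, ∀ (α : ℝ) (w : ℝ → ℝ) (F : ℝ → ℝ≥0∞) (I : Set ℝ) (x : ℤ → ℝ≥0∞),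
      MeasurableSet I → (∀ k, x k ≠ 0 → cell k ⊆ I ∧
        ∀ u ∈ cell k, x k ≤ ENNReal.ofReal (u ^ α * w u) * F u) →
      seqNorm q x ≤ C * weightedNorm q α w F I := by
  refine ⟨2 ^ (q.toReal)⁻¹, fun α w F I x hI h => ?_⟩
  unfold weightedNorm seqNorm
  split_ifs with hq'
  · subst hq'
    rw [eLpNorm_exponent_top, eLpNormEssSup]
    simp only [ENNReal.inv_top, ENNReal.toReal_zero, sub_zero, enorm_eq_self, ENNReal.toReal_top,
      inv_zero, NNReal.rpow_zero, ENNReal.coe_one, one_mul]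
    refine iSup_le fun k => ?_
    by_cases hk : x k = 0
    · simp [hk]
    · obtain ⟨h1, h2⟩ := h k hk
      have hv : (volume.restrict (cell k)) ≠ 0 := by
        rw [Ne, Measure.restrict_eq_zero, volume_cell]
        exact (ENNReal.ofReal_pos.2 (zpow_pos (by norm_num) k)).ne'
      calc x k = essSup (fun _ : ℝ => x k) (volume.restrict (cell k)) :=
            (essSup_const _ hv).symm
        _ ≤ essSup (fun u => ENNReal.ofReal (u ^ α * w u) * F u) (volume.restrict (cell k)) :=
            essSup_mono_ae ((ae_restrict_iff' measurableSet_Ico).2 (ae_of_all _ h2))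
        _ ≤ _ := essSup_mono_measure (Measure.restrict_mono h1 le_rfl).absolutelyContinuous
  · have hp : 0 < q.toReal := ENNReal.toReal_pos hq.ne' hq'
    rw [eLpNorm_eq_lintegral_rpow_enorm_toReal hq.ne' hq', one_div,
      ENNReal.coe_rpow_of_nonneg _ (inv_nonneg.2 hp.le),
      ← ENNReal.mul_rpow_of_nonneg _ _ (inv_nonneg.2 hp.le)]
    gcongr
    simp only [enorm_eq_self]
    calc ∑' k, x k ^ q.toReal
        ≤ ∑' k, ((2 : ℝ≥0) : ℝ≥0∞) * ∫⁻ u in cell k ∩ I,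
            (ENNReal.ofReal (u ^ (α - (q⁻¹).toReal) * w u) * F u) ^ q.toReal := by
          refine ENNReal.tsum_le_tsum fun k => ?_
          by_cases hk : x k = 0
          · simp [hk, hp]
          · obtain ⟨h1, h2⟩ := h k hk
            rw [inter_eq_left.2 h1]
            have hk0 : ENNReal.ofReal (2 ^ k) ≠ 0 :=
              (ENNReal.ofReal_pos.2 (zpow_pos (by norm_num) k)).ne'
            calc x k ^ q.toReal
                = ((2 : ℝ≥0) : ℝ≥0∞) *
                    ∫⁻ _ in cell k, (ENNReal.ofReal (2 ^ (k + 1)))⁻¹ * x k ^ q.toReal := by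
                  rw [setLIntegral_const, volume_cell, zpow_add_one₀ (by norm_num),
                    ENNReal.ofReal_mul (by positivity),
                    ENNReal.mul_inv (Or.inl hk0) (Or.inl ENNReal.ofReal_ne_top)]
                  have e2 : ENNReal.ofReal 2 = 2 := by simp
                  rw [e2]
                  calc x k ^ q.toReal = (2 * 2⁻¹) * ((ENNReal.ofReal (2 ^ k))⁻¹ *
                        ENNReal.ofReal (2 ^ k)) * x k ^ q.toReal := by
                        rw [ENNReal.mul_inv_cancel two_ne_zero ENNReal.ofNat_ne_top,
                          ENNReal.inv_mul_cancel hk0 ENNReal.ofReal_ne_top, one_mul, one_mul]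
                    _ = _ := by push_cast; ring
              _ ≤ _ := by
                  refine mul_le_mul' le_rfl ?_
                  refine setLIntegral_mono' (measurableSet_Ico : MeasurableSet (cell k)) fun u hu => ?_
                  rw [weightedNorm_integrand_rpow hq hq' (pos_of_mem_cell hu)]
                  gcongr
                  · exact hu.2.le
                  · exact h2 u hu
      _ = ((2 : ℝ≥0) : ℝ≥0∞) * ∫⁻ u in ⋃ k, cell k ∩ I,
            (ENNReal.ofReal (u ^ (α - (q⁻¹).toReal) * w u) * F u) ^ q.toReal := by
          rw [ENNReal.tsum_mul_left]
          congr 1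
          exact (lintegral_iUnion (fun k => measurableSet_Ico.inter hI)
            (fun j k hjk => (pairwise_disjoint_cell hjk).mono inter_subset_left inter_subset_left)
            _).symm
      _ ≤ _ := by
          gcongr
          exact iUnion_subset fun k => inter_subset_right

end Discretization

/-- A nonzero constant can be inverted in `ℝ≥0∞` and moved across an inequality. -/
theorem CellEqv.exists_ne_zero {ι : Type*} {F : ι → ℝ → ℝ≥0∞} {x : ι → ℤ → ℝ≥0∞}
    (h : CellEqv F x) :
    ∃ C : ℝ≥0, C ≠ 0 ∧ ∀ i k, ∀ t ∈ cell k, F i t ≤ C * x i k ∧ x i k ≤ C * F i t := by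
  obtain ⟨C, hC⟩ := h
  have hle : (C : ℝ≥0∞) ≤ (max C 1 : ℝ≥0) := by exact_mod_cast le_max_left C 1
  refine ⟨max C 1, (one_pos.trans_le (le_max_right _ _)).ne', fun i k t ht => ⟨?_, ?_⟩⟩
  · exact (hC i k t ht).1.trans (by gcongr)
  · exact (hC i k t ht).2.trans (by gcongr)

theorem exists_seqNorm_le_mul_weightedNorm {q : ℝ≥0∞} (hq : 0 < q) {c : ℝ≥0} (hc : c ≠ 0) :
    ∃ C : ℝ≥0, ∀ (α : ℝ) (w : ℝ → ℝ) (F : ℝ → ℝ≥0∞) (I : Set ℝ) (S : Set ℤ) (x : ℤ → ℝ≥0∞),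
      MeasurableSet I → (∀ k ∈ S, cell k ⊆ I ∧
        ∀ u ∈ cell k, x k ≤ c * (ENNReal.ofReal (u ^ α * w u) * F u)) →
      seqNorm q (S.indicator x) ≤ C * weightedNorm q α w F I := by
  obtain ⟨C, hC⟩ := exists_seqNorm_le_weightedNorm hq
  have hc0 : (c : ℝ≥0∞) ≠ 0 := by exact_mod_cast hc
  refine ⟨c * C, fun α w F I S x hI h => ?_⟩
  have := hC α w F I (S.indicator fun k => (c : ℝ≥0∞)⁻¹ * x k) hI fun k hk => by
    have hkS : k ∈ S := by
      by_contra h'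
      exact hk (indicator_of_notMem h' _)
    refine ⟨(h k hkS).1, fun u hu => ?_⟩
    rw [indicator_of_mem hkS, ENNReal.inv_mul_le_iff hc0 ENNReal.coe_ne_top]
    exact (h k hkS).2 u hu
  rw [seqNorm_indicator_const_mul hq, ENNReal.inv_mul_le_iff hc0 ENNReal.coe_ne_top] at this
  rwa [ENNReal.coe_mul, mul_assoc]

section Discretization

variable {ι : Type*} {q : ℝ≥0∞} {α p : ℝ} {w : ℝ → ℝ} {F : ι → ℝ → ℝ≥0∞} {x y : ι → ℤ → ℝ≥0∞}

theorem cell_subset_Ioi (k : ℤ) : cell k ⊆ Ioi 0 := fun _ => pos_of_mem_cell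

theorem CellEqv.dom_weightedNorm_Ioi (hq : 0 < q)
    (h : CellEqv (fun i u => ENNReal.ofReal (u ^ α * w u) * F i u) x) :
    Dom (fun i => weightedNorm q α w (F i) (Ioi 0)) (fun i => seqNorm q (x i)) ∧
      Dom (fun i => seqNorm q (x i)) (fun i => weightedNorm q α w (F i) (Ioi 0)) := by
  obtain ⟨C, hC0, hC⟩ := h.exists_ne_zero
  constructor
  · refine ⟨C, fun i => ?_⟩
    rw [← seqNorm_const_mul hq]
    exact weightedNorm_le_seqNorm hq measurableSet_Ioi subset_rfl _
      fun k u hu _ => (hC i k u hu).1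
  · obtain ⟨D, hD⟩ := exists_seqNorm_le_mul_weightedNorm hq hC0
    refine ⟨D, fun i => ?_⟩
    have := hD α w (F i) (Ioi 0) univ (x i) measurableSet_Ioi
      fun k _ => ⟨cell_subset_Ioi k, fun u hu => (hC i k u hu).2⟩
    rwa [indicator_univ] at this

/-- For `t` in the cell of index `k`, the interval `(0,t)` is covered by the cells up to `k` but is
only sure to contain those up to `k - 1`; doubling of the head norm closes the gap. -/
theorem CellEqv.weightedNorm_Ioo (hq : 0 < q)
    (h : CellEqv (fun i u => ENNReal.ofReal (u ^ α * w u) * F i u) x) (hx : Doubling x) :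
    CellEqv (fun i t => weightedNorm q α w (F i) (Ioo 0 t)) (fun i => headNorm q (x i)) := by
  obtain ⟨C, hC0, hC⟩ := h.exists_ne_zero
  obtain ⟨D, hD⟩ := exists_seqNorm_le_mul_weightedNorm hq hC0
  obtain ⟨E, hE⟩ := hx.headNorm hq
  have hle : (C : ℝ≥0∞) ≤ (max C (E * D) : ℝ≥0) := by exact_mod_cast le_max_left _ _
  have hle' : ((E * D : ℝ≥0) : ℝ≥0∞) ≤ (max C (E * D) : ℝ≥0) := by exact_mod_cast le_max_right _ _
  refine ⟨max C (E * D), fun i k t ht => ⟨?_, ?_⟩⟩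
  · refine le_trans ?_ (mul_le_mul' hle le_rfl)
    unfold headNorm
    rw [← seqNorm_indicator_const_mul hq]
    refine weightedNorm_le_seqNorm hq measurableSet_Ioo (fun u hu => hu.1) _ fun j u hu hut => ?_
    rw [indicator_of_mem (show j ∈ Iic k from le_of_cell hu ht hut.2.le)]
    exact (hC i j u hu).1
  · refine le_trans ?_ (mul_le_mul' hle' le_rfl)
    have h1 := (hE i (k - 1)).1
    rw [sub_add_cancel] at h1
    refine h1.trans ?_
    rw [ENNReal.coe_mul, mul_assoc]
    gcongr
    refine hD α w (F i) (Ioo 0 t) (Iic (k - 1)) (x i) measurableSet_Ioo fun j hj => ⟨?_, ?_⟩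
    · intro u hu
      have : j ≤ k - 1 := hj
      exact ⟨pos_of_mem_cell hu, lt_of_cell hu ht (by omega)⟩
    · exact fun u hu => (hC i j u hu).2

theorem CellEqv.weightedNorm_Ioi (hq : 0 < q)
    (h : CellEqv (fun i u => ENNReal.ofReal (u ^ α * w u) * F i u) x) (hx : Doubling x) :
    CellEqv (fun i t => weightedNorm q α w (F i) (Ioi t)) (fun i => tailNorm q (x i)) := by
  obtain ⟨C, hC0, hC⟩ := h.exists_ne_zero
  obtain ⟨D, hD⟩ := exists_seqNorm_le_mul_weightedNorm hq hC0
  obtain ⟨E, hE⟩ := hx.tailNorm hq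
  have hle : (C : ℝ≥0∞) ≤ (max C (E * D) : ℝ≥0) := by exact_mod_cast le_max_left _ _
  have hle' : ((E * D : ℝ≥0) : ℝ≥0∞) ≤ (max C (E * D) : ℝ≥0) := by exact_mod_cast le_max_right _ _
  refine ⟨max C (E * D), fun i k t ht => ⟨?_, ?_⟩⟩
  · refine le_trans ?_ (mul_le_mul' hle le_rfl)
    unfold tailNorm
    rw [← seqNorm_indicator_const_mul hq]
    refine weightedNorm_le_seqNorm hq measurableSet_Ioi
      (fun u hu => (pos_of_mem_cell ht).trans hu) _ fun j u hu hut => ?_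
    rw [indicator_of_mem (show j ∈ Ici k from le_of_cell ht hu (le_of_lt hut))]
    exact (hC i j u hu).1
  · refine le_trans ?_ (mul_le_mul' hle' le_rfl)
    refine (hE i k).2.trans ?_
    rw [ENNReal.coe_mul, mul_assoc]
    gcongr
    refine hD α w (F i) (Ioi t) (Ici (k + 1)) (x i) measurableSet_Ioi fun j hj => ⟨?_, ?_⟩
    · intro u hu
      have : k + 1 ≤ j := hj
      exact lt_of_cell ht hu (by omega)
    · exact fun u hu => (hC i j u hu).2

theorem RegVar.cellEqv_mul (hw : RegVar p w) (α : ℝ) (hF : CellEqv F y) :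
    CellEqv (fun i u => ENNReal.ofReal (u ^ α * w u) * F i u)
      (fun i k => sample (fun t => t ^ α * w t) k * y i k) :=
  ((RegVar.id_rpow α).mul hw).cellEqv.mul hF

theorem RegVar.doubling_mul (hw : RegVar p w) (α : ℝ) (hy : Doubling y) :
    Doubling (fun i k => sample (fun t => t ^ α * w t) k * y i k) :=
  ((RegVar.id_rpow α).mul hw).doubling.mul hy

theorem sample_rpow_zero_mul (w : ℝ → ℝ) : sample (fun t => t ^ (0 : ℝ) * w t) = sample w := by
  ext k; simp [sample]

theorem cellEqv_one : CellEqv (fun (_ : ι) _ => 1) (fun _ _ => 1) :=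
  ⟨1, fun _ _ _ _ => by simp⟩

theorem doubling_one : Doubling (fun (_ : ι) _ => 1) := ⟨1, fun _ _ => by simp⟩

theorem RegVar.cellEqv_weightedNorm_Ioi (hq : 0 < q) (hw : RegVar 0 w) :
    CellEqv (fun (_ : ι) t => weightedNorm q 0 w (fun _ => 1) (Ioi t))
      (fun _ => tailNorm q (sample w)) := by
  have := (hw.cellEqv_mul (ι := ι) 0 cellEqv_one).weightedNorm_Ioi hq
    (hw.doubling_mul 0 doubling_one)
  simpa only [sample_rpow_zero_mul, mul_one] using this

theorem RegVar.cellEqv_weightedNorm_Ioo (hq : 0 < q) (hw : RegVar 0 w) :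
    CellEqv (fun (_ : ι) t => weightedNorm q 0 w (fun _ => 1) (Ioo 0 t))
      (fun _ => headNorm q (sample w)) := by
  have := (hw.cellEqv_mul (ι := ι) 0 cellEqv_one).weightedNorm_Ioo hq
    (hw.doubling_mul 0 doubling_one)
  simpa only [sample_rpow_zero_mul, mul_one] using this

/-! ### Slow variation of norms of slowly varying functions -/

/-- Slow variation for sequences. -/
def SlowSeq (v : ℤ → ℝ≥0∞) : Prop :=
  ∀ ε : ℝ, 0 < ε → ∃ C : ℝ≥0, ∀ j k : ℤ, v j ≤ C * (expKernel ε (j - k))⁻¹ * v k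

theorem expKernel_ne_zero (ε : ℝ) (m : ℤ) : expKernel ε m ≠ 0 :=
  (ENNReal.rpow_pos (by norm_num) (by norm_num)).ne'

theorem expKernel_ne_top (ε : ℝ) (m : ℤ) : expKernel ε m ≠ ∞ := by
  unfold expKernel
  exact ENNReal.rpow_ne_top_of_ne_zero (by norm_num) (by norm_num)

theorem RegVar.slowSeq (hw : RegVar 0 w) : SlowSeq (sample w) := fun _ hε =>
  hw.exists_sample_le_sv hε

/-- Quasi-norms of a slowly varying sequence over a translation invariant family of sets. -/
theorem SlowSeq.seqNorm_indicator (hq : 0 < q) {v : ℤ → ℤ → ℝ≥0∞} (S : ℤ → Set ℤ)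
    (hS : ∀ k m j, j ∈ S k ↔ j + m ∈ S (k + m))
    (hv : ∀ ε : ℝ, 0 < ε → ∃ C : ℝ≥0, ∀ j k m : ℤ,
      v (k + m) (j + m) ≤ C * (expKernel ε m)⁻¹ * v k j) :
    SlowSeq (fun k => seqNorm q ((S k).indicator (v k))) := by
  intro ε hε
  obtain ⟨C, hC⟩ := hv ε hε
  refine ⟨C, fun j k => ?_⟩
  obtain ⟨m, rfl⟩ : ∃ m, j = k + m := ⟨j - k, by ring⟩
  beta_reduce
  rw [add_sub_cancel_left, ← seqNorm_indicator_comp_add (S k) (S (k + m)) _ m (hS k m),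
    ← seqNorm_indicator_const_mul hq]
  exact seqNorm_indicator_mono _ _ subset_rfl fun i _ => hC i k m

theorem SlowSeq.shift {v : ℤ → ℝ≥0∞} (hv : SlowSeq v) {ε : ℝ} (hε : 0 < ε) :
    ∃ C : ℝ≥0, ∀ j m : ℤ, v (j + m) ≤ C * (expKernel ε m)⁻¹ * v j := by
  obtain ⟨C, hC⟩ := hv ε hε
  exact ⟨C, fun j m => by simpa using hC (j + m) j⟩

theorem SlowSeq.headNorm (hq : 0 < q) {v : ℤ → ℝ≥0∞} (hv : SlowSeq v) :
    SlowSeq (headNorm q v) := by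
  refine SlowSeq.seqNorm_indicator hq (v := fun _ => v) Iic (fun k m j => by simp) fun ε hε => ?_
  obtain ⟨C, hC⟩ := hv.shift hε
  exact ⟨C, fun j _ m => hC j m⟩

theorem SlowSeq.tailNorm (hq : 0 < q) {v : ℤ → ℝ≥0∞} (hv : SlowSeq v) :
    SlowSeq (tailNorm q v) := by
  refine SlowSeq.seqNorm_indicator hq (v := fun _ => v) Ici (fun k m j => by simp) fun ε hε => ?_
  obtain ⟨C, hC⟩ := hv.shift hε
  exact ⟨C, fun j _ m => hC j m⟩

/-- The discrete counterpart of `nestedHead`. -/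
noncomputable def nestedSeq (r : ℝ≥0∞) (b : ℤ → ℝ≥0∞) (q : ℝ≥0∞) (a : ℤ → ℝ≥0∞) (k : ℤ) : ℝ≥0∞ :=
  headNorm r (fun j => b j * seqNorm q ((Icc j k).indicator a)) k

/-- Translating `j` and `k` together translates the whole block `Icc j k`, so the losses of `a` and
`b` multiply, and each is given the exponent `ε/2`. -/
theorem slowSeq_nestedSeq {r : ℝ≥0∞} (hr : 0 < r) (hq : 0 < q) {a b : ℤ → ℝ≥0∞} (ha : SlowSeq a)
    (hb : SlowSeq b) : SlowSeq (nestedSeq r b q a) := by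
  refine SlowSeq.seqNorm_indicator hr (v := fun k j => b j * seqNorm q ((Icc j k).indicator a)) Iic
    (fun k m j => by simp) fun ε hε => ?_
  obtain ⟨C, hC⟩ := ha.shift (half_pos hε)
  obtain ⟨D, hD⟩ := hb.shift (half_pos hε)
  refine ⟨D * C, fun j k m => ?_⟩
  have h1 : seqNorm q ((Icc (j + m) (k + m)).indicator a) ≤
      C * (expKernel (ε / 2) m)⁻¹ * seqNorm q ((Icc j k).indicator a) := by
    rw [← seqNorm_indicator_comp_add (Icc j k) (Icc (j + m) (k + m)) _ m (fun i => by simp),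
      ← seqNorm_indicator_const_mul hq]
    exact seqNorm_indicator_mono _ _ subset_rfl fun i _ => hC i m
  refine (mul_le_mul' (hD j m) h1).trans_eq ?_
  have e : (expKernel ε m)⁻¹ = (expKernel (ε / 2) m)⁻¹ * (expKernel (ε / 2) m)⁻¹ := by
    rw [← ENNReal.mul_inv (Or.inl (expKernel_ne_zero _ _)) (Or.inl (expKernel_ne_top _ _)),
      ← expKernel_add, add_halves]
  rw [e, ENNReal.coe_mul]
  ring

theorem SlowSeq.doubling {v : ℤ → ℝ≥0∞} (hv : SlowSeq v) : Doubling (fun (_ : ι) => v) := by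
  obtain ⟨C, hC⟩ := hv.shift one_pos
  refine ⟨C * 2, fun _ k => ⟨?_, ?_⟩⟩
  · refine (hC k 1).trans_eq ?_
    simp [expKernel, ← ENNReal.rpow_neg]
  · have := hC (k + 1) (-1)
    rw [add_neg_cancel_right] at this
    refine this.trans_eq ?_
    simp [expKernel, ← ENNReal.rpow_neg]

/-- For `s` and `t` in the cells `j` and `k`, the interval `(s,t)` meets only the cells `j, …, k`
and contains `j + 1, …, k - 1`. The lower bound is therefore proved for the nested sequence at `k -
2` and carried to `k` by doubling twice. -/
theorem cellEqv_nestedHead {r : ℝ≥0∞} (hr : 0 < r) (hq : 0 < q) {a b : ℝ → ℝ} (ha : RegVar 0 a)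
    (hb : RegVar 0 b) :
    CellEqv (fun (_ : ι) t => nestedHead r b q a t)
      (fun _ => nestedSeq r (sample b) q (sample a)) := by
  obtain ⟨A, hA0, hA⟩ := (ha.cellEqv (ι := Unit)).exists_ne_zero
  obtain ⟨B, hB0, hB⟩ := (hb.cellEqv (ι := Unit)).exists_ne_zero
  obtain ⟨D, hD⟩ := exists_seqNorm_le_mul_weightedNorm hq hA0
  obtain ⟨A', hA'⟩ := ha.doubling (ι := Unit)
  obtain ⟨N, hN⟩ := (slowSeq_nestedSeq hr hq ha.slowSeq hb.slowSeq).doubling (ι := Unit)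
  -- Shifting the block by one places it in the range of cells that `(s,t)` contains.
  have hinner : ∀ j k, seqNorm q ((Icc j (k - 2)).indicator (sample a)) ≤
      A' * seqNorm q ((Icc (j + 1) (k - 1)).indicator (sample a)) := by
    intro j k
    rw [← seqNorm_indicator_comp_add (Icc j (k - 2)) (Icc (j + 1) (k - 1)) _ 1
      (fun i => by simp only [mem_Icc]; omega), ← seqNorm_indicator_const_mul hq]
    exact seqNorm_indicator_mono _ _ subset_rfl fun i _ => (hA' () i).2
  set M : ℝ≥0 := max 1 (B * (A' * D)) with hM
  have hM0 : M ≠ 0 := (one_pos.trans_le (le_max_left _ _)).ne'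
  obtain ⟨D', hD'⟩ := exists_seqNorm_le_mul_weightedNorm hr hM0
  have hle : ((B * A : ℝ≥0) : ℝ≥0∞) ≤ (max (B * A) (N * N * D') : ℝ≥0) := by
    exact_mod_cast le_max_left _ _
  have hle' : ((N * N * D' : ℝ≥0) : ℝ≥0∞) ≤ (max (B * A) (N * N * D') : ℝ≥0) := by
    exact_mod_cast le_max_right _ _
  refine ⟨max (B * A) (N * N * D'), fun _ k t ht => ⟨?_, ?_⟩⟩
  · refine le_trans ?_ (mul_le_mul' hle le_rfl)
    unfold nestedSeq headNorm
    rw [← seqNorm_indicator_const_mul hr]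
    refine weightedNorm_le_seqNorm hr measurableSet_Ioo (fun u hu => hu.1) _ fun j s hs hst => ?_
    rw [indicator_of_mem (show j ∈ Iic k from le_of_cell hs ht hst.2.le), Real.rpow_zero, one_mul]
    have h1 : weightedNorm q 0 a (fun _ => 1) (Ioo s t) ≤
        A * seqNorm q ((Icc j k).indicator (sample a)) := by
      rw [← seqNorm_indicator_const_mul hq]
      refine weightedNorm_le_seqNorm hq measurableSet_Ioo (fun u hu => hst.1.trans hu.1) _
        fun i u hu hut => ?_
      rw [indicator_of_mem (show i ∈ Icc j k from
        ⟨le_of_cell hs hu hut.1.le, le_of_cell hu ht hut.2.le⟩), Real.rpow_zero, one_mul, mul_one]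
      exact (hA () i u hu).1
    refine (mul_le_mul' (hB () j s hs).1 h1).trans_eq ?_
    rw [ENNReal.coe_mul]; ring
  · refine le_trans ?_ (mul_le_mul' hle' le_rfl)
    have h1 := (hN () (k - 1)).1
    have h2 := (hN () (k - 2)).1
    rw [sub_add_cancel] at h1
    rw [show k - 2 + 1 = k - 1 by ring] at h2
    refine (h1.trans (mul_le_mul' le_rfl h2)).trans ?_
    rw [ENNReal.coe_mul, ENNReal.coe_mul, ← mul_assoc, mul_assoc _ (D' : ℝ≥0∞)]
    gcongr
    refine hD' 0 b (fun s => weightedNorm q 0 a (fun _ => 1) (Ioo s t)) (Ioo 0 t) (Iic (k - 2)) _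
      measurableSet_Ioo fun j hj => ?_
    have hj' : j ≤ k - 2 := hj
    refine ⟨fun u hu => ⟨pos_of_mem_cell hu, lt_of_cell hu ht (by omega)⟩, fun s hs => ?_⟩
    have h3 : seqNorm q ((Icc (j + 1) (k - 1)).indicator (sample a)) ≤
        D * weightedNorm q 0 a (fun _ => 1) (Ioo s t) := by
      refine hD 0 a (fun _ => 1) (Ioo s t) _ _ measurableSet_Ioo fun i hi => ⟨fun u hu => ?_, ?_⟩
      · exact ⟨lt_of_cell hs hu (by have := hi.1; omega), lt_of_cell hu ht (by have := hi.2; omega)⟩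
      · intro u hu
        rw [Real.rpow_zero, one_mul, mul_one]
        exact (hA () i u hu).2
    rw [Real.rpow_zero, one_mul]
    calc sample b j * seqNorm q ((Icc j (k - 2)).indicator (sample a))
        ≤ (B * ENNReal.ofReal (b s)) *
          (A' * (D * weightedNorm q 0 a (fun _ => 1) (Ioo s t))) :=
          mul_le_mul' (hB () j s hs).2 ((hinner j k).trans (mul_le_mul' le_rfl h3))
      _ = ((B * (A' * D) : ℝ≥0) : ℝ≥0∞) * (ENNReal.ofReal (b s) *
            weightedNorm q 0 a (fun _ => 1) (Ioo s t)) := by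
          push_cast; ring
      _ ≤ _ := by
          gcongr
          exact le_max_right _ _

theorem two_zpow_abs_le {j k : ℤ} {s t : ℝ} (hs : s ∈ cell j) (ht : t ∈ cell k) :
    (2 : ℝ) ^ |((k - j : ℤ) : ℝ)| ≤ 2 * max (t / s) (s / t) := by
  have key : ∀ {j k : ℤ} {s t : ℝ}, s ∈ cell j → t ∈ cell k →
      (2 : ℝ) ^ k / 2 ^ j ≤ 2 * (t / s) := by
    intro j k s t hs ht
    have h1 := ht.1
    have h2 := (lt_two_mul_of_mem_cell hs).le
    have h0 := pos_of_mem_cell hs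
    have h0' := pos_of_mem_cell ht
    have hj : (0 : ℝ) < 2 ^ j := zpow_pos (by norm_num) j
    rw [div_le_iff₀ hj, mul_div_assoc', div_mul_eq_mul_div, le_div_iff₀ h0]
    nlinarith
  rw [← RegVar.max_zpow]
  refine max_le ((key hs ht).trans ?_) ((key ht hs).trans ?_)
  · gcongr; exact le_max_left _ _
  · gcongr; exact le_max_right _ _

/-- Slow variation bounds every sample by a finite multiple of the sample at index `0`, so the
finiteness assumed at `t = 1` spreads to all `t > 0`. -/
theorem CellEqv.ne_top {W : ℝ → ℝ≥0∞} {v : ℤ → ℝ≥0∞} (h : CellEqv (fun (_ : Unit) => W) fun _ => v)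
    (hv : SlowSeq v) (hfin : W 1 < ∞) {t : ℝ} (ht : 0 < t) : W t ≠ ∞ := by
  obtain ⟨C, hC⟩ := h
  obtain ⟨D, hD⟩ := hv 1 one_pos
  have h0 : v 0 ≠ ∞ := ne_top_of_le_ne_top (ENNReal.mul_ne_top ENNReal.coe_ne_top hfin.ne)
    (hC () 0 1 (by simpa using zpow_mem_cell 0)).2
  obtain ⟨k, hk⟩ := exists_mem_cell ht
  refine ne_top_of_le_ne_top (ENNReal.mul_ne_top ENNReal.coe_ne_top ?_) (hC () k t hk).1
  exact ne_top_of_le_ne_top (ENNReal.mul_ne_top (ENNReal.mul_ne_top ENNReal.coe_ne_top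
    (ENNReal.inv_ne_top.2 (expKernel_ne_zero _ _))) h0) (hD k 0)

theorem CellEqv.regVar_toReal {W : ℝ → ℝ≥0∞} {v : ℤ → ℝ≥0∞}
    (h : CellEqv (fun (_ : Unit) => W) fun _ => v)
    (hv : SlowSeq v) (hv0 : ∀ k, v k ≠ 0) (hfin : W 1 < ∞) :
    RegVar 0 (fun t => (W t).toReal) := by
  have hW : ∀ {t : ℝ}, 0 < t → W t ≠ ∞ := fun ht => h.ne_top hv hfin ht
  obtain ⟨C, hC⟩ := h
  refine ⟨fun t ht => ENNReal.toReal_pos (fun h0 => ?_) (hW ht), fun ε hε => ?_⟩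
  · obtain ⟨k, hk⟩ := exists_mem_cell ht
    have := (hC () k t hk).2
    simp only [h0, mul_zero, nonpos_iff_eq_zero] at this
    exact hv0 k this
  · obtain ⟨D, hD⟩ := hv ε hε
    -- `2 ^ ε` is the cost of replacing `2^|k - j|` by the ratio of points of the two cells; the `+
    -- 1` only makes the constant positive.
    refine ⟨C * D * C * 2 ^ ε + 1, by positivity, fun s t hs ht => ?_⟩
    obtain ⟨j, hj⟩ := exists_mem_cell hs
    obtain ⟨k, hk⟩ := exists_mem_cell ht
    have h1 : W t ≤ ((C * D * C : ℝ≥0) : ℝ≥0∞) * ((expKernel ε (k - j))⁻¹ * W s) := by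
      calc W t ≤ C * (D * (expKernel ε (k - j))⁻¹ * (C * W s)) := by
            refine (hC () k t hk).1.trans ?_
            gcongr
            refine (hD k j).trans ?_
            gcongr
            exact (hC () j s hj).2
        _ = _ := by push_cast; ring
    have h2 : (expKernel ε (k - j))⁻¹ = ENNReal.ofReal ((2 ^ |((k - j : ℤ) : ℝ)|) ^ ε) := by
      rw [expKernel, ← ENNReal.rpow_neg, neg_neg, ← Real.rpow_mul (by norm_num),
        ← ENNReal.ofReal_rpow_of_pos (by norm_num), mul_comm ε]
      simp
    rw [h2] at h1
    have h3 := ENNReal.toReal_mono (ENNReal.mul_ne_top ENNReal.coe_ne_top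
      (ENNReal.mul_ne_top ENNReal.ofReal_ne_top (hW hs))) h1
    rw [ENNReal.toReal_mul, ENNReal.toReal_mul, ENNReal.toReal_ofReal (by positivity),
      ENNReal.coe_toReal] at h3
    have hm0 : 0 < max (t / s) (s / t) := one_pos.trans_le (one_le_max_div hs ht)
    have h4 : ((2 : ℝ) ^ |((k - j : ℤ) : ℝ)|) ^ ε ≤ 2 ^ ε * max (t / s) (s / t) ^ ε := by
      rw [← Real.mul_rpow (by norm_num) hm0.le]
      exact Real.rpow_le_rpow (by positivity) (two_zpow_abs_le hj hk) hε.le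
    rw [Real.rpow_zero, mul_one]
    have hWs : 0 ≤ (W s).toReal := ENNReal.toReal_nonneg
    calc (W t).toReal ≤ _ := h3
      _ ≤ ((C * D * C : ℝ≥0) : ℝ) * ((2 ^ ε * max (t / s) (s / t) ^ ε) * (W s).toReal) := by gcongr
      _ = C * D * C * 2 ^ ε * max (t / s) (s / t) ^ ε * (W s).toReal := by push_cast; ring
      _ ≤ _ := by
          gcongr
          linarith

theorem CellEqv.sample_dom {W : ℝ → ℝ≥0∞} {v : ℤ → ℝ≥0∞}
    (h : CellEqv (fun (_ : Unit) => W) fun _ => v) (hv : SlowSeq v) (hfin : W 1 < ∞) :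
    Dom (sample fun t => (W t).toReal) v ∧ Dom v (sample fun t => (W t).toReal) := by
  have e : sample (fun t => (W t).toReal) = fun k => W (2 ^ k) := by
    ext k
    exact ENNReal.ofReal_toReal (h.ne_top hv hfin (zpow_pos (by norm_num) k))
  rw [e]
  obtain ⟨C, hC⟩ := h
  exact ⟨⟨C, fun k => (hC () k _ (zpow_mem_cell k)).1⟩, ⟨C, fun k => (hC () k _ (zpow_mem_cell k)).2⟩⟩

end Discretization

/-! ### The K-functional -/

section PeetreK

variable {V : Type*} [AddCommGroup V] {X₀ X₁ : V → ℝ≥0∞}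

theorem peetreK_le (t : ℝ) {f f₀ f₁ : V} (h : f = f₀ + f₁) :
    peetreK X₀ X₁ t f ≤ X₀ f₀ + ENNReal.ofReal t * X₁ f₁ :=
  iInf_le_of_le f₀ (iInf_le_of_le f₁ (iInf_le _ h))

theorem le_peetreK {t : ℝ} {f : V} {c : ℝ≥0∞}
    (h : ∀ f₀ f₁, f = f₀ + f₁ → c ≤ X₀ f₀ + ENNReal.ofReal t * X₁ f₁) : c ≤ peetreK X₀ X₁ t f :=
  le_iInf fun f₀ => le_iInf fun f₁ => le_iInf fun hf => h f₀ f₁ hf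

theorem peetreK_mono (f : V) {s t : ℝ} (h : s ≤ t) : peetreK X₀ X₁ s f ≤ peetreK X₀ X₁ t f :=
  le_peetreK fun _ _ hf => (peetreK_le s hf).trans (by gcongr)

/-- The same decomposition is used at both points; equivalently, `K(t,f)/t` is non-increasing. -/
theorem peetreK_le_ofReal_div_mul (f : V) {s t : ℝ} (hs : 0 < s) (h : s ≤ t) :
    peetreK X₀ X₁ t f ≤ ENNReal.ofReal (t / s) * peetreK X₀ X₁ s f := by
  have h1 : 1 ≤ t / s := (one_le_div hs).2 h
  have hc0 : ENNReal.ofReal (t / s) ≠ 0 := (ENNReal.ofReal_pos.2 (one_pos.trans_le h1)).ne'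
  rw [← ENNReal.inv_mul_le_iff hc0 ENNReal.ofReal_ne_top]
  refine le_peetreK fun f₀ f₁ hf => ?_
  rw [ENNReal.inv_mul_le_iff hc0 ENNReal.ofReal_ne_top]
  refine (peetreK_le t hf).trans ?_
  rw [mul_add, ← mul_assoc, ← ENNReal.ofReal_mul (by positivity), div_mul_cancel₀ _ hs.ne']
  gcongr
  exact le_mul_of_one_le_left' (ENNReal.one_le_ofReal.2 h1)

theorem peetreK_le_of_le_mul (f : V) {s t Λ : ℝ} (hΛ : 1 ≤ Λ) (hs : 0 < s) (h : t ≤ Λ * s) :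
    peetreK X₀ X₁ t f ≤ ENNReal.ofReal Λ * peetreK X₀ X₁ s f := by
  refine (peetreK_mono f h).trans ?_
  have := peetreK_le_ofReal_div_mul (X₀ := X₀) (X₁ := X₁) f hs
    (le_mul_of_one_le_left hs.le hΛ : s ≤ Λ * s)
  rwa [mul_div_cancel_right₀ _ hs.ne'] at this

theorem peetreK_le_left (h₁ : X₁ 0 = 0) (t : ℝ) (f : V) : peetreK X₀ X₁ t f ≤ X₀ f := by
  simpa [h₁] using peetreK_le (X₀ := X₀) (X₁ := X₁) t (add_zero f).symm

theorem peetreK_le_right (h₀ : X₀ 0 = 0) (t : ℝ) (f : V) :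
    peetreK X₀ X₁ t f ≤ ENNReal.ofReal t * X₁ f := by
  simpa [h₀] using peetreK_le (X₀ := X₀) (X₁ := X₁) t (zero_add f).symm

theorem peetreK_zero (h₀ : X₀ 0 = 0) (h₁ : X₁ 0 = 0) (t : ℝ) : peetreK X₀ X₁ t 0 = 0 :=
  nonpos_iff_eq_zero.1 ((peetreK_le_left h₁ t 0).trans_eq h₀)

theorem exists_peetreK_add_le (h₀ : ∃ C : ℝ≥0, ∀ x y : V, X₀ (x + y) ≤ C * (X₀ x + X₀ y))
    (h₁ : ∃ C : ℝ≥0, ∀ x y : V, X₁ (x + y) ≤ C * (X₁ x + X₁ y)) :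
    ∃ C : ℝ≥0, ∀ (t : ℝ) (f g : V),
      peetreK X₀ X₁ t (f + g) ≤ C * (peetreK X₀ X₁ t f + peetreK X₀ X₁ t g) := by
  obtain ⟨C, hC⟩ := h₀
  obtain ⟨D, hD⟩ := h₁
  -- A common bound for both quasi-triangle constants, made nonzero so that it can be divided out
  -- before taking infima.
  set M : ℝ≥0 := C + D + 1 with hM
  have hM0 : (M : ℝ≥0∞) ≠ 0 := by
    have : (0 : ℝ≥0) < M := by positivity
    exact_mod_cast this.ne'
  have hCM : (C : ℝ≥0∞) ≤ M := by
    rw [hM, add_assoc]; exact_mod_cast le_self_add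
  have hDM : (D : ℝ≥0∞) ≤ M := by
    rw [hM, add_comm C, add_assoc]; exact_mod_cast le_self_add
  refine ⟨M, fun t f g => ?_⟩
  rw [← ENNReal.inv_mul_le_iff hM0 ENNReal.coe_ne_top]
  have key : ∀ f₀ f₁ g₀ g₁, f = f₀ + f₁ → g = g₀ + g₁ →
      (M : ℝ≥0∞)⁻¹ * peetreK X₀ X₁ t (f + g) ≤
        (X₀ f₀ + ENNReal.ofReal t * X₁ f₁) + (X₀ g₀ + ENNReal.ofReal t * X₁ g₁) := by
    intro f₀ f₁ g₀ g₁ hf hg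
    rw [ENNReal.inv_mul_le_iff hM0 ENNReal.coe_ne_top]
    calc peetreK X₀ X₁ t (f + g) ≤ X₀ (f₀ + g₀) + ENNReal.ofReal t * X₁ (f₁ + g₁) :=
          peetreK_le t (by rw [hf, hg]; abel)
      _ ≤ M * (X₀ f₀ + X₀ g₀) + ENNReal.ofReal t * (M * (X₁ f₁ + X₁ g₁)) := by
          gcongr
          · exact (hC _ _).trans (by gcongr)
          · exact (hD _ _).trans (by gcongr)
      _ = _ := by ring
  simp only [peetreK]
  simp only [ENNReal.iInf_add, ENNReal.add_iInf]
  refine le_iInf fun f₀ => le_iInf fun f₁ => le_iInf fun hf => le_iInf fun g₀ => le_iInf fun g₁ =>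
    le_iInf fun hg => ?_
  exact key g₀ g₁ f₀ f₁ hg hf

theorem Dom.peetreK {Y₀ Y₁ : V → ℝ≥0∞} (h₀ : Dom X₀ Y₀) (h₁ : Dom X₁ Y₁) :
    ∃ C : ℝ≥0, ∀ t f, peetreK X₀ X₁ t f ≤ C * peetreK Y₀ Y₁ t f := by
  obtain ⟨C, hC⟩ := h₀
  obtain ⟨D, hD⟩ := h₁
  set M : ℝ≥0 := C + D + 1 with hM
  have hM0 : (M : ℝ≥0∞) ≠ 0 := by
    have : (0 : ℝ≥0) < M := by positivity
    exact_mod_cast this.ne'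
  have hCM : (C : ℝ≥0∞) ≤ M := by
    rw [hM, add_assoc]; exact_mod_cast le_self_add
  have hDM : (D : ℝ≥0∞) ≤ M := by
    rw [hM, add_comm C, add_assoc]; exact_mod_cast le_self_add
  refine ⟨M, fun t f => ?_⟩
  rw [← ENNReal.inv_mul_le_iff hM0 ENNReal.coe_ne_top]
  refine le_peetreK fun f₀ f₁ hf => ?_
  rw [ENNReal.inv_mul_le_iff hM0 ENNReal.coe_ne_top]
  calc _ ≤ X₀ f₀ + ENNReal.ofReal t * X₁ f₁ := peetreK_le t hf
    _ ≤ M * Y₀ f₀ + ENNReal.ofReal t * (M * Y₁ f₁) := by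
        gcongr
        · exact (hC _).trans (by gcongr)
        · exact (hD _).trans (by gcongr)
    _ = _ := by ring

/-- Dyadic samples of the K-functional. -/
noncomputable def peetreSeq (X₀ X₁ : V → ℝ≥0∞) (f : V) (k : ℤ) : ℝ≥0∞ := peetreK X₀ X₁ (2 ^ k) f

theorem peetreSeq_mono (f : V) : Monotone (peetreSeq X₀ X₁ f) := fun _ _ h =>
  peetreK_mono f (zpow_le_zpow_right₀ (by norm_num) h)

theorem cellEqv_peetreK :
    CellEqv (fun f t => peetreK X₀ X₁ t f) (peetreSeq X₀ X₁) := by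
  refine ⟨2, fun f k t ht => ⟨?_, ?_⟩⟩
  · have := peetreK_le_of_le_mul (X₀ := X₀) (X₁ := X₁) f one_le_two (zpow_pos two_pos k)
      (lt_two_mul_of_mem_cell ht).le
    simpa [peetreSeq] using this
  · refine (peetreK_mono f ht.1).trans ?_
    exact le_mul_of_one_le_left' (by norm_num)

theorem doubling_peetreSeq : Doubling (peetreSeq X₀ X₁) := by
  refine ⟨2, fun f k => ⟨?_, ?_⟩⟩
  · have := peetreK_le_of_le_mul (X₀ := X₀) (X₁ := X₁) f one_le_two (zpow_pos two_pos k)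
      (t := 2 ^ (k + 1)) (by rw [zpow_add_one₀ two_ne_zero, mul_comm])
    simpa [peetreSeq] using this
  · refine (peetreSeq_mono f (by omega : k ≤ k + 1)).trans ?_
    exact le_mul_of_one_le_left' (by norm_num)

end PeetreK

/-! ### Discretization of the interpolation spaces -/

section Spaces

variable {V : Type*} [AddCommGroup V]

/-- The sequence `2 ^ (-θ k) w(2 ^ k) K(2 ^ k, f)`. -/
noncomputable def weightedSeq (X₀ X₁ : V → ℝ≥0∞) (θ : ℝ) (w : ℝ → ℝ) (f : V) (k : ℤ) : ℝ≥0∞ :=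
  sample (fun t => t ^ (-θ) * w t) k * peetreSeq X₀ X₁ f k

/-- Mutual domination. -/
def DomEqv {κ : Type*} (x y : κ → ℝ≥0∞) : Prop := Dom x y ∧ Dom y x

theorem DomEqv.symm {κ : Type*} {x y : κ → ℝ≥0∞} (h : DomEqv x y) : DomEqv y x := ⟨h.2, h.1⟩

theorem DomEqv.trans {κ : Type*} {x y z : κ → ℝ≥0∞} (h : DomEqv x y) (h' : DomEqv y z) :
    DomEqv x z := ⟨h.1.trans h'.1, h'.2.trans h.2⟩

theorem DomEqv.max {κ : Type*} {x y x' y' : κ → ℝ≥0∞} (h : DomEqv x x') (h' : DomEqv y y') :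
    DomEqv (fun i => max (x i) (y i)) (fun i => max (x' i) (y' i)) :=
  ⟨(h.1.trans (Dom.of_le fun _ => le_max_left _ _)).max
      (h'.1.trans (Dom.of_le fun _ => le_max_right _ _)),
    (h.2.trans (Dom.of_le fun _ => le_max_left _ _)).max
      (h'.2.trans (Dom.of_le fun _ => le_max_right _ _))⟩

theorem DomEqv.sameSpace {W : Type*} {X Y : W → ℝ≥0∞} (h : DomEqv X Y) : SameSpace X Y := ⟨h.2, h.1⟩

variable {X₀ X₁ : V → ℝ≥0∞} {θ : ℝ} {s r q : ℝ≥0∞} {a b c : ℝ → ℝ} {pa pb pc : ℝ}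

theorem cellEqv_weightedSeq (ha : RegVar pa a) :
    CellEqv (fun f u => ENNReal.ofReal (u ^ (-θ) * a u) * peetreK X₀ X₁ u f)
      (weightedSeq X₀ X₁ θ a) := ha.cellEqv_mul (-θ) cellEqv_peetreK

theorem doubling_weightedSeq (ha : RegVar pa a) : Doubling (weightedSeq X₀ X₁ θ a) :=
  ha.doubling_mul (-θ) doubling_peetreSeq

theorem standardSpace_domEqv (hq : 0 < q) (ha : RegVar pa a) :
    DomEqv (standardSpace X₀ X₁ θ q a) (fun f => seqNorm q (weightedSeq X₀ X₁ θ a f)) :=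
  (cellEqv_weightedSeq ha).dom_weightedNorm_Ioi hq

theorem RegVar.cellEqv_mul_zero {ι : Type*} {F : ι → ℝ → ℝ≥0∞} {y : ι → ℤ → ℝ≥0∞}
    (hb : RegVar pb b) (hF : CellEqv F y) :
    CellEqv (fun i u => ENNReal.ofReal (u ^ (0 : ℝ) * b u) * F i u)
      (fun i k => sample b k * y i k) := by
  simpa only [sample_rpow_zero_mul] using hb.cellEqv_mul 0 hF

/-- Discretization proceeds from the inside: the inner norm is comparable on cells with head norms,
and can then serve as the integrand of the outer one. -/
theorem spaceL_domEqv (hr : 0 < r) (hq : 0 < q) (hb : RegVar pb b) (ha : RegVar pa a) :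
    DomEqv (spaceL X₀ X₁ θ r b q a)
      (fun f => seqNorm r (fun k => sample b k * headNorm q (weightedSeq X₀ X₁ θ a f) k)) :=
  (hb.cellEqv_mul_zero ((cellEqv_weightedSeq ha).weightedNorm_Ioo hq
    (doubling_weightedSeq ha))).dom_weightedNorm_Ioi hr

theorem spaceR_domEqv (hr : 0 < r) (hq : 0 < q) (hb : RegVar pb b) (ha : RegVar pa a) :
    DomEqv (spaceR X₀ X₁ θ r b q a)
      (fun f => seqNorm r (fun k => sample b k * tailNorm q (weightedSeq X₀ X₁ θ a f) k)) :=
  (hb.cellEqv_mul_zero ((cellEqv_weightedSeq ha).weightedNorm_Ioi hq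
    (doubling_weightedSeq ha))).dom_weightedNorm_Ioi hr

theorem spaceLL_domEqv (hs : 0 < s) (hr : 0 < r) (hq : 0 < q) (hc : RegVar pc c)
    (hb : RegVar pb b) (ha : RegVar pa a) :
    DomEqv (spaceLL X₀ X₁ θ s c r b q a)
      (fun f => seqNorm s (fun k => sample c k *
        headNorm r (fun j => sample b j * headNorm q (weightedSeq X₀ X₁ θ a f) j) k)) :=
  (hc.cellEqv_mul_zero ((hb.cellEqv_mul_zero ((cellEqv_weightedSeq ha).weightedNorm_Ioo hq
    (doubling_weightedSeq ha))).weightedNorm_Ioo hr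
    (hb.doubling.mul ((doubling_weightedSeq ha).headNorm hq)))).dom_weightedNorm_Ioi hs

theorem spaceRR_domEqv (hs : 0 < s) (hr : 0 < r) (hq : 0 < q) (hc : RegVar pc c)
    (hb : RegVar pb b) (ha : RegVar pa a) :
    DomEqv (spaceRR X₀ X₁ θ s c r b q a)
      (fun f => seqNorm s (fun k => sample c k *
        tailNorm r (fun j => sample b j * tailNorm q (weightedSeq X₀ X₁ θ a f) j) k)) :=
  (hc.cellEqv_mul_zero ((hb.cellEqv_mul_zero ((cellEqv_weightedSeq ha).weightedNorm_Ioi hq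
    (doubling_weightedSeq ha))).weightedNorm_Ioi hr
    (hb.doubling.mul ((doubling_weightedSeq ha).tailNorm hq)))).dom_weightedNorm_Ioi hs

/-! ### Sampling along a regularly varying function -/

/-- Half of the positive index is spent on the slowly varying factor, and power growth of order
`p/2` is left. -/
theorem RegVar.exists_growth {p : ℝ} {w : ℝ → ℝ} (h : RegVar p w) (hp : 0 < p) :
    ∃ C : ℝ, 0 < C ∧ ∀ s t : ℝ, 0 < s → s ≤ t → (t / s) ^ (p / 2) * w s ≤ C * w t := by
  obtain ⟨C, hC, H⟩ := h.2 (p / 2) (half_pos hp)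
  refine ⟨C, hC, fun s t hs hst => ?_⟩
  have ht := hs.trans_le hst
  have h1 := H t s ht hs
  have hd : 0 < t / s := div_pos ht hs
  have hm : max (s / t) (t / s) = t / s :=
    max_eq_right (((div_le_one ht).2 hst).trans ((one_le_div hs).2 hst))
  have e : (s / t) ^ p = (t / s) ^ (-p) := by
    rw [Real.rpow_neg hd.le, ← Real.inv_rpow hd.le, inv_div]
  rw [hm, e, mul_assoc C, ← Real.rpow_add hd] at h1
  calc (t / s) ^ (p / 2) * w s ≤ (t / s) ^ (p / 2) * (C * (t / s) ^ (-p + p / 2) * w t) := by gcongr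
    _ = C * ((t / s) ^ (p / 2) * (t / s) ^ (-p + p / 2)) * w t := by ring
    _ = C * w t := by
        rw [← Real.rpow_add hd, show p / 2 + (-p + p / 2) = 0 by ring, Real.rpow_zero, mul_one]

theorem exists_lt_zpow_rpow {p : ℝ} (hp : 0 < p) (M : ℝ) : ∃ n : ℕ, M < ((2 : ℝ) ^ n) ^ p := by
  obtain ⟨n, hn⟩ := pow_unbounded_of_one_lt M (Real.one_lt_rpow one_lt_two hp)
  refine ⟨n, hn.trans_eq ?_⟩
  rw [← Real.rpow_natCast, ← Real.rpow_natCast, ← Real.rpow_mul two_pos.le,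
    ← Real.rpow_mul two_pos.le, mul_comm]

/-- Power growth forces indices with comparable values of `w` to lie near each other. This bounds
the fibres of the index maps used to resample norms. -/
theorem RegVar.exists_abs_sub_le {p : ℝ} {w : ℝ → ℝ} (h : RegVar p w) (hp : 0 < p) (Λ : ℝ) :
    ∃ N : ℕ, ∀ j k : ℤ, w (2 ^ j) ≤ Λ * w (2 ^ k) → w (2 ^ k) ≤ Λ * w (2 ^ j) → |j - k| ≤ N := by
  obtain ⟨C, hC, H⟩ := h.exists_growth hp
  obtain ⟨N, hN⟩ := exists_lt_zpow_rpow (half_pos hp) (C * Λ)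
  have key : ∀ j k : ℤ, w (2 ^ k) ≤ Λ * w (2 ^ j) → k - j ≤ N := by
    intro j k hjk
    by_contra! hlt
    have hj : (0 : ℝ) < 2 ^ j := zpow_pos two_pos j
    have h1 := H (2 ^ j) (2 ^ k) hj (zpow_le_zpow_right₀ one_le_two (by omega))
    have h2 : (2 : ℝ) ^ N ≤ 2 ^ k / 2 ^ j := by
      rw [← zpow_sub₀ two_ne_zero, ← zpow_natCast]
      exact zpow_le_zpow_right₀ one_le_two hlt.le
    have hwj := h.1 _ hj
    have h3 : C * Λ * w (2 ^ j) < C * w (2 ^ k) := by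
      refine lt_of_lt_of_le ?_ h1
      have := Real.rpow_le_rpow (by positivity) h2 (half_pos hp).le
      have := hN.trans_le this
      gcongr
    have h4 : C * w (2 ^ k) ≤ C * Λ * w (2 ^ j) := by
      rw [mul_assoc]; gcongr
    exact absurd h3 (not_lt.2 h4)
  refine ⟨N, fun j k h1 h2 => abs_le.2 ⟨?_, key k j h1⟩⟩
  have := key j k h2
  omega

/-- The function `w` need not be monotone or continuous. Growth at both ends yields a largest `k`
with `w (2 ^ k) ≤ y`; then `y < w (2 ^ (k + 1))`, and neighbouring samples are comparable. -/
theorem RegVar.exists_comparable {p : ℝ} {w : ℝ → ℝ} (h : RegVar p w) (hp : 0 < p) :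
    ∃ Λ : ℝ, 1 ≤ Λ ∧ ∀ y : ℝ, 0 < y → ∃ k : ℤ, y ≤ Λ * w (2 ^ k) ∧ w (2 ^ k) ≤ Λ * y := by
  obtain ⟨C, hC, H⟩ := h.exists_growth hp
  obtain ⟨D, hD, H'⟩ := h.exists_le_of_ratio (Λ := 2) one_le_two
  refine ⟨max D 1, le_max_right _ _, fun y hy => ?_⟩
  have h1 := h.1 1 one_pos
  obtain ⟨n, hn⟩ := exists_lt_zpow_rpow (half_pos hp) (C * w 1 / y)
  obtain ⟨m, hm⟩ := exists_lt_zpow_rpow (half_pos hp) (C * y / w 1)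
  have hne : ∃ k : ℤ, w (2 ^ k) ≤ y := by
    refine ⟨-n, ?_⟩
    have := H (2 ^ (-n : ℤ)) 1 (zpow_pos two_pos _) (zpow_le_one_of_nonpos₀ one_le_two (by omega))
    rw [zpow_neg, one_div, inv_inv, zpow_natCast] at this
    rw [zpow_neg, zpow_natCast]
    rw [div_lt_iff₀ hy] at hn
    have h3 : (0 : ℝ) < (2 ^ n) ^ (p / 2) := by positivity
    refine le_of_mul_le_mul_left (this.trans hn.le) h3
  have hbd : ∀ k : ℤ, w (2 ^ k) ≤ y → k ≤ m := by
    intro k hk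
    by_contra! hlt
    have hle : (1 : ℝ) ≤ 2 ^ k := one_le_zpow₀ one_le_two (by omega)
    have h2 := H 1 (2 ^ k) one_pos hle
    rw [div_one] at h2
    rw [div_lt_iff₀ h1] at hm
    have h3 : ((2 : ℝ) ^ m) ^ (p / 2) ≤ (2 ^ k) ^ (p / 2) := by
      refine Real.rpow_le_rpow (by positivity) ?_ (half_pos hp).le
      rw [← zpow_natCast]
      exact zpow_le_zpow_right₀ one_le_two hlt.le
    have h4 := mul_le_mul_of_nonneg_right h3 h1.le
    have h5 : C * w (2 ^ k) ≤ C * y := by gcongr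
    linarith
  obtain ⟨k, hk, hmax⟩ := Int.exists_greatest_of_bdd ⟨m, hbd⟩ hne
  refine ⟨k, ?_, hk.trans (le_mul_of_one_le_left hy.le (le_max_right _ _))⟩
  have hk' : y < w (2 ^ (k + 1)) := by
    by_contra! hle
    have := hmax _ hle
    omega
  have hk0 : (0 : ℝ) < 2 ^ k := zpow_pos two_pos k
  have e : (2 : ℝ) ^ (k + 1) = 2 * 2 ^ k := by rw [zpow_add_one₀ two_ne_zero, mul_comm]
  have := H' (2 ^ k) (2 ^ (k + 1)) hk0 (by positivity) e.le (by rw [e]; linarith)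
  refine hk'.le.trans (this.trans ?_)
  have := h.1 _ hk0
  gcongr
  exact le_max_left _ _

theorem dom_seqNorm_of_comp {ι : Type*} (hq : 0 < q) {x y : ι → ℤ → ℝ≥0∞} (φ : ℤ → ℤ) (N : ℕ)
    (hφ : ∀ j k, φ j = φ k → |j - k| ≤ N) (h : Dom₂ x fun i k => y i (φ k)) :
    Dom (fun i => seqNorm q (x i)) (fun i => seqNorm q (y i)) := by
  obtain ⟨C, hC⟩ := exists_seqNorm_comp_le q φ N hφ
  exact (h.seqNorm hq).trans ⟨C, fun i => hC (y i)⟩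

theorem exists_peetreK_weight_le {w : ℝ → ℝ} {p Λ : ℝ} (hw : RegVar p w) (hΛ : 1 ≤ Λ)
    (X₀ X₁ : V → ℝ≥0∞) :
    ∃ C : ℝ≥0, ∀ (f : V) (s t : ℝ), 0 < s → 0 < t → t ≤ Λ * s → s ≤ Λ * t →
      ENNReal.ofReal (w t) * peetreK X₀ X₁ t f ≤
        C * (ENNReal.ofReal (w s) * peetreK X₀ X₁ s f) := by
  obtain ⟨C, hC, H⟩ := hw.exists_le_of_ratio hΛ
  refine ⟨C.toNNReal * Λ.toNNReal, fun f s t hs ht h1 h2 => ?_⟩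
  refine (mul_le_mul' (ENNReal.ofReal_le_ofReal (H s t hs ht h1 h2))
    (peetreK_le_of_le_mul f hΛ hs h1)).trans_eq ?_
  rw [ENNReal.ofReal_mul hC.le, ENNReal.coe_mul]
  simp only [ENNReal.ofReal]
  ring

/-- The discretized norm of a standard space can be computed along the sequence `ρ(2 ^ k)`. -/
theorem seqNorm_weightedSeq_domEqv_comp {p : ℝ} {ρ : ℝ → ℝ} (hq : 0 < q) (ha : RegVar pa a)
    (hρ : RegVar p ρ) (hp : 0 < p) :
    DomEqv (fun f => seqNorm q (weightedSeq X₀ X₁ θ a f))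
      (fun f => seqNorm q (fun k => sample (fun t => ρ t ^ (-θ) * a (ρ t)) k *
        peetreK X₀ X₁ (ρ (2 ^ k)) f)) := by
  have hw := (RegVar.id_rpow (-θ)).mul ha
  have hpos : ∀ k : ℤ, (0 : ℝ) < 2 ^ k := fun k => zpow_pos two_pos k
  constructor
  · obtain ⟨Λ, hΛ, H⟩ := hρ.exists_comparable hp
    choose ψ hψ using fun n : ℤ => H (2 ^ n) (hpos n)
    -- If `ψ m = ψ n`, then `2^m` and `2^n` are both within a factor `Λ` of the same value of `ρ`,
    -- hence within `Λ²` of each other.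
    obtain ⟨N, hN⟩ := (RegVar.id_rpow 1).exists_abs_sub_le one_pos (Λ * Λ)
    obtain ⟨C, hC⟩ := exists_peetreK_weight_le hw hΛ X₀ X₁
    refine dom_seqNorm_of_comp hq ψ N (fun m n hmn => hN m n ?_ ?_) ⟨C, fun f n => ?_⟩
    · rw [Real.rpow_one, Real.rpow_one, mul_assoc]
      refine (hψ m).1.trans ?_
      rw [hmn]
      gcongr
      exact (hψ n).2
    · rw [Real.rpow_one, Real.rpow_one, mul_assoc]
      refine (hψ n).1.trans ?_
      rw [← hmn]
      gcongr
      exact (hψ m).2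
    · exact hC f (ρ (2 ^ ψ n)) (2 ^ n) (hρ.1 _ (hpos _)) (hpos n) (hψ n).1 (hψ n).2
  -- Conversely, `φ k` is the cell containing `ρ (2 ^ k)`; equal cells mean values of `ρ` within a
  -- factor `2`.
  · choose φ hφ using fun k : ℤ => exists_mem_cell (hρ.1 _ (hpos k))
    obtain ⟨N, hN⟩ := hρ.exists_abs_sub_le hp 2
    obtain ⟨C, hC⟩ := exists_peetreK_weight_le hw one_le_two X₀ X₁
    have key : ∀ {j k}, φ j = φ k → ρ (2 ^ j) ≤ 2 * ρ (2 ^ k) := by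
      intro j k hjk
      have h1 := (lt_two_mul_of_mem_cell (hφ j)).le
      rw [hjk] at h1
      linarith [(hφ k).1]
    refine dom_seqNorm_of_comp hq φ N (fun j k hjk => hN j k (key hjk) (key hjk.symm))
      ⟨C, fun f k => ?_⟩
    refine hC f (2 ^ φ k) (ρ (2 ^ k)) (hpos _) (hρ.1 _ (hpos k))
      (lt_two_mul_of_mem_cell (hφ k)).le ?_
    linarith [(hφ k).1, hρ.1 _ (hpos k)]

end Spaces

/-! ### Holmstedt's formula for sequences -/

theorem DomEqv.dom_mul_right {κ : Type*} {x y : κ → ℝ≥0∞} (h : DomEqv x y) (z : κ → ℝ≥0∞) :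
    DomEqv (fun i => x i * z i) (fun i => y i * z i) := ⟨h.1.mul (Dom.refl z), h.2.mul (Dom.refl z)⟩

/-- The slowly varying functions that enter Holmstedt's formula, with `T`, `H`, `X` comparable to
`‖b₀‖_{r₀,(t,∞)}`, `‖b₁‖_{r₁,(0,t)}` and `‖b₁(s) ‖a₁‖_{q₁,(s,t)}‖_{r₁,(0,t)}`. -/
structure HolmstedtWeights (θ₀ : ℝ) (r₀ q₀ r₁ q₁ : ℝ≥0∞) (a₀ b₀ a₁ b₁ T H X : ℝ → ℝ) : Prop where
  θ_pos : 0 < θ₀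
  θ_lt_one : θ₀ < 1
  r₀_pos : 0 < r₀
  q₀_pos : 0 < q₀
  r₁_pos : 0 < r₁
  q₁_pos : 0 < q₁
  regVar_a₀ : RegVar 0 a₀
  regVar_b₀ : RegVar 0 b₀
  regVar_a₁ : RegVar 0 a₁
  regVar_b₁ : RegVar 0 b₁
  regVar_T : RegVar 0 T
  regVar_H : RegVar 0 H
  regVar_X : RegVar 0 X
  T_eqv : DomEqv (sample T) (tailNorm r₀ (sample b₀))
  H_eqv : DomEqv (sample H) (headNorm r₁ (sample b₁))
  X_eqv : DomEqv (sample X) (nestedSeq r₁ (sample b₁) q₁ (sample a₁))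

/-- The dyadic sequence `2 ^ (-k)`. -/
noncomputable def invSeq (k : ℤ) : ℝ≥0∞ := sample (fun t => t ^ (-1 : ℝ)) k

/-- `‖b₀(s) ‖u ^ (-θ₀) a₀(u) κ(u)‖_{q₀,(0,s)}‖_{r₀}` for sequences. -/
noncomputable def seqL (r : ℝ≥0∞) (b : ℤ → ℝ≥0∞) (q : ℝ≥0∞) (x : ℤ → ℝ≥0∞) : ℝ≥0∞ :=
  seqNorm r fun k => b k * headNorm q x k

/-- `‖b₁(s) ‖u ^ (-1) a₁(u) κ(u)‖_{q₁,(s,∞)}‖_{r₁}` for sequences. -/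
noncomputable def seqR (r : ℝ≥0∞) (b : ℤ → ℝ≥0∞) (q : ℝ≥0∞) (x : ℤ → ℝ≥0∞) : ℝ≥0∞ :=
  seqNorm r fun k => b k * tailNorm q x k

/-- The part of Holmstedt's formula that comes from the first space. -/
noncomputable def holmL (r : ℝ≥0∞) (b T : ℤ → ℝ≥0∞) (q : ℝ≥0∞) (x : ℤ → ℝ≥0∞) (k : ℤ) : ℝ≥0∞ :=
  headNorm r (fun j => b j * headNorm q x j) k + T k * headNorm q x k

/-- The part of Holmstedt's formula that comes from the second space. -/
noncomputable def holmR (r : ℝ≥0∞) (b H X : ℤ → ℝ≥0∞) (q : ℝ≥0∞) (y κ : ℤ → ℝ≥0∞) (k : ℤ) :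
    ℝ≥0∞ :=
  X k * (invSeq k * κ k) + H k * tailNorm q y k + tailNorm r (fun j => b j * tailNorm q y j) k

theorem exists_seqNorm_le_head_add_tail (q : ℝ≥0∞) :
    ∃ C : ℝ≥0, ∀ (x : ℤ → ℝ≥0∞) (k : ℤ), seqNorm q x ≤ C * (headNorm q x k + tailNorm q x k) := by
  obtain ⟨C, hC⟩ := exists_seqNorm_add_le q
  refine ⟨C, fun x k => (seqNorm_mono fun j => ?_).trans (hC _ _)⟩
  rcases le_total j k with h | h
  · rw [indicator_of_mem (show j ∈ Iic k from h)]; exact le_self_add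
  · rw [indicator_of_mem (show j ∈ Ici k from h)]; exact le_add_self

theorem exists_tailNorm_le_mid_add_tail (q : ℝ≥0∞) :
    ∃ C : ℝ≥0, ∀ (x : ℤ → ℝ≥0∞) (j k : ℤ),
      tailNorm q x j ≤ C * (seqNorm q ((Icc j k).indicator x) + tailNorm q x k) := by
  obtain ⟨C, hC⟩ := exists_seqNorm_add_le q
  refine ⟨C, fun x j k => (seqNorm_mono fun i => ?_).trans (hC _ _)⟩
  by_cases hi : i ∈ Ici j
  · rw [indicator_of_mem hi]
    rcases le_total i k with h | h
    · rw [indicator_of_mem (show i ∈ Icc j k from ⟨hi, h⟩)]; exact le_self_add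
    · rw [indicator_of_mem (show i ∈ Ici k from h)]; exact le_add_self
  · rw [indicator_of_notMem hi]; exact zero_le

namespace HolmstedtWeights

variable {θ₀ : ℝ} {r₀ q₀ r₁ q₁ : ℝ≥0∞} {a₀ b₀ a₁ b₁ T H X : ℝ → ℝ} {ι : Type*}
  {κ κ' κ'' : ι → ℤ → ℝ≥0∞}

theorem dom₂_seq {x y : ℤ → ℝ≥0∞} (h : Dom x y) : Dom₂ (fun (_ : ι) k => x k) (fun _ k => y k) :=
  (h.comp (fun p : ι × ℤ => p.2)).dom₂

theorem two_zpow_pos (k : ℤ) : (0 : ℝ) < 2 ^ k := zpow_pos two_pos k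

theorem sample_U₁ (a₁ : ℝ → ℝ) (k : ℤ) :
    sample (fun t => t ^ (-1 : ℝ) * a₁ t) k = invSeq k * sample a₁ k :=
  sample_mul (Real.rpow_nonneg (two_zpow_pos k).le _)

theorem sample_U₀_mul_T (W : HolmstedtWeights θ₀ r₀ q₀ r₁ q₁ a₀ b₀ a₁ b₁ T H X) (k : ℤ) :
    sample (fun t => (t ^ (-θ₀) * a₀ t * T t)⁻¹) k *
      (sample T k * sample (fun t => t ^ (-θ₀) * a₀ t) k) = 1 := by
  have h := two_zpow_pos k
  have h1 := W.regVar_a₀.1 _ h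
  have h2 := W.regVar_T.1 _ h
  have h3 := Real.rpow_pos_of_pos h (-θ₀)
  unfold sample
  rw [← ENNReal.ofReal_mul h2.le, ← ENNReal.ofReal_mul (by positivity), ← ENNReal.ofReal_one]
  congr 1
  field_simp

theorem sample_m₁_mul (W : HolmstedtWeights θ₀ r₀ q₀ r₁ q₁ a₀ b₀ a₁ b₁ T H X) (k : ℤ) :
    sample (fun t => t ^ (1 : ℝ) * (X t)⁻¹) k * (sample X k * invSeq k) = 1 := by
  have h := two_zpow_pos k
  have h2 := W.regVar_X.1 _ h
  unfold invSeq sample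
  rw [← ENNReal.ofReal_mul h2.le, ← ENNReal.ofReal_mul (by positivity), ← ENNReal.ofReal_one]
  congr 1
  beta_reduce
  rw [Real.rpow_neg_one, Real.rpow_one]
  field_simp

/-- `ρ` is the quotient of `T t^{-θ₀} a₀` by `X/t`, the weights with which the first and the second
norm control `K(t,f)`. -/
theorem sample_rho (W : HolmstedtWeights θ₀ r₀ q₀ r₁ q₁ a₀ b₀ a₁ b₁ T H X) (k : ℤ) :
    sample (rhoFun θ₀ (fun t => a₀ t * T t) X) k =
      sample T k * (sample (fun t => t ^ (-θ₀) * a₀ t) k *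
        sample (fun t => t ^ (1 : ℝ) * (X t)⁻¹) k) := by
  have h := two_zpow_pos k
  have h1 := W.regVar_a₀.1 _ h
  have h2 := W.regVar_T.1 _ h
  have h4 := W.regVar_X.1 _ h
  have h3 := Real.rpow_pos_of_pos h (-θ₀)
  unfold sample rhoFun
  rw [← ENNReal.ofReal_mul (by positivity), ← ENNReal.ofReal_mul h2.le]
  congr 1
  beta_reduce
  rw [Real.rpow_one, sub_eq_add_neg, Real.rpow_add h, Real.rpow_one]
  field_simp

theorem rho_regVar (W : HolmstedtWeights θ₀ r₀ q₀ r₁ q₁ a₀ b₀ a₁ b₁ T H X) :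
    RegVar (1 - θ₀) (rhoFun θ₀ (fun t => a₀ t * T t) X) :=
  (((RegVar.id_rpow (1 - θ₀)).mul ((W.regVar_a₀.mul W.regVar_T).mul W.regVar_X.inv)).congr fun t ht => by
    simp only [rhoFun, div_eq_mul_inv]).of_eq (by ring)

theorem b₀_le (W : HolmstedtWeights θ₀ r₀ q₀ r₁ q₁ a₀ b₀ a₁ b₁ T H X) :
    Dom (sample b₀) (sample T) :=
  (Dom.of_le fun _ => le_tailNorm W.r₀_pos _ le_rfl).trans W.T_eqv.2

theorem b₁_le (W : HolmstedtWeights θ₀ r₀ q₀ r₁ q₁ a₀ b₀ a₁ b₁ T H X) :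
    Dom (sample b₁) (sample H) :=
  (Dom.of_le fun _ => le_headNorm W.r₁_pos _ le_rfl).trans W.H_eqv.2

/-- Each inner norm over `[j,k]` contains the term `a k`. -/
theorem headNorm_mul_le_nestedSeq {r q : ℝ≥0∞} (hr : 0 < r) (hq : 0 < q) (a b : ℤ → ℝ≥0∞) (k : ℤ) :
    headNorm r b k * a k ≤ nestedSeq r b q a k := by
  rw [mul_comm, ← headNorm_const_mul hr]
  refine seqNorm_indicator_mono _ _ subset_rfl fun j hj => ?_
  rw [mul_comm]
  refine mul_le_mul' le_rfl ?_
  have := le_seqNorm hq ((Icc j k).indicator a) k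
  rwa [indicator_of_mem (show k ∈ Icc j k from ⟨hj, le_rfl⟩)] at this

theorem H_mul_a₁_le (W : HolmstedtWeights θ₀ r₀ q₀ r₁ q₁ a₀ b₀ a₁ b₁ T H X) :
    Dom (fun k => sample H k * sample a₁ k) (sample X) :=
  ((W.H_eqv.dom_mul_right _).1.trans (Dom.of_le fun _ =>
    headNorm_mul_le_nestedSeq W.r₁_pos W.q₁_pos _ _ _)).trans W.X_eqv.2

/-- In the outer norm keep only the indices `j ≥ k`, where the inner head norm is at least its value
at `k`. `H_mul_tail_le` is the mirror image. -/
theorem T_mul_head_le (W : HolmstedtWeights θ₀ r₀ q₀ r₁ q₁ a₀ b₀ a₁ b₁ T H X)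
    (x : ι → ℤ → ℝ≥0∞) :
    Dom₂ (fun i k => sample T k * headNorm q₀ (x i) k) (fun i _ => seqL r₀ (sample b₀) q₀ (x i)) := by
  refine ((dom₂_seq W.T_eqv.1).mul (Dom₂.refl _)).trans
    (Dom₂.of_le fun i k => ?_)
  rw [mul_comm, ← tailNorm_const_mul W.r₀_pos]
  refine seqNorm_mono fun j => ?_
  by_cases hj : j ∈ Ici k
  · rw [indicator_of_mem hj, mul_comm]
    exact mul_le_mul' le_rfl (headNorm_mono_right _ hj)
  · rw [indicator_of_notMem hj]; exact zero_le

theorem H_mul_tail_le (W : HolmstedtWeights θ₀ r₀ q₀ r₁ q₁ a₀ b₀ a₁ b₁ T H X)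
    (y : ι → ℤ → ℝ≥0∞) :
    Dom₂ (fun i k => sample H k * tailNorm q₁ (y i) k) (fun i _ => seqR r₁ (sample b₁) q₁ (y i)) := by
  refine ((dom₂_seq W.H_eqv.1).mul (Dom₂.refl _)).trans
    (Dom₂.of_le fun i k => ?_)
  rw [mul_comm, ← headNorm_const_mul W.r₁_pos]
  refine seqNorm_mono fun j => ?_
  by_cases hj : j ∈ Iic k
  · rw [indicator_of_mem hj, mul_comm]
    exact mul_le_mul' le_rfl (tailNorm_anti_right _ hj)
  · rw [indicator_of_notMem hj]; exact zero_le

/-- On the block `[j,k]` the ratio `κ(u)/u` is at least its value at `2^k`; pulling that value out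
leaves the nested norm that defines `X`. -/
theorem X_mul_le (W : HolmstedtWeights θ₀ r₀ q₀ r₁ q₁ a₀ b₀ a₁ b₁ T H X)
    (hκ : ∀ i, Antitone fun k => invSeq k * κ i k) :
    Dom₂ (fun i k => sample X k * (invSeq k * κ i k)) (fun i _ => seqR r₁ (sample b₁) q₁
      (fun j => sample (fun t => t ^ (-1 : ℝ) * a₁ t) j * κ i j)) := by
  refine ((dom₂_seq W.X_eqv.1).mul (Dom₂.refl _)).trans
    (Dom₂.of_le fun i k => ?_)
  rw [mul_comm]
  unfold nestedSeq
  rw [← headNorm_const_mul W.r₁_pos]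
  refine seqNorm_mono fun j => ?_
  by_cases hj : j ∈ Iic k
  · rw [indicator_of_mem hj, mul_left_comm, ← seqNorm_indicator_const_mul W.q₁_pos]
    refine mul_le_mul' le_rfl (seqNorm_indicator_mono _ _ (fun l hl => hl.1) fun l hl => ?_)
    calc (invSeq k * κ i k) * sample a₁ l ≤ (invSeq l * κ i l) * sample a₁ l :=
          mul_le_mul' (hκ i hl.2) le_rfl
      _ = _ := by rw [sample_U₁]; ring
  · rw [indicator_of_notMem hj]; exact zero_le

theorem headNorm_sample_dom {q : ℝ≥0∞} (hq : 0 < q) {p : ℝ} {w : ℝ → ℝ} (h : RegVar p w)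
    (hp : 0 < p) : Dom (headNorm q (sample w)) (sample w) := h.exists_headNorm_sample_le hq hp

theorem tailNorm_sample_dom {q : ℝ≥0∞} (hq : 0 < q) {p : ℝ} {w : ℝ → ℝ} (h : RegVar p w)
    (hp : p < 0) : Dom (tailNorm q (sample w)) (sample w) := h.exists_tailNorm_sample_le hq hp

theorem headNorm_dom_of_dom {q : ℝ≥0∞} (hq : 0 < q) {p : ℝ} {w : ℝ → ℝ} (h : RegVar p w)
    (hp : 0 < p) {x : ι → ℤ → ℝ≥0∞} {N : ι → ℝ≥0∞} (hx : Dom₂ x fun i k => N i * sample w k) :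
    Dom₂ (fun i k => headNorm q (x i) k) fun i k => N i * sample w k := by
  refine (hx.headNorm hq).trans ?_
  simp only [headNorm_const_mul hq]
  exact ((Dom.refl (fun p : ι × ℤ => N p.1)).mul
    ((headNorm_sample_dom hq h hp).comp (fun p : ι × ℤ => p.2))).dom₂

theorem tailNorm_dom_of_dom {q : ℝ≥0∞} (hq : 0 < q) {p : ℝ} {w : ℝ → ℝ} (h : RegVar p w)
    (hp : p < 0) {x : ι → ℤ → ℝ≥0∞} {N : ι → ℝ≥0∞} (hx : Dom₂ x fun i k => N i * sample w k) :
    Dom₂ (fun i k => tailNorm q (x i) k) fun i k => N i * sample w k := by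
  refine (hx.tailNorm hq).trans ?_
  simp only [tailNorm_const_mul hq]
  exact ((Dom.refl (fun p : ι × ℤ => N p.1)).mul
    ((tailNorm_sample_dom hq h hp).comp (fun p : ι × ℤ => p.2))).dom₂

variable (θ₀ r₀ q₀ r₁ q₁ a₀ b₀ a₁ b₁ T H X) in
/-- The right-hand side of Holmstedt's formula at `ρ(2 ^ k)`. -/
noncomputable def holm (κ : ℤ → ℝ≥0∞) (k : ℤ) : ℝ≥0∞ :=
  holmL r₀ (sample b₀) (sample T) q₀ (fun j => sample (fun t => t ^ (-θ₀) * a₀ t) j * κ j) k +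
  sample (rhoFun θ₀ (fun t => a₀ t * T t) X) k *
    holmR r₁ (sample b₁) (sample H) (sample X) q₁
      (fun j => sample (fun t => t ^ (-1 : ℝ) * a₁ t) j * κ j) κ k

/-- The first norm `N` bounds `κ` pointwise by `N m`, where `m = (t^{-θ₀} a₀ T)⁻¹` has index `θ₀`.
The tail pieces then involve weights of index `θ₀ - 1 < 0`, whose tails are governed by their first
term. With `b₁ ≲ H` and `H a₁ ≲ X` all reduces to `ρ X m / t = 1`. -/
theorem holm_dom_left (W : HolmstedtWeights θ₀ r₀ q₀ r₁ q₁ a₀ b₀ a₁ b₁ T H X)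
    (κ : ι → ℤ → ℝ≥0∞) :
    Dom₂ (fun i => holm θ₀ r₀ q₀ r₁ q₁ a₀ b₀ a₁ b₁ T H X (κ i))
      (fun i _ => seqL r₀ (sample b₀) q₀ (fun j => sample (fun t => t ^ (-θ₀) * a₀ t) j * κ i j)) := by
  set x : ι → ℤ → ℝ≥0∞ := fun i j => sample (fun t => t ^ (-θ₀) * a₀ t) j * κ i j with hx
  set y : ι → ℤ → ℝ≥0∞ := fun i j => sample (fun t => t ^ (-1 : ℝ) * a₁ t) j * κ i j with hy
  set N : ι → ℝ≥0∞ := fun i => seqL r₀ (sample b₀) q₀ (x i) with hN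
  set m : ℝ → ℝ := fun t => (t ^ (-θ₀) * a₀ t * T t)⁻¹ with hm
  set R := rhoFun θ₀ (fun t => a₀ t * T t) X with hR
  have hmv : RegVar θ₀ m := (((RegVar.id_rpow (-θ₀)).mul W.regVar_a₀).mul W.regVar_T).inv.of_eq (by ring)
  have hmpos : ∀ k : ℤ, 0 ≤ m (2 ^ k) := fun k => (hmv.1 _ (two_zpow_pos k)).le
  have hlt := W.θ_lt_one
  have hκ : Dom₂ κ fun i k => N i * sample m k := by
    have h1 : Dom₂ (fun i k => sample T k * x i k) (fun i _ => N i) :=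
      (Dom₂.of_le fun i k => mul_le_mul' le_rfl (le_headNorm W.q₀_pos (x i) le_rfl)).trans
        (W.T_mul_head_le x)
    refine (Dom₂.of_le fun i k => le_of_eq ?_).trans ((h1.const_mul fun _ k => sample m k).trans
      (Dom₂.of_le fun i k => (mul_comm _ _).le))
    have := W.sample_U₀_mul_T k
    calc κ i k = (sample m k * (sample T k * sample (fun t => t ^ (-θ₀) * a₀ t) k)) * κ i k := by
          rw [this, one_mul]
      _ = _ := by simp only [hx]; ring
  have hJ : Dom₂ (fun i k => tailNorm q₁ (y i) k)
      fun i k => N i * sample (fun t => (t ^ (-1 : ℝ) * a₁ t) * m t) k := by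
    refine tailNorm_dom_of_dom W.q₁_pos (((RegVar.id_rpow (-1)).mul W.regVar_a₁).mul hmv)
      (by linarith) ?_
    refine (hκ.const_mul fun _ k => sample (fun t => t ^ (-1 : ℝ) * a₁ t) k).trans
      (Dom₂.of_le fun i k => le_of_eq ?_)
    rw [sample_mul (w := fun t => t ^ (-1 : ℝ) * a₁ t)
      ((((RegVar.id_rpow (-1)).mul W.regVar_a₁).1 _ (two_zpow_pos k)).le)]
    ring
  have hI : Dom₂ (fun i k => tailNorm r₁ (fun j => sample b₁ j * tailNorm q₁ (y i) j) k)
      fun i k => N i * sample (fun t => b₁ t * ((t ^ (-1 : ℝ) * a₁ t) * m t)) k := by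
    refine tailNorm_dom_of_dom W.r₁_pos (W.regVar_b₁.mul (((RegVar.id_rpow (-1)).mul W.regVar_a₁).mul hmv))
      (by linarith) ?_
    refine (hJ.const_mul fun _ k => sample b₁ k).trans (Dom₂.of_le fun i k => le_of_eq ?_)
    rw [sample_mul (w := b₁) (W.regVar_b₁.1 _ (two_zpow_pos k)).le]
    ring
  have hU : ∀ k, sample (fun t => (t ^ (-1 : ℝ) * a₁ t) * m t) k =
      invSeq k * sample a₁ k * sample m k := fun k => by
    rw [sample_mul (w := fun t => t ^ (-1 : ℝ) * a₁ t)
      ((((RegVar.id_rpow (-1)).mul W.regVar_a₁).1 _ (two_zpow_pos k)).le), sample_U₁]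
  have hone : ∀ k, sample R k * (sample X k * (invSeq k * sample m k)) = 1 := fun k => by
    rw [hR, W.sample_rho]
    calc _ = (sample m k * (sample T k * sample (fun t => t ^ (-θ₀) * a₀ t) k)) *
          (sample (fun t => t ^ (1 : ℝ) * (X t)⁻¹) k * (sample X k * invSeq k)) := by ring
      _ = 1 := by rw [W.sample_U₀_mul_T, W.sample_m₁_mul, one_mul]
  have hXm : Dom₂ (fun i k => sample R k * (sample X k * (N i * (invSeq k * sample m k))))
      (fun i _ => N i) := Dom₂.of_le fun i k => le_of_eq <| by
    calc _ = N i * (sample R k * (sample X k * (invSeq k * sample m k))) := by ring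
      _ = _ := by rw [hone, mul_one]
  have hHm : Dom₂ (fun i k => sample R k * (sample H k *
      (N i * sample (fun t => (t ^ (-1 : ℝ) * a₁ t) * m t) k))) (fun i _ => N i) := by
    refine Dom₂.trans ?_ hXm
    refine (Dom₂.of_le fun i k => le_of_eq ?_).trans
      (((dom₂_seq W.H_mul_a₁_le).const_mul
        fun i k => sample R k * N i * (invSeq k * sample m k)).trans
        (Dom₂.of_le fun i k => le_of_eq ?_))
    · rw [hU]; ring
    · ring
  unfold holm holmL holmR
  refine ((Dom₂.of_le fun i k => headNorm_le_seqNorm _ k).add (W.T_mul_head_le x)).add ?_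
  simp only [mul_add]
  refine (Dom₂.add ?_ ?_).add ?_
  · refine Dom₂.trans ?_ hXm
    have h := hκ.const_mul fun _ k => sample R k * (sample X k * invSeq k)
    refine (Dom₂.of_le fun i k => le_of_eq ?_).trans
      (h.trans (Dom₂.of_le fun i k => le_of_eq ?_)) <;> ring
  · exact (((hJ.const_mul fun _ k => sample H k)).const_mul fun _ k => sample R k).trans hHm
  · refine (hI.const_mul fun _ k => sample R k).trans (Dom₂.trans ?_ hHm)
    refine (Dom₂.of_le fun i k => le_of_eq ?_).trans
      (((dom₂_seq W.b₁_le).const_mul fun i k => sample R k *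
        (N i * sample (fun t => (t ^ (-1 : ℝ) * a₁ t) * m t) k)).trans
        (Dom₂.of_le fun i k => le_of_eq ?_))
    · rw [sample_mul (w := b₁) (W.regVar_b₁.1 _ (two_zpow_pos k)).le]; ring
    · ring

/-- The second norm `N` bounds `κ` by `N m` with `m = t/X` of index `1`. The head pieces have index
`1 - θ₀ > 0`, so they are governed by their last term, and `b₀ ≲ T` together with `T t^{-θ₀} a₀ m =
ρ` finishes. -/
theorem holm_dom_right (W : HolmstedtWeights θ₀ r₀ q₀ r₁ q₁ a₀ b₀ a₁ b₁ T H X)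
    (hκ : ∀ i, Antitone fun k => invSeq k * κ i k) :
    Dom₂ (fun i => holm θ₀ r₀ q₀ r₁ q₁ a₀ b₀ a₁ b₁ T H X (κ i))
      (fun i k => sample (rhoFun θ₀ (fun t => a₀ t * T t) X) k * seqR r₁ (sample b₁) q₁
        (fun j => sample (fun t => t ^ (-1 : ℝ) * a₁ t) j * κ i j)) := by
  set x : ι → ℤ → ℝ≥0∞ := fun i j => sample (fun t => t ^ (-θ₀) * a₀ t) j * κ i j with hx
  set y : ι → ℤ → ℝ≥0∞ := fun i j => sample (fun t => t ^ (-1 : ℝ) * a₁ t) j * κ i j with hy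
  set N : ι → ℝ≥0∞ := fun i => seqR r₁ (sample b₁) q₁ (y i) with hN
  set m : ℝ → ℝ := fun t => t ^ (1 : ℝ) * (X t)⁻¹ with hm
  set R := rhoFun θ₀ (fun t => a₀ t * T t) X with hR
  have hmv : RegVar 1 m := ((RegVar.id_rpow 1).mul W.regVar_X.inv).of_eq (by ring)
  have hU₀ := (RegVar.id_rpow (-θ₀)).mul W.regVar_a₀
  have hlt := W.θ_lt_one
  have hX : Dom₂ (fun i k => sample X k * (invSeq k * κ i k)) (fun i _ => N i) := W.X_mul_le hκ
  have hκm : Dom₂ κ fun i k => N i * sample m k := by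
    refine (Dom₂.of_le fun i k => le_of_eq ?_).trans ((hX.const_mul fun _ k => sample m k).trans
      (Dom₂.of_le fun i k => (mul_comm _ _).le))
    have := W.sample_m₁_mul k
    calc κ i k = (sample m k * (sample X k * invSeq k)) * κ i k := by
          rw [this, one_mul]
      _ = _ := by ring
  have hJ : Dom₂ (fun i k => headNorm q₀ (x i) k)
      fun i k => N i * sample (fun t => (t ^ (-θ₀) * a₀ t) * m t) k := by
    refine headNorm_dom_of_dom W.q₀_pos (hU₀.mul hmv) (by linarith) ?_
    refine (hκm.const_mul fun _ k => sample (fun t => t ^ (-θ₀) * a₀ t) k).trans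
      (Dom₂.of_le fun i k => le_of_eq ?_)
    rw [sample_mul (w := fun t => t ^ (-θ₀) * a₀ t) ((hU₀.1 _ (two_zpow_pos k)).le)]
    ring
  have hI : Dom₂ (fun i k => headNorm r₀ (fun j => sample b₀ j * headNorm q₀ (x i) j) k)
      fun i k => N i * sample (fun t => b₀ t * ((t ^ (-θ₀) * a₀ t) * m t)) k := by
    refine headNorm_dom_of_dom W.r₀_pos (W.regVar_b₀.mul (hU₀.mul hmv)) (by linarith) ?_
    refine (hJ.const_mul fun _ k => sample b₀ k).trans (Dom₂.of_le fun i k => le_of_eq ?_)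
    rw [sample_mul (w := b₀) (W.regVar_b₀.1 _ (two_zpow_pos k)).le]
    ring
  have hTm : Dom₂ (fun i k => sample T k * (N i * sample (fun t => (t ^ (-θ₀) * a₀ t) * m t) k))
      (fun i k => sample R k * N i) := Dom₂.of_le fun i k => le_of_eq <| by
    rw [hR, W.sample_rho, sample_mul (w := fun t => t ^ (-θ₀) * a₀ t) ((hU₀.1 _ (two_zpow_pos k)).le)]
    ring
  unfold holm holmL holmR
  refine (Dom₂.add ?_ ?_).add (Dom₂.const_mul ((hX.add (W.H_mul_tail_le y)).add
    (Dom₂.of_le fun i k => tailNorm_le_seqNorm _ k)) _)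
  · refine hI.trans (Dom₂.trans ?_ hTm)
    refine (Dom₂.of_le fun i k => le_of_eq ?_).trans
      (((dom₂_seq W.b₀_le).const_mul fun i k =>
        N i * sample (fun t => (t ^ (-θ₀) * a₀ t) * m t) k).trans
        (Dom₂.of_le fun i k => le_of_eq ?_))
    · rw [sample_mul (w := b₀) (W.regVar_b₀.1 _ (two_zpow_pos k)).le]; ring
    · ring
  · exact (hJ.const_mul fun _ k => sample T k).trans hTm

theorem headNorm_add_dom {q : ℝ≥0∞} {x y z : ι → ℤ → ℝ≥0∞} (hq : 0 < q)
    (h : Dom₂ x fun i k => y i k + z i k) :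
    Dom₂ (fun i k => headNorm q (x i) k)
      (fun i k => headNorm q (y i) k + headNorm q (z i) k) := by
  obtain ⟨C, hC⟩ := exists_seqNorm_indicator_add_le q
  exact (h.headNorm hq).trans ⟨C, fun i k => hC (Iic k) (y i) (z i)⟩

theorem tailNorm_add_dom {q : ℝ≥0∞} {x y z : ι → ℤ → ℝ≥0∞} (hq : 0 < q)
    (h : Dom₂ x fun i k => y i k + z i k) :
    Dom₂ (fun i k => tailNorm q (x i) k)
      (fun i k => tailNorm q (y i) k + tailNorm q (z i) k) := by
  obtain ⟨C, hC⟩ := exists_seqNorm_indicator_add_le q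
  exact (h.tailNorm hq).trans ⟨C, fun i k => hC (Ici k) (y i) (z i)⟩

theorem const_mul_add_dom {x y z : ι → ℤ → ℝ≥0∞} (h : Dom₂ x fun i k => y i k + z i k)
    (w : ℤ → ℝ≥0∞) :
    Dom₂ (fun i k => w k * x i k) (fun i k => w k * y i k + w k * z i k) := by
  simpa only [mul_add] using h.const_mul fun _ k => w k

theorem add_add_dom {x y z x' y' z' : ι → ℤ → ℝ≥0∞} (h : Dom₂ x fun i k => y i k + z i k)
    (h' : Dom₂ x' fun i k => y' i k + z' i k) :
    Dom₂ (fun i k => x i k + x' i k) (fun i k => (y i k + y' i k) + (z i k + z' i k)) :=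
  (h.trans (Dom₂.of_le fun _ _ => add_le_add le_self_add le_self_add)).add
    (h'.trans (Dom₂.of_le fun _ _ => add_le_add le_add_self le_add_self))

/-- All five pieces are built from multiplications by weights and monotone quasi-norms, each of
which preserves quasi-subadditivity. -/
theorem holm_add_dom (W : HolmstedtWeights θ₀ r₀ q₀ r₁ q₁ a₀ b₀ a₁ b₁ T H X)
    (h : Dom₂ κ fun i k => κ' i k + κ'' i k) :
    Dom₂ (fun i => holm θ₀ r₀ q₀ r₁ q₁ a₀ b₀ a₁ b₁ T H X (κ i))
      (fun i k => holm θ₀ r₀ q₀ r₁ q₁ a₀ b₀ a₁ b₁ T H X (κ' i) k +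
        holm θ₀ r₀ q₀ r₁ q₁ a₀ b₀ a₁ b₁ T H X (κ'' i) k) := by
  have hJ₀ := headNorm_add_dom W.q₀_pos
    (const_mul_add_dom h (sample (fun t => t ^ (-θ₀) * a₀ t)))
  have hI₀ := headNorm_add_dom W.r₀_pos (const_mul_add_dom hJ₀ (sample b₀))
  have hJ₁ := tailNorm_add_dom W.q₁_pos
    (const_mul_add_dom h (sample (fun t => t ^ (-1 : ℝ) * a₁ t)))
  have hI₁ := tailNorm_add_dom W.r₁_pos (const_mul_add_dom hJ₁ (sample b₁))
  exact add_add_dom (add_add_dom hI₀ (const_mul_add_dom hJ₀ (sample T)))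
    (const_mul_add_dom (add_add_dom (add_add_dom
      (const_mul_add_dom (const_mul_add_dom h invSeq) (sample X))
      (const_mul_add_dom hJ₁ (sample H))) hI₁) _)

/-- Here `κ'` stands for the K-functional of `f₀`. Up to `k` it is replaced by `κ`. Beyond `k` it is
bounded, and since `t^{-θ₀} a₀` decays geometrically the inner norm stays below a multiple of its
value at `k`; the outer tail of `b₀` contributes the factor `T`. -/
theorem seqL_dom_holmL (W : HolmstedtWeights θ₀ r₀ q₀ r₁ q₁ a₀ b₀ a₁ b₁ T H X) (k : ι → ℤ) (c : ℝ≥0)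
    (h₁ : ∀ i, ∀ j ≤ k i, κ' i j ≤ c * κ i j) (h₂ : ∀ i, ∀ j ≥ k i, κ' i j ≤ c * κ i (k i)) :
    Dom (fun i => seqL r₀ (sample b₀) q₀ (fun j => sample (fun t => t ^ (-θ₀) * a₀ t) j * κ' i j))
      (fun i => holmL r₀ (sample b₀) (sample T) q₀
        (fun j => sample (fun t => t ^ (-θ₀) * a₀ t) j * κ i j) (k i)) := by
  set U := sample (fun t => t ^ (-θ₀) * a₀ t) with hU
  obtain ⟨D, hD⟩ := exists_seqNorm_le_head_add_tail q₀
  obtain ⟨D', hD'⟩ := exists_seqNorm_le_head_add_tail r₀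
  obtain ⟨E, hE⟩ := tailNorm_sample_dom W.q₀_pos ((RegVar.id_rpow (-θ₀)).mul W.regVar_a₀)
    (by linarith [W.θ_pos])
  obtain ⟨F, hF⟩ := W.T_eqv.2
  set M : ℝ≥0 := D * (c + c * E) with hM
  have hJ : ∀ i j, j ≤ k i → headNorm q₀ (fun j => U j * κ' i j) j ≤
      c * headNorm q₀ (fun j => U j * κ i j) j := by
    intro i j hj
    rw [← headNorm_const_mul W.q₀_pos]
    refine seqNorm_indicator_mono _ _ subset_rfl fun l hl => ?_
    rw [mul_left_comm]
    exact mul_le_mul' le_rfl (h₁ i l (le_trans hl hj))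
  have hJ' : ∀ i j, headNorm q₀ (fun j => U j * κ' i j) j ≤
      M * headNorm q₀ (fun j => U j * κ i j) (k i) := by
    intro i j
    have h3 : tailNorm q₀ (fun j => U j * κ' i j) (k i) ≤
        c * E * headNorm q₀ (fun j => U j * κ i j) (k i) := by
      calc tailNorm q₀ (fun j => U j * κ' i j) (k i)
          ≤ tailNorm q₀ (fun j => (c * κ i (k i)) * U j) (k i) :=
            seqNorm_indicator_mono _ _ subset_rfl fun l hl => by
              rw [mul_comm]; exact mul_le_mul' (h₂ i l hl) le_rfl
        _ = (c * κ i (k i)) * tailNorm q₀ U (k i) := tailNorm_const_mul W.q₀_pos _ _ _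
        _ ≤ (c * κ i (k i)) * (E * U (k i)) := mul_le_mul' le_rfl (hE _)
        _ = c * E * (U (k i) * κ i (k i)) := by ring
        _ ≤ _ := mul_le_mul' le_rfl (le_headNorm W.q₀_pos (fun j => U j * κ i j) le_rfl)
    calc headNorm q₀ (fun j => U j * κ' i j) j ≤ _ := headNorm_le_seqNorm _ j
      _ ≤ _ := hD _ (k i)
      _ ≤ D * (c * headNorm q₀ (fun j => U j * κ i j) (k i) +
            c * E * headNorm q₀ (fun j => U j * κ i j) (k i)) :=
          mul_le_mul' le_rfl (add_le_add (hJ i _ le_rfl) h3)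
      _ = _ := by rw [hM]; push_cast; ring
  refine ⟨D' * (c + M * F), fun i => (hD' _ (k i)).trans ?_⟩
  have h4 : headNorm r₀ (fun j => sample b₀ j * headNorm q₀ (fun j => U j * κ' i j) j) (k i) ≤
      c * headNorm r₀ (fun j => sample b₀ j * headNorm q₀ (fun j => U j * κ i j) j) (k i) := by
    rw [← headNorm_const_mul W.r₀_pos]
    refine seqNorm_indicator_mono _ _ subset_rfl fun l hl => ?_
    rw [mul_left_comm]
    exact mul_le_mul' le_rfl (hJ i l hl)
  have h5 : tailNorm r₀ (fun j => sample b₀ j * headNorm q₀ (fun j => U j * κ' i j) j) (k i) ≤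
      M * F * (sample T (k i) * headNorm q₀ (fun j => U j * κ i j) (k i)) := by
    calc _ ≤ tailNorm r₀ (fun j => (M * headNorm q₀ (fun j => U j * κ i j) (k i)) * sample b₀ j)
          (k i) := seqNorm_indicator_mono _ _ subset_rfl fun l _ => by
            rw [mul_comm]; exact mul_le_mul' (hJ' i l) le_rfl
      _ = (M * headNorm q₀ (fun j => U j * κ i j) (k i)) * tailNorm r₀ (sample b₀) (k i) :=
          tailNorm_const_mul W.r₀_pos _ _ _
      _ ≤ (M * headNorm q₀ (fun j => U j * κ i j) (k i)) * (F * sample T (k i)) :=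
          mul_le_mul' le_rfl (hF _)
      _ = _ := by ring
  unfold holmL
  calc _ ≤ (D' : ℝ≥0∞) * _ := mul_le_mul' le_rfl (add_le_add h4 h5)
    _ ≤ (D' : ℝ≥0∞) * ((c + M * F : ℝ≥0) * headNorm r₀ (fun j => sample b₀ j *
          headNorm q₀ (fun j => U j * κ i j) j) (k i) +
          (c + M * F : ℝ≥0) * (sample T (k i) * headNorm q₀ (fun j => U j * κ i j) (k i))) := by
        gcongr
        · exact le_self_add
        · push_cast; exact le_add_self
    _ = _ := by push_cast; ring

/-- Here `κ'` stands for the K-functional of `f₁`. For `j ≤ k` the inner tail splits at `k`: on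
`[j,k]` the ratio `κ'(u)/u` is bounded but `a₁` has index `0`, so no geometric sum is available and
the whole block norm of `a₁` remains, giving `X`; the part beyond `k` gives `H`. -/
theorem seqR_dom_holmR (W : HolmstedtWeights θ₀ r₀ q₀ r₁ q₁ a₀ b₀ a₁ b₁ T H X) (k : ι → ℤ) (c : ℝ≥0)
    (h₁ : ∀ i, ∀ j ≥ k i, κ' i j ≤ c * κ i j)
    (h₂ : ∀ i, ∀ j ≤ k i, invSeq j * κ' i j ≤ c * (invSeq (k i) * κ i (k i))) :
    Dom (fun i => seqR r₁ (sample b₁) q₁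
        (fun j => sample (fun t => t ^ (-1 : ℝ) * a₁ t) j * κ' i j))
      (fun i => holmR r₁ (sample b₁) (sample H) (sample X) q₁
        (fun j => sample (fun t => t ^ (-1 : ℝ) * a₁ t) j * κ i j) (κ i) (k i)) := by
  set U := sample (fun t => t ^ (-1 : ℝ) * a₁ t) with hU
  obtain ⟨D, hD⟩ := exists_tailNorm_le_mid_add_tail q₁
  obtain ⟨D', hD'⟩ := exists_seqNorm_le_head_add_tail r₁
  obtain ⟨D'', hD''⟩ := exists_seqNorm_indicator_add_le r₁
  obtain ⟨E, hE⟩ := W.X_eqv.2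
  obtain ⟨F, hF⟩ := W.H_eqv.2
  have hJ : ∀ i j, k i ≤ j → tailNorm q₁ (fun j => U j * κ' i j) j ≤
      c * tailNorm q₁ (fun j => U j * κ i j) j := by
    intro i j hj
    rw [← tailNorm_const_mul W.q₁_pos]
    refine seqNorm_indicator_mono _ _ subset_rfl fun l hl => ?_
    rw [mul_left_comm]
    exact mul_le_mul' le_rfl (h₁ i l (le_trans hj hl))
  have hJ' : ∀ i j, j ≤ k i → sample b₁ j * tailNorm q₁ (fun j => U j * κ' i j) j ≤
      (D * c * (invSeq (k i) * κ i (k i))) *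
          (sample b₁ j * seqNorm q₁ ((Icc j (k i)).indicator (sample a₁))) +
        (D * c * tailNorm q₁ (fun j => U j * κ i j) (k i)) * sample b₁ j := by
    intro i j hj
    have h3 : seqNorm q₁ ((Icc j (k i)).indicator fun j => U j * κ' i j) ≤
        (c * (invSeq (k i) * κ i (k i))) * seqNorm q₁ ((Icc j (k i)).indicator (sample a₁)) := by
      rw [← seqNorm_indicator_const_mul W.q₁_pos]
      refine seqNorm_indicator_mono _ _ subset_rfl fun l hl => ?_
      rw [hU, sample_U₁, mul_comm (invSeq l), mul_assoc, mul_comm]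
      exact mul_le_mul' (h₂ i l hl.2) le_rfl
    calc _ ≤ sample b₁ j * (D * _) := mul_le_mul' le_rfl ((hD _ j (k i)).trans
          (mul_le_mul' le_rfl (add_le_add h3 (hJ i (k i) le_rfl))))
      _ = _ := by ring
  refine ⟨D' * (D'' * D * c * (E + F) + c), fun i => (hD' _ (k i)).trans ?_⟩
  have h4 : headNorm r₁ (fun j => sample b₁ j * tailNorm q₁ (fun j => U j * κ' i j) j) (k i) ≤
      D'' * ((D * c * (invSeq (k i) * κ i (k i))) * (E * sample X (k i)) +
        (D * c * tailNorm q₁ (fun j => U j * κ i j) (k i)) * (F * sample H (k i))) := by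
    refine (seqNorm_indicator_mono (S := Iic (k i)) _ _ subset_rfl fun l hl => hJ' i l hl).trans
      ((hD'' _ _ _).trans ?_)
    rw [seqNorm_indicator_const_mul W.r₁_pos, seqNorm_indicator_const_mul W.r₁_pos]
    exact mul_le_mul' le_rfl (add_le_add (mul_le_mul' le_rfl (hE _)) (mul_le_mul' le_rfl (hF _)))
  have h5 : tailNorm r₁ (fun j => sample b₁ j * tailNorm q₁ (fun j => U j * κ' i j) j) (k i) ≤
      c * tailNorm r₁ (fun j => sample b₁ j * tailNorm q₁ (fun j => U j * κ i j) j) (k i) := by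
    rw [← tailNorm_const_mul W.r₁_pos]
    refine seqNorm_indicator_mono _ _ subset_rfl fun l hl => ?_
    rw [mul_left_comm]
    exact mul_le_mul' le_rfl (hJ i l hl)
  unfold holmR
  set P := sample X (k i) * (invSeq (k i) * κ i (k i))
  set Q := sample H (k i) * tailNorm q₁ (fun j => U j * κ i j) (k i)
  set S := tailNorm r₁ (fun j => sample b₁ j * tailNorm q₁ (fun j => U j * κ i j) j) (k i)
  set G : ℝ≥0 := D'' * D * c with hG
  calc _ ≤ (D' : ℝ≥0∞) * _ := mul_le_mul' le_rfl (add_le_add h4 h5)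
    _ = (D' : ℝ≥0∞) * ((G * E : ℝ≥0) * P + (G * F : ℝ≥0) * Q + c * S) := by
        simp only [hG, P, Q]; push_cast; ring
    _ ≤ (D' : ℝ≥0∞) * ((G * (E + F) + c : ℝ≥0) * P + (G * (E + F) + c : ℝ≥0) * Q +
          (G * (E + F) + c : ℝ≥0) * S) := by
        gcongr
        · rw [mul_add, add_assoc]; exact le_self_add
        · rw [mul_add, add_comm (G * E), add_assoc]; exact le_self_add
        · exact le_add_self
    _ = _ := by push_cast; ring

end HolmstedtWeights

/-! ### Holmstedt's formula for the K-functional -/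

theorem invSeq_mul_ofReal (k : ℤ) : invSeq k * ENNReal.ofReal (2 ^ k) = 1 := by
  have h : (0 : ℝ) < 2 ^ k := zpow_pos two_pos k
  unfold invSeq sample
  rw [← ENNReal.ofReal_mul (Real.rpow_nonneg h.le _), Real.rpow_neg_one, inv_mul_cancel₀ h.ne',
    ENNReal.ofReal_one]

section PeetreK

variable {V : Type*} [AddCommGroup V] {X₀ X₁ : V → ℝ≥0∞}

theorem antitone_invSeq_mul_peetreSeq (f : V) : Antitone fun k => invSeq k * peetreSeq X₀ X₁ f k := by
  intro k l hkl
  have hk : (0 : ℝ) < 2 ^ k := zpow_pos two_pos k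
  have hl : (0 : ℝ) < 2 ^ l := zpow_pos two_pos l
  have h := peetreK_le_ofReal_div_mul (X₀ := X₀) (X₁ := X₁) f hk
    (zpow_le_zpow_right₀ one_le_two hkl)
  have e : ENNReal.ofReal ((2 : ℝ) ^ l / 2 ^ k) = ENNReal.ofReal (2 ^ l) * invSeq k := by
    unfold invSeq sample
    rw [← ENNReal.ofReal_mul hl.le]
    beta_reduce
    rw [Real.rpow_neg_one, div_eq_mul_inv]
  rw [e] at h
  calc invSeq l * peetreSeq X₀ X₁ f l
      ≤ invSeq l * (ENNReal.ofReal (2 ^ l) * invSeq k * peetreSeq X₀ X₁ f k) :=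
        mul_le_mul' le_rfl h
    _ = (invSeq l * ENNReal.ofReal (2 ^ l)) * (invSeq k * peetreSeq X₀ X₁ f k) := by ring
    _ = _ := by rw [invSeq_mul_ofReal, one_mul]

/-! ### Near-optimal decompositions and the two-sided estimate. -/

/-- A decomposition `f = f₀ + f₁` that is optimal for the K-functional at `2 ^ k` up to a factor. -/
structure NearOptimal (X₀ X₁ : V → ℝ≥0∞) where
  f : V
  f₀ : V
  f₁ : V
  k : ℤ
  eq_add : f = f₀ + f₁
  le : X₀ f₀ + ENNReal.ofReal (2 ^ k) * X₁ f₁ ≤ 2 * peetreSeq X₀ X₁ f k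

theorem exists_nearOptimal {f : V} {k : ℤ} (h0 : peetreSeq X₀ X₁ f k ≠ 0)
    (h1 : peetreSeq X₀ X₁ f k ≠ ∞) : ∃ d : NearOptimal X₀ X₁, d.f = f ∧ d.k = k := by
  have h : peetreK X₀ X₁ (2 ^ k) f < 2 * peetreSeq X₀ X₁ f k := by
    rw [two_mul]
    exact ENNReal.lt_add_right h1 h0
  simp only [peetreK, iInf_lt_iff] at h
  obtain ⟨f₀, f₁, hf, hlt⟩ := h
  exact ⟨⟨f, f₀, f₁, k, hf, hlt.le⟩, rfl, rfl⟩

/-- The saturation bounds are `K(t,f₀) ≤ ‖f₀‖` and `K(t,f₁) ≤ t‖f₁‖`. For the other two, write `f₀ =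
f - f₁` or `f₁ = f - f₀` and bound the subtracted piece by `2 K(2^j,f)`, using that `K(t,f)/t` is
non-increasing or that `K` is non-decreasing. -/
theorem NearOptimal.exists_bounds
    (h₀ : ∃ C : ℝ≥0, ∀ x y : V, X₀ (x + y) ≤ C * (X₀ x + X₀ y))
    (h₁ : ∃ C : ℝ≥0, ∀ x y : V, X₁ (x + y) ≤ C * (X₁ x + X₁ y))
    (hz₀ : X₀ 0 = 0) (hz₁ : X₁ 0 = 0) (hn₀ : ∀ f, X₀ (-f) = X₀ f) (hn₁ : ∀ f, X₁ (-f) = X₁ f) :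
    ∃ c : ℝ≥0, ∀ d : NearOptimal X₀ X₁,
      (∀ j ≤ d.k, peetreSeq X₀ X₁ d.f₀ j ≤ c * peetreSeq X₀ X₁ d.f j) ∧
      (∀ j ≥ d.k, peetreSeq X₀ X₁ d.f₀ j ≤ c * peetreSeq X₀ X₁ d.f d.k) ∧
      (∀ j ≥ d.k, peetreSeq X₀ X₁ d.f₁ j ≤ c * peetreSeq X₀ X₁ d.f j) ∧
      (∀ j ≤ d.k, invSeq j * peetreSeq X₀ X₁ d.f₁ j ≤
        c * (invSeq d.k * peetreSeq X₀ X₁ d.f d.k)) := by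
  obtain ⟨C, hC⟩ := exists_peetreK_add_le h₀ h₁
  have hle : ((3 * C : ℝ≥0) : ℝ≥0∞) ≤ (3 * C + 2 : ℝ≥0) := by exact_mod_cast le_self_add
  have hle' : (2 : ℝ≥0∞) ≤ (3 * C + 2 : ℝ≥0) := by push_cast; exact le_add_self
  -- `3C` comes from the quasi-triangle inequality applied to `K + 2K`, and `2` from
  -- near-optimality.
  refine ⟨3 * C + 2, fun d => ?_⟩
  have e₀ : X₀ d.f₀ ≤ 2 * peetreSeq X₀ X₁ d.f d.k := le_self_add.trans d.le
  have e₁ : X₁ d.f₁ ≤ 2 * (invSeq d.k * peetreSeq X₀ X₁ d.f d.k) := by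
    calc X₁ d.f₁ = invSeq d.k * (ENNReal.ofReal (2 ^ d.k) * X₁ d.f₁) := by
          rw [← mul_assoc, invSeq_mul_ofReal, one_mul]
      _ ≤ invSeq d.k * (2 * peetreSeq X₀ X₁ d.f d.k) :=
          mul_le_mul' le_rfl (le_add_self.trans d.le)
      _ = _ := by ring
  refine ⟨fun j hj => ?_, fun j _ => ?_, fun j hj => ?_, fun j _ => ?_⟩
  · refine le_trans ?_ (mul_le_mul' hle le_rfl)
    have hd : d.f₀ = d.f + -d.f₁ := by rw [d.eq_add]; abel
    have h2 : peetreSeq X₀ X₁ (-d.f₁) j ≤ 2 * peetreSeq X₀ X₁ d.f j := by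
      calc peetreSeq X₀ X₁ (-d.f₁) j ≤ ENNReal.ofReal (2 ^ j) * X₁ (-d.f₁) :=
            peetreK_le_right hz₀ _ _
        _ ≤ ENNReal.ofReal (2 ^ j) * (2 * (invSeq j * peetreSeq X₀ X₁ d.f j)) := by
            rw [hn₁]
            exact mul_le_mul' le_rfl (e₁.trans (mul_le_mul' le_rfl
              (antitone_invSeq_mul_peetreSeq d.f hj)))
        _ = 2 * ((invSeq j * ENNReal.ofReal (2 ^ j)) * peetreSeq X₀ X₁ d.f j) := by ring
        _ = _ := by rw [invSeq_mul_ofReal, one_mul]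
    calc peetreSeq X₀ X₁ d.f₀ j
        ≤ C * (peetreSeq X₀ X₁ d.f j + peetreSeq X₀ X₁ (-d.f₁) j) := by
          rw [hd]; exact hC _ _ _
      _ ≤ C * (peetreSeq X₀ X₁ d.f j + 2 * peetreSeq X₀ X₁ d.f j) := by gcongr
      _ = _ := by push_cast; ring
  · refine le_trans ?_ (mul_le_mul' hle' le_rfl)
    exact (peetreK_le_left hz₁ _ _).trans e₀
  · refine le_trans ?_ (mul_le_mul' hle le_rfl)
    have hd : d.f₁ = d.f + -d.f₀ := by rw [d.eq_add]; abel
    have h2 : peetreSeq X₀ X₁ (-d.f₀) j ≤ 2 * peetreSeq X₀ X₁ d.f j := by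
      refine (peetreK_le_left hz₁ _ _).trans ?_
      rw [hn₀]
      exact e₀.trans (mul_le_mul' le_rfl (peetreSeq_mono d.f hj))
    calc peetreSeq X₀ X₁ d.f₁ j
        ≤ C * (peetreSeq X₀ X₁ d.f j + peetreSeq X₀ X₁ (-d.f₀) j) := by
          rw [hd]; exact hC _ _ _
      _ ≤ C * (peetreSeq X₀ X₁ d.f j + 2 * peetreSeq X₀ X₁ d.f j) := by gcongr
      _ = _ := by push_cast; ring
  · refine le_trans ?_ (mul_le_mul' hle' le_rfl)
    refine le_trans ?_ e₁
    refine (mul_le_mul' le_rfl (peetreK_le_right hz₀ _ _)).trans_eq ?_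
    rw [← mul_assoc, invSeq_mul_ofReal, one_mul]

end PeetreK

section QuasiBanach

variable {𝕜 : Type*} [RCLike 𝕜] {V : Type*} [AddCommGroup V] [Module 𝕜 V]
  [TopologicalSpace V] {N A₀ A₁ : V → ℝ≥0∞}

theorem IsQuasiBanachIn.zero (h : IsQuasiBanachIn 𝕜 N) : N 0 = 0 := (h.eq_zero_iff 0).2 rfl

theorem IsQuasiBanachIn.neg (h : IsQuasiBanachIn 𝕜 N) (f : V) : N (-f) = N f := by
  have := h.smul (-1) f
  simpa using this

/-- If `f ≠ 0`, the Hausdorff property gives a neighbourhood `U` of `0` with `f ∉ U + U`; but a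
decomposition of sufficiently small cost has both parts in `U`. -/
theorem IsQuasiBanachIn.eq_zero_of_peetreK_eq_zero [IsTopologicalAddGroup V] [T2Space V]
    (h₀ : IsQuasiBanachIn 𝕜 A₀) (h₁ : IsQuasiBanachIn 𝕜 A₁) {t : ℝ} (ht : 0 < t) {f : V}
    (hf : peetreK A₀ A₁ t f = 0) : f = 0 := by
  by_contra hne
  obtain ⟨U, hU, hUU⟩ := exists_nhds_zero_half (isOpen_ne.mem_nhds (Ne.symm hne) : {f}ᶜ ∈ 𝓝 (0 : V))
  obtain ⟨ε₀, hε₀, H₀⟩ := h₀.continuous_embedding U hU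
  obtain ⟨ε₁, hε₁, H₁⟩ := h₁.continuous_embedding U hU
  have ht' : ENNReal.ofReal t ≠ 0 := (ENNReal.ofReal_pos.2 ht).ne'
  have hlt : peetreK A₀ A₁ t f < min ε₀ (ENNReal.ofReal t * ε₁) := by
    rw [hf]
    exact lt_min hε₀ (ENNReal.mul_pos ht' hε₁.ne')
  simp only [peetreK, iInf_lt_iff] at hlt
  obtain ⟨f₀, f₁, hadd, hlt⟩ := hlt
  have m₀ := H₀ f₀ (le_self_add.trans_lt (hlt.trans_le (min_le_left _ _)))
  have m₁ := H₁ f₁ (lt_of_mul_lt_mul_left' (le_add_self.trans_lt (hlt.trans_le (min_le_right _ _))))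
  exact hUU f₀ m₀ f₁ m₁ hadd.symm

theorem seqL_zero {r q : ℝ≥0∞} (hr : 0 < r) (hq : 0 < q) (b : ℤ → ℝ≥0∞) :
    seqL r b q (fun _ => 0) = 0 := by
  have : ∀ k, headNorm q (fun _ => 0) k = 0 := fun k => by
    simpa using headNorm_const_mul hq 0 (fun _ => 0) k
  simp [seqL, this, seqNorm_zero hr]

theorem seqR_zero {r q : ℝ≥0∞} (hr : 0 < r) (hq : 0 < q) (b : ℤ → ℝ≥0∞) :
    seqR r b q (fun _ => 0) = 0 := by
  have : ∀ k, tailNorm q (fun _ => 0) k = 0 := fun k => by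
    simpa using tailNorm_const_mul hq 0 (fun _ => 0) k
  simp [seqR, this, seqNorm_zero hr]

variable {θ₀ : ℝ} {r₀ q₀ r₁ q₁ : ℝ≥0∞} {a₀ b₀ a₁ b₁ T H X : ℝ → ℝ}

theorem sample_weight_pos {p : ℝ} {w : ℝ → ℝ} (h : RegVar p w) (k : ℤ) : sample w k ≠ 0 :=
  (h.sample_pos k).ne'

/-- **Holmstedt's formula** for the couple of limiting spaces, up to equivalence of norms. -/
theorem HolmstedtWeights.peetreK_domEqv_holm [IsTopologicalAddGroup V] [T2Space V]
    (W : HolmstedtWeights θ₀ r₀ q₀ r₁ q₁ a₀ b₀ a₁ b₁ T H X)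
    (hA₀ : IsQuasiBanachIn 𝕜 A₀) (hA₁ : IsQuasiBanachIn 𝕜 A₁) :
    let P : V → ℤ → ℝ≥0∞ := fun f k => peetreK
      (fun f => seqL r₀ (sample b₀) q₀ (weightedSeq A₀ A₁ θ₀ a₀ f))
      (fun f => seqR r₁ (sample b₁) q₁ (weightedSeq A₀ A₁ 1 a₁ f))
      (rhoFun θ₀ (fun t => a₀ t * T t) X (2 ^ k)) f
    Dom₂ P (fun f => holm θ₀ r₀ q₀ r₁ q₁ a₀ b₀ a₁ b₁ T H X (peetreSeq A₀ A₁ f)) ∧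
    Dom₂ (fun f => holm θ₀ r₀ q₀ r₁ q₁ a₀ b₀ a₁ b₁ T H X (peetreSeq A₀ A₁ f)) P := by
  intro P
  set κ : V → ℤ → ℝ≥0∞ := peetreSeq A₀ A₁ with hκ
  set R := rhoFun θ₀ (fun t => a₀ t * T t) X with hR
  constructor
  · obtain ⟨c, hc⟩ := NearOptimal.exists_bounds hA₀.add_le hA₁.add_le hA₀.zero hA₁.zero
      hA₀.neg hA₁.neg
    -- Indexing by all near-optimal decompositions makes the constant independent of `f`, of `k` and
    -- of the decomposition.
    obtain ⟨D₀, hD₀⟩ := W.seqL_dom_holmL (κ := fun d : NearOptimal A₀ A₁ => κ d.f)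
      (κ' := fun d => κ d.f₀) (fun d => d.k) c (fun d => (hc d).1) (fun d => (hc d).2.1)
    obtain ⟨D₁, hD₁⟩ := W.seqR_dom_holmR (κ := fun d : NearOptimal A₀ A₁ => κ d.f)
      (κ' := fun d => κ d.f₁) (fun d => d.k) c (fun d => (hc d).2.2.1) (fun d => (hc d).2.2.2)
    refine ⟨D₀ + D₁ + 1, fun f k => ?_⟩
    by_cases h0 : κ f k = 0
    · have hf : f = 0 := hA₀.eq_zero_of_peetreK_eq_zero hA₁ (zpow_pos two_pos k) h0
      have hz : ∀ θ a, weightedSeq A₀ A₁ θ a 0 = fun _ => 0 := fun θ a => by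
        ext k
        simp only [weightedSeq, peetreSeq, peetreK_zero hA₀.zero hA₁.zero, mul_zero]
      have : P f k = 0 := by
        simp only [P, hf]
        refine peetreK_zero ?_ ?_ _
        · rw [hz, seqL_zero W.r₀_pos W.q₀_pos]
        · rw [hz, seqR_zero W.r₁_pos W.q₁_pos]
      rw [this]
      exact zero_le
    -- No near-optimal decomposition is available, but the middle piece already makes the right-hand
    -- side infinite.
    by_cases h1 : κ f k = ∞
    · have : holm θ₀ r₀ q₀ r₁ q₁ a₀ b₀ a₁ b₁ T H X (κ f) k = ∞ := by
        have e1 : sample R k ≠ 0 := sample_weight_pos W.rho_regVar k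
        have e2 : sample X k ≠ 0 := sample_weight_pos W.regVar_X k
        have e3 : invSeq k ≠ 0 := sample_weight_pos (RegVar.id_rpow (-1)) k
        have e4 : sample R k * (sample X k * (invSeq k * κ f k)) = ∞ := by
          rw [h1, ENNReal.mul_top e3, ENNReal.mul_top e2, ENNReal.mul_top e1]
        rw [← top_le_iff, ← e4]
        unfold holm holmR
        refine le_trans ?_ le_add_self
        exact mul_le_mul' le_rfl (le_self_add.trans le_self_add)
      beta_reduce
      rw [this, ENNReal.mul_top]
      · exact le_top
      · have : (0 : ℝ≥0) < D₀ + D₁ + 1 := by positivity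
        exact_mod_cast this.ne'
    obtain ⟨d, rfl, rfl⟩ := exists_nearOptimal h0 h1
    have key : ∀ x y l m ρ : ℝ≥0∞, x ≤ D₀ * l → y ≤ D₁ * m →
        x + ρ * y ≤ (D₀ + D₁ + 1 : ℝ≥0) * (l + ρ * m) := by
      intro x y l m ρ hx hy
      calc x + ρ * y ≤ D₀ * l + ρ * (D₁ * m) := add_le_add hx (mul_le_mul' le_rfl hy)
        _ = D₀ * l + D₁ * (ρ * m) := by rw [mul_left_comm ρ]
        _ ≤ (D₀ + D₁ + 1 : ℝ≥0) * l + (D₀ + D₁ + 1 : ℝ≥0) * (ρ * m) := by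
            refine add_le_add (mul_le_mul' ?_ le_rfl) (mul_le_mul' ?_ le_rfl)
            · rw [add_assoc]; exact_mod_cast le_self_add
            · rw [add_comm D₀, add_assoc]; exact_mod_cast le_self_add
        _ = _ := (mul_add _ _ _).symm
    exact (peetreK_le _ d.eq_add).trans (key _ _ _ _ _ (hD₀ d) (hD₁ d))
  -- For an arbitrary decomposition, split the right-hand side by quasi-subadditivity, bound the
  -- `f₀` part by the first norm and the `f₁` part by `ρ` times the second, then take the infimum.
  · obtain ⟨C, hC⟩ := exists_peetreK_add_le hA₀.add_le hA₁.add_le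
    have h1 := (W.holm_add_dom (κ := fun p : V × V => κ (p.1 + p.2)) (κ' := fun p => κ p.1)
      (κ'' := fun p => κ p.2) ⟨C, fun p k => hC _ _ _⟩)
    have h2 := W.holm_dom_left (fun p : V × V => κ p.1)
    have h3 := W.holm_dom_right (κ := fun p : V × V => κ p.2)
      (fun p => antitone_invSeq_mul_peetreSeq p.2)
    obtain ⟨D, hD⟩ := h1.trans (Dom₂.add (h2.trans (Dom₂.of_le fun _ _ => le_self_add))
      (h3.trans (Dom₂.of_le fun _ _ => le_add_self)))
    refine ⟨D + 1, fun f k => ?_⟩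
    have hD0 : ((D + 1 : ℝ≥0) : ℝ≥0∞) ≠ 0 := by
      have : (0 : ℝ≥0) < D + 1 := by positivity
      exact_mod_cast this.ne'
    rw [← ENNReal.inv_mul_le_iff hD0 ENNReal.coe_ne_top]
    refine le_peetreK fun f₀ f₁ hf => ?_
    rw [ENNReal.inv_mul_le_iff hD0 ENNReal.coe_ne_top]
    have := hD (f₀, f₁) k
    rw [hf]
    refine this.trans (mul_le_mul' ?_ le_rfl)
    exact_mod_cast le_self_add

end QuasiBanach

/-! ### The pieces of the norm of a reiterated space -/

namespace HolmstedtWeights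

variable {θ θ₀ : ℝ} {r r₀ q₀ r₁ q₁ : ℝ≥0∞} {a a₀ b₀ a₁ b₁ T H X : ℝ → ℝ} {ι : Type*}

local notation "ρf" => rhoFun θ₀ (fun t => a₀ t * T t) X
local notation "ωf" => fun t : ℝ => ρf t ^ (-θ) * a (ρf t)

theorem omega_regVar (W : HolmstedtWeights θ₀ r₀ q₀ r₁ q₁ a₀ b₀ a₁ b₁ T H X) (ha : RegVar 0 a) :
    RegVar (-θ * (1 - θ₀)) ωf :=
  ((W.rho_regVar.rpow (-θ)).mul (ha.comp W.rho_regVar)).of_eq (by ring)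

/-- This identity, built into the choice of `ρ`, turns a single term of the `T` head piece into the
middle piece. -/
theorem T_mul_U₀ (W : HolmstedtWeights θ₀ r₀ q₀ r₁ q₁ a₀ b₀ a₁ b₁ T H X) (k : ℤ) :
    sample T k * sample (fun t => t ^ (-θ₀) * a₀ t) k =
      sample ρf k * (sample X k * invSeq k) := by
  rw [W.sample_rho]
  calc _ = (sample T k * sample (fun t => t ^ (-θ₀) * a₀ t) k) *
        (sample (fun t => t ^ (1 : ℝ) * (X t)⁻¹) k * (sample X k * invSeq k)) := by
        rw [W.sample_m₁_mul, mul_one]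
    _ = _ := by ring

/-- The weight `ωT` has index `-θ(1-θ₀) < 0`, so Hardy's inequality replaces the head norm by its
last term. -/
theorem hardy_T_head (W : HolmstedtWeights θ₀ r₀ q₀ r₁ q₁ a₀ b₀ a₁ b₁ T H X) (ha : RegVar 0 a)
    (hr : 0 < r) (hθ : 0 < θ) (κ : ι → ℤ → ℝ≥0∞) :
    Dom (fun i => seqNorm r (fun k => sample ωf k * (sample T k *
        headNorm q₀ (fun j => sample (fun t => t ^ (-θ₀) * a₀ t) j * κ i j) k)))
      (fun i => seqNorm r (fun k => sample ωf k * (sample ρf k *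
        (sample X k * (invSeq k * κ i k))))) := by
  have hω := W.omega_regVar (θ := θ) ha
  have hp : -θ * (1 - θ₀) + 0 < 0 := by nlinarith [W.θ_lt_one]
  obtain ⟨C, hC⟩ := (hω.mul W.regVar_T).exists_hardy_head W.q₀_pos hr hp
  have e : ∀ k, sample (fun t => ωf t * T t) k = sample ωf k * sample T k := fun k =>
    sample_mul (w := ωf) (hω.1 _ (two_zpow_pos k)).le
  refine ⟨C, fun i => ?_⟩
  have := hC (fun j => sample (fun t => t ^ (-θ₀) * a₀ t) j * κ i j)
  simp only [e] at this
  refine (Eq.le ?_).trans (this.trans (Eq.le ?_))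
  · simp only [mul_assoc]
  · congr 2
    ext k
    rw [mul_assoc, ← mul_assoc (sample T k), W.T_mul_U₀]
    ring

/-- Hardy's inequality removes the outer head norm, and `b₀ ≲ T` leads back to the `T` head piece.
-/
theorem hardy_head_head (W : HolmstedtWeights θ₀ r₀ q₀ r₁ q₁ a₀ b₀ a₁ b₁ T H X) (ha : RegVar 0 a)
    (hr : 0 < r) (hθ : 0 < θ) (κ : ι → ℤ → ℝ≥0∞) :
    Dom (fun i => seqNorm r (fun k => sample ωf k * headNorm r₀ (fun j => sample b₀ j *
        headNorm q₀ (fun j => sample (fun t => t ^ (-θ₀) * a₀ t) j * κ i j) j) k))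
      (fun i => seqNorm r (fun k => sample ωf k * (sample ρf k *
        (sample X k * (invSeq k * κ i k))))) := by
  have hω := W.omega_regVar (θ := θ) ha
  have hp : -θ * (1 - θ₀) < 0 := by nlinarith [W.θ_lt_one]
  obtain ⟨C, hC⟩ := hω.exists_hardy_head W.r₀_pos hr hp
  refine Dom.trans ⟨C, fun i => hC _⟩ (Dom.trans ?_ (W.hardy_T_head ha hr hθ κ))
  exact Dom₂.seqNorm hr (((dom₂_seq W.b₀_le).mul (Dom₂.refl _)).const_mul fun _ k => sample ωf k)

/-- The weight `ωρH` has index `(1-θ)(1-θ₀) > 0`, so the tail norm reduces to its first term, and `H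
a₁ ≲ X`. -/
theorem hardy_H_tail (W : HolmstedtWeights θ₀ r₀ q₀ r₁ q₁ a₀ b₀ a₁ b₁ T H X) (ha : RegVar 0 a)
    (hr : 0 < r) (hθ : θ < 1) (κ : ι → ℤ → ℝ≥0∞) :
    Dom (fun i => seqNorm r (fun k => sample ωf k * (sample ρf k * (sample H k *
        tailNorm q₁ (fun j => sample (fun t => t ^ (-1 : ℝ) * a₁ t) j * κ i j) k))))
      (fun i => seqNorm r (fun k => sample ωf k * (sample ρf k *
        (sample X k * (invSeq k * κ i k))))) := by
  have hω := W.omega_regVar (θ := θ) ha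
  have hp : 0 < -θ * (1 - θ₀) + (1 - θ₀ + 0) := by nlinarith [W.θ_lt_one]
  have hRH := W.rho_regVar.mul W.regVar_H
  obtain ⟨C, hC⟩ := (hω.mul hRH).exists_hardy_tail W.q₁_pos hr hp
  have e : ∀ k, sample (fun t => ωf t * (ρf t * H t)) k =
      sample ωf k * (sample ρf k * sample H k) := fun k => by
    rw [sample_mul (w := ωf) (hω.1 _ (two_zpow_pos k)).le,
      sample_mul (w := ρf) (W.rho_regVar.1 _ (two_zpow_pos k)).le]
  refine Dom.trans ⟨C, fun i => ?_⟩ (Dom₂.seqNorm hr (x := fun i k => sample ωf k * (sample ρf k *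
    (sample H k * (sample a₁ k * (invSeq k * κ i k))))) ?_)
  · have := hC (fun j => sample (fun t => t ^ (-1 : ℝ) * a₁ t) j * κ i j)
    simp only [e] at this
    refine (Eq.le ?_).trans (this.trans (Eq.le ?_))
    · simp only [mul_assoc]
    · congr 2
      ext k
      rw [sample_U₁]
      ring
  · refine Dom₂.const_mul (Dom₂.const_mul ?_ _) _
    simp only [← mul_assoc (sample H _)]
    exact (dom₂_seq W.H_mul_a₁_le).mul (Dom₂.refl _)

theorem hardy_tail_tail (W : HolmstedtWeights θ₀ r₀ q₀ r₁ q₁ a₀ b₀ a₁ b₁ T H X) (ha : RegVar 0 a)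
    (hr : 0 < r) (hθ : θ < 1) (κ : ι → ℤ → ℝ≥0∞) :
    Dom (fun i => seqNorm r (fun k => sample ωf k * (sample ρf k * tailNorm r₁ (fun j => sample b₁ j *
        tailNorm q₁ (fun j => sample (fun t => t ^ (-1 : ℝ) * a₁ t) j * κ i j) j) k)))
      (fun i => seqNorm r (fun k => sample ωf k * (sample ρf k *
        (sample X k * (invSeq k * κ i k))))) := by
  have hω := W.omega_regVar (θ := θ) ha
  have hp : 0 < -θ * (1 - θ₀) + (1 - θ₀) := by nlinarith [W.θ_lt_one]
  obtain ⟨C, hC⟩ := (hω.mul W.rho_regVar).exists_hardy_tail W.r₁_pos hr hp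
  have e : ∀ k, sample (fun t => ωf t * ρf t) k = sample ωf k * sample ρf k := fun k =>
    sample_mul (w := ωf) (hω.1 _ (two_zpow_pos k)).le
  refine Dom.trans (y := fun i => seqNorm r (fun k => sample ωf k * (sample ρf k * (sample b₁ k *
      tailNorm q₁ (fun j => sample (fun t => t ^ (-1 : ℝ) * a₁ t) j * κ i j) k))))
    ⟨C, fun i => ?_⟩ (Dom.trans ?_ (W.hardy_H_tail ha hr hθ κ))
  · have := hC (fun j => sample b₁ j *
        tailNorm q₁ (fun j => sample (fun t => t ^ (-1 : ℝ) * a₁ t) j * κ i j) j)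
    simp only [e] at this
    refine (Eq.le ?_).trans (this.trans (Eq.le ?_)) <;> simp only [mul_assoc]
  · exact Dom₂.seqNorm hr ((((dom₂_seq W.b₁_le).mul (Dom₂.refl _)).const_mul
      fun _ k => sample ρf k).const_mul fun _ k => sample ωf k)

theorem exists_seqNorm_mul_add_le (q : ℝ≥0∞) (ω : ℤ → ℝ≥0∞) {x y : ι → ℤ → ℝ≥0∞}
    {z : ι → ℝ≥0∞} (hx : Dom (fun i => seqNorm q fun k => ω k * x i k) z)
    (hy : Dom (fun i => seqNorm q fun k => ω k * y i k) z) :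
    Dom (fun i => seqNorm q fun k => ω k * (x i k + y i k)) z := by
  obtain ⟨C, hC⟩ := exists_seqNorm_add_le q
  refine Dom.trans ⟨C, fun i => ?_⟩ (hx.add hy)
  simpa only [mul_add] using hC (fun k => ω k * x i k) fun k => ω k * y i k

/-- The weighted norm of Holmstedt's formula is bounded as soon as its five pieces are. -/
theorem seqNorm_holm_dom (ω : ℤ → ℝ≥0∞) {κ : ι → ℤ → ℝ≥0∞} {z : ι → ℝ≥0∞}
    (h₁ : Dom (fun i => seqNorm r (fun k => ω k * headNorm r₀ (fun j => sample b₀ j *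
        headNorm q₀ (fun j => sample (fun t => t ^ (-θ₀) * a₀ t) j * κ i j) j) k)) z)
    (h₂ : Dom (fun i => seqNorm r (fun k => ω k * (sample T k *
        headNorm q₀ (fun j => sample (fun t => t ^ (-θ₀) * a₀ t) j * κ i j) k))) z)
    (h₃ : Dom (fun i => seqNorm r (fun k => ω k * (sample ρf k *
        (sample X k * (invSeq k * κ i k))))) z)
    (h₄ : Dom (fun i => seqNorm r (fun k => ω k * (sample ρf k * (sample H k *
        tailNorm q₁ (fun j => sample (fun t => t ^ (-1 : ℝ) * a₁ t) j * κ i j) k)))) z)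
    (h₅ : Dom (fun i => seqNorm r (fun k => ω k * (sample ρf k * tailNorm r₁ (fun j => sample b₁ j *
        tailNorm q₁ (fun j => sample (fun t => t ^ (-1 : ℝ) * a₁ t) j * κ i j) j) k))) z) :
    Dom (fun i => seqNorm r (fun k => ω k * holm θ₀ r₀ q₀ r₁ q₁ a₀ b₀ a₁ b₁ T H X (κ i) k)) z := by
  unfold holm holmL holmR
  simp only [mul_add (sample _ _)]
  exact exists_seqNorm_mul_add_le r ω (exists_seqNorm_mul_add_le r ω h₁ h₂)
    (exists_seqNorm_mul_add_le r ω (exists_seqNorm_mul_add_le r ω h₃ h₄) h₅)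

end HolmstedtWeights

/-! ### Reiteration -/

namespace HolmstedtWeights

variable {V : Type*} [AddCommGroup V] {A₀ A₁ : V → ℝ≥0∞} {θ θ₀ : ℝ} {r r₀ q₀ r₁ q₁ : ℝ≥0∞}
  {a a₀ b₀ a₁ b₁ T H X : ℝ → ℝ}

theorem aSharp_regVar (W : HolmstedtWeights θ₀ r₀ q₀ r₁ q₁ a₀ b₀ a₁ b₁ T H X) (ha : RegVar 0 a)
    (θ : ℝ) :
    RegVar 0 (aSharp θ (fun t => a₀ t * T t) X a (rhoFun θ₀ (fun t => a₀ t * T t) X)) :=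
  ((((W.regVar_a₀.mul W.regVar_T).rpow (1 - θ)).mul (W.regVar_X.rpow θ)).mul
    (ha.comp W.rho_regVar)).of_eq (by ring)

/-- The middle piece is termwise equal to the discretized standard norm, because `ρ^{1-θ} X / t =
t^{-η} χ₀^{1-θ} X^θ`. -/
theorem standardSpace_aSharp_domEqv (W : HolmstedtWeights θ₀ r₀ q₀ r₁ q₁ a₀ b₀ a₁ b₁ T H X)
    (hr : 0 < r) (ha : RegVar 0 a) {η : ℝ} (hη : η = (1 - θ) * θ₀ + θ) :
    DomEqv (standardSpace A₀ A₁ η r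
        (aSharp θ (fun t => a₀ t * T t) X a (rhoFun θ₀ (fun t => a₀ t * T t) X)))
      (fun f => seqNorm r (fun k => sample (fun t => rhoFun θ₀ (fun t => a₀ t * T t) X t ^ (-θ) *
          a (rhoFun θ₀ (fun t => a₀ t * T t) X t)) k *
        (sample (rhoFun θ₀ (fun t => a₀ t * T t) X) k *
          (sample X k * (invSeq k * peetreSeq A₀ A₁ f k))))) := by
  convert standardSpace_domEqv hr (W.aSharp_regVar ha θ) using 4 with f k
  unfold weightedSeq
  rw [← mul_assoc (sample X k), ← mul_assoc, ← mul_assoc]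
  congr 1
  have ht := two_zpow_pos k
  have hX := W.regVar_X.1 _ ht
  have hχ := (W.regVar_a₀.mul W.regVar_T).1 _ ht
  have hρ := W.rho_regVar.1 _ ht
  have haρ := ha.1 _ hρ
  unfold invSeq sample
  rw [← ENNReal.ofReal_mul hX.le, ← ENNReal.ofReal_mul (by positivity),
    ← ENNReal.ofReal_mul (by positivity)]
  congr 1
  set t : ℝ := 2 ^ k with htdef
  set ρ := rhoFun θ₀ (fun t => a₀ t * T t) X with hρdef
  have h1 : ρ t ^ (-θ) * ρ t = t ^ ((1 - θ₀) * (1 - θ)) * ((a₀ t * T t) ^ (1 - θ) *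
      (X t * X t ^ (θ - 1 - 1))) := by
    rw [← Real.rpow_add_one hρ.ne', hρdef, rhoFun, Real.mul_rpow (by positivity) (by positivity),
      Real.div_rpow hχ.le hX.le, ← Real.rpow_mul ht.le, show -θ + 1 = 1 - θ by ring,
      mul_comm (X t), ← Real.rpow_add_one hX.ne', show θ - 1 - 1 + 1 = -(1 - θ) by ring,
      Real.rpow_neg hX.le, div_eq_mul_inv]
  have h2 : t ^ ((1 - θ₀) * (1 - θ)) * t ^ (-1 : ℝ) = t ^ (-η) := by
    rw [← Real.rpow_add ht, hη]
    congr 1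
    ring
  have h3 : X t * X t ^ (θ - 1 - 1) * X t = X t ^ θ := by
    rw [mul_comm (X t), ← Real.rpow_add_one hX.ne', ← Real.rpow_add_one hX.ne']
    congr 1
    ring
  unfold aSharp
  calc _ = (ρ t ^ (-θ) * ρ t) * (X t * t ^ (-1 : ℝ) * a (ρ t)) := by ring
    _ = (t ^ ((1 - θ₀) * (1 - θ)) * t ^ (-1 : ℝ)) * ((a₀ t * T t) ^ (1 - θ) *
          (X t * X t ^ (θ - 1 - 1) * X t) * a (ρ t)) := by rw [h1]; ring
    _ = _ := by rw [h2, h3]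

end HolmstedtWeights

section Reiteration

variable {𝕜 : Type*} [RCLike 𝕜] {V : Type*} [AddCommGroup V] [Module 𝕜 V]
  [TopologicalSpace V] [IsTopologicalAddGroup V] [T2Space V] {A₀ A₁ : V → ℝ≥0∞}
  {θ θ₀ : ℝ} {r r₀ q₀ r₁ q₁ : ℝ≥0∞} {a a₀ b₀ a₁ b₁ T H X : ℝ → ℝ}

/-- The slowly varying functions of the limiting spaces are admissible in Holmstedt's formula. -/
theorem holmstedtWeights_of_slowlyVarying (hθ₀ : 0 < θ₀) (hθ₀' : θ₀ < 1)
    (hr₀ : 0 < r₀) (hq₀ : 0 < q₀) (hr₁ : 0 < r₁) (hq₁ : 0 < q₁)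
    (ha₀ : SlowlyVarying a₀) (hb₀ : SlowlyVarying b₀)
    (ha₁ : SlowlyVarying a₁) (hb₁ : SlowlyVarying b₁)
    (h₀ : weightedNorm r₀ 0 b₀ (fun _ => 1) (Ioi 1) < ∞) (h₁ : nestedHead r₁ b₁ q₁ a₁ 1 < ∞) :
    HolmstedtWeights θ₀ r₀ q₀ r₁ q₁ a₀ b₀ a₁ b₁ (tailAt r₀ b₀) (headAt r₁ b₁)
      (chiOne r₁ b₁ q₁ a₁) := by
  have vb₀ := hb₀.regVar
  have va₁ := ha₁.regVar
  have vb₁ := hb₁.regVar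
  have cT := vb₀.cellEqv_weightedNorm_Ioi (ι := Unit) hr₀
  have cH := vb₁.cellEqv_weightedNorm_Ioo (ι := Unit) hr₁
  have cX := cellEqv_nestedHead (ι := Unit) hr₁ hq₁ va₁ vb₁
  have sT := vb₀.slowSeq.tailNorm hr₀
  have sH := vb₁.slowSeq.headNorm hr₁
  have sX := slowSeq_nestedSeq hr₁ hq₁ va₁.slowSeq vb₁.slowSeq
  have nT : ∀ k, tailNorm r₀ (sample b₀) k ≠ 0 := fun k =>
    ((vb₀.sample_pos k).trans_le (le_tailNorm hr₀ _ le_rfl)).ne'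
  have nH : ∀ k, headNorm r₁ (sample b₁) k ≠ 0 := fun k =>
    ((vb₁.sample_pos k).trans_le (le_headNorm hr₁ _ le_rfl)).ne'
  have hHX := HolmstedtWeights.headNorm_mul_le_nestedSeq hr₁ hq₁ (sample a₁) (sample b₁)
  have nX : ∀ k, nestedSeq r₁ (sample b₁) q₁ (sample a₁) k ≠ 0 := fun k =>
    ((ENNReal.mul_pos (nH k) (va₁.sample_pos k).ne').trans_le (hHX k)).ne'
  have h1cell : (1 : ℝ) ∈ cell 0 := by simpa using zpow_mem_cell 0
  -- Finiteness of `H` is inherited from `χ₁`: `H a₁ ≲ χ₁` at `t = 1`, and `a₁` is positive there.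
  have fH : weightedNorm r₁ 0 b₁ (fun _ => 1) (Ioo 0 1) < ∞ := by
    obtain ⟨C, hC⟩ := cX
    obtain ⟨D, hD⟩ := cH
    have e1 : headNorm r₁ (sample b₁) 0 * sample a₁ 0 < ∞ :=
      ((hHX 0).trans (hC () 0 1 h1cell).2).trans_lt (ENNReal.mul_lt_top ENNReal.coe_lt_top h₁)
    have e2 : headNorm r₁ (sample b₁) 0 < ∞ :=
      ENNReal.lt_top_of_mul_ne_top_left e1.ne (va₁.sample_pos 0).ne'
    exact (hD () 0 1 h1cell).1.trans_lt (ENNReal.mul_lt_top ENNReal.coe_lt_top e2)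
  exact
    { θ_pos := hθ₀
      θ_lt_one := hθ₀'
      r₀_pos := hr₀
      q₀_pos := hq₀
      r₁_pos := hr₁
      q₁_pos := hq₁
      regVar_a₀ := ha₀.regVar
      regVar_b₀ := vb₀
      regVar_a₁ := va₁
      regVar_b₁ := vb₁
      regVar_T := cT.regVar_toReal sT nT h₀
      regVar_H := cH.regVar_toReal sH nH fH
      regVar_X := cX.regVar_toReal sX nX h₁
      T_eqv := cT.sample_dom sT h₀
      H_eqv := cH.sample_dom sH fH
      X_eqv := cX.sample_dom sX h₁ }

namespace HolmstedtWeights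

/-- Replacing the two endpoint norms by discretized ones changes the K-functional only by constants;
the norm is then sampled along `ρ (2 ^ k)`, where Holmstedt's formula applies. -/
theorem standardSpace_domEqv_holm (W : HolmstedtWeights θ₀ r₀ q₀ r₁ q₁ a₀ b₀ a₁ b₁ T H X)
    (hA₀ : IsQuasiBanachIn 𝕜 A₀) (hA₁ : IsQuasiBanachIn 𝕜 A₁) (hr : 0 < r) (ha : RegVar 0 a) (θ : ℝ) :
    DomEqv (standardSpace (spaceL A₀ A₁ θ₀ r₀ b₀ q₀ a₀) (spaceR A₀ A₁ 1 r₁ b₁ q₁ a₁) θ r a)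
      (fun f => seqNorm r (fun k => sample (fun t => rhoFun θ₀ (fun t => a₀ t * T t) X t ^ (-θ) *
          a (rhoFun θ₀ (fun t => a₀ t * T t) X t)) k *
        holm θ₀ r₀ q₀ r₁ q₁ a₀ b₀ a₁ b₁ T H X (peetreSeq A₀ A₁ f) k)) := by
  have hL := spaceL_domEqv (X₀ := A₀) (X₁ := A₁) (θ := θ₀) W.r₀_pos W.q₀_pos W.regVar_b₀ W.regVar_a₀
  have hR := spaceR_domEqv (X₀ := A₀) (X₁ := A₁) (θ := 1) W.r₁_pos W.q₁_pos W.regVar_b₁ W.regVar_a₁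
  obtain ⟨C, hC⟩ := hL.1.peetreK hR.1
  obtain ⟨D, hD⟩ := hL.2.peetreK hR.2
  have hH := W.peetreK_domEqv_holm hA₀ hA₁
  refine ((standardSpace_domEqv hr ha).trans (seqNorm_weightedSeq_domEqv_comp hr ha W.rho_regVar
    (by linarith [W.θ_lt_one]))).trans ⟨?_, ?_⟩
  · exact Dom₂.seqNorm hr (Dom₂.const_mul (Dom₂.trans ⟨C, fun f k => hC _ f⟩ hH.1) _)
  · exact Dom₂.seqNorm hr (Dom₂.const_mul (hH.2.trans ⟨D, fun f k => hD _ f⟩) _)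

theorem reiteration_of_pos_of_lt_one (W : HolmstedtWeights θ₀ r₀ q₀ r₁ q₁ a₀ b₀ a₁ b₁ T H X)
    (hA₀ : IsQuasiBanachIn 𝕜 A₀) (hA₁ : IsQuasiBanachIn 𝕜 A₁) (hr : 0 < r) (ha : RegVar 0 a)
    (hθ : 0 < θ) (hθ' : θ < 1) :
    SameSpace
      (standardSpace (spaceL A₀ A₁ θ₀ r₀ b₀ q₀ a₀) (spaceR A₀ A₁ 1 r₁ b₁ q₁ a₁) θ r a)
      (standardSpace A₀ A₁ ((1 - θ) * θ₀ + θ) r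
        (aSharp θ (fun t => a₀ t * T t) X a (rhoFun θ₀ (fun t => a₀ t * T t) X))) := by
  refine DomEqv.sameSpace ((W.standardSpace_domEqv_holm hA₀ hA₁ hr ha θ).trans
    (DomEqv.trans ⟨?_, ?_⟩ (W.standardSpace_aSharp_domEqv hr ha rfl).symm))
  · exact seqNorm_holm_dom _ (W.hardy_head_head ha hr hθ _) (W.hardy_T_head ha hr hθ _)
      (Dom.refl _) (W.hardy_H_tail ha hr hθ' _) (W.hardy_tail_tail ha hr hθ' _)
  · refine (Dom₂.of_le fun f k => mul_le_mul' le_rfl ?_).seqNorm hr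
    exact le_trans (mul_le_mul' le_rfl (le_self_add.trans le_self_add)) le_add_self

theorem reiteration_zero (W : HolmstedtWeights θ₀ r₀ q₀ r₁ q₁ a₀ b₀ a₁ b₁ T H X)
    (hA₀ : IsQuasiBanachIn 𝕜 A₀) (hA₁ : IsQuasiBanachIn 𝕜 A₁) (hr : 0 < r) (ha : RegVar 0 a) :
    SameSpace
      (standardSpace (spaceL A₀ A₁ θ₀ r₀ b₀ q₀ a₀) (spaceR A₀ A₁ 1 r₁ b₁ q₁ a₁) 0 r a)
      (interSpace
        (spaceL A₀ A₁ θ₀ r (fun t => T t * a (rhoFun θ₀ (fun t => a₀ t * T t) X t)) q₀ a₀)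
        (spaceLL A₀ A₁ θ₀ r (a ∘ rhoFun θ₀ (fun t => a₀ t * T t) X) r₀ b₀ q₀ a₀)) := by
  set ρ := rhoFun θ₀ (fun t => a₀ t * T t) X with hρ
  have haρ : RegVar 0 (fun t => a (ρ t)) := ha.comp W.rho_regVar
  have eω : ∀ k, sample (fun t => ρ t ^ (-(0 : ℝ)) * a (ρ t)) k = sample (a ∘ ρ) k := fun k => by
    simp [sample]
  have e2 : ∀ k (z : ℝ≥0∞), sample (fun t => ρ t ^ (-(0 : ℝ)) * a (ρ t)) k * (sample T k * z) =
      sample (fun t => T t * a (ρ t)) k * z := fun k z => by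
    rw [eω, sample_mul (w := T) (W.regVar_T.1 _ (two_zpow_pos k)).le]
    change sample (fun t => a (ρ t)) k * _ = _
    ring
  have hZ := (spaceL_domEqv (X₀ := A₀) (X₁ := A₁) (θ := θ₀) hr W.q₀_pos (W.regVar_T.mul haρ)
    W.regVar_a₀).max (spaceLL_domEqv (X₀ := A₀) (X₁ := A₁) (θ := θ₀) (c := a ∘ ρ) hr W.r₀_pos
    W.q₀_pos haρ W.regVar_b₀ W.regVar_a₀)
  simp only [← e2, ← eω] at hZ
  refine DomEqv.sameSpace ((W.standardSpace_domEqv_holm hA₀ hA₁ hr ha 0).trans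
    (DomEqv.trans ⟨?_, ?_⟩ hZ.symm))
  -- For `θ = 0` the weight has index `0`, so Hardy cannot absorb the head pieces. The middle piece
  -- is instead the last term of the `T` head piece, and the tail pieces follow through it.
  · have h₃ : Dom (fun f => seqNorm r (fun k => sample (fun t => ρ t ^ (-(0 : ℝ)) * a (ρ t)) k *
        (sample ρ k * (sample X k * (invSeq k * peetreSeq A₀ A₁ f k)))))
        (fun f => seqNorm r (fun k => sample (fun t => ρ t ^ (-(0 : ℝ)) * a (ρ t)) k *
          (sample T k * headNorm q₀ (weightedSeq A₀ A₁ θ₀ a₀ f) k))) := by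
      refine (Dom₂.of_le fun f k => mul_le_mul' le_rfl ?_).seqNorm hr
      rw [← mul_assoc (sample X k), ← mul_assoc, ← W.T_mul_U₀, mul_assoc]
      exact mul_le_mul' le_rfl (le_headNorm W.q₀_pos (weightedSeq A₀ A₁ θ₀ a₀ f) le_rfl)
    exact seqNorm_holm_dom _ (Dom.of_le fun f => le_max_right _ _)
      (Dom.of_le fun f => le_max_left _ _)
      (h₃.trans (Dom.of_le fun f => le_max_left _ _))
      (((W.hardy_H_tail ha hr one_pos _).trans h₃).trans (Dom.of_le fun f => le_max_left _ _))
      (((W.hardy_tail_tail ha hr one_pos _).trans h₃).trans (Dom.of_le fun f => le_max_left _ _))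
  · refine Dom.max ?_ ?_
    · refine (Dom₂.of_le fun f k => mul_le_mul' le_rfl ?_).seqNorm hr
      exact le_trans le_add_self le_self_add
    · refine (Dom₂.of_le fun f k => mul_le_mul' le_rfl ?_).seqNorm hr
      exact le_trans le_self_add le_self_add

theorem reiteration_one (W : HolmstedtWeights θ₀ r₀ q₀ r₁ q₁ a₀ b₀ a₁ b₁ T H X)
    (hA₀ : IsQuasiBanachIn 𝕜 A₀) (hA₁ : IsQuasiBanachIn 𝕜 A₁) (hr : 0 < r) (ha : RegVar 0 a) :
    SameSpace
      (standardSpace (spaceL A₀ A₁ θ₀ r₀ b₀ q₀ a₀) (spaceR A₀ A₁ 1 r₁ b₁ q₁ a₁) 1 r a)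
      (interSpace
        (standardSpace A₀ A₁ 1 r
          (aSharp 1 (fun t => a₀ t * T t) X a (rhoFun θ₀ (fun t => a₀ t * T t) X)))
        (interSpace
          (spaceR A₀ A₁ 1 r (fun t => H t * a (rhoFun θ₀ (fun t => a₀ t * T t) X t)) q₁ a₁)
          (spaceRR A₀ A₁ 1 r (a ∘ rhoFun θ₀ (fun t => a₀ t * T t) X) r₁ b₁ q₁ a₁))) := by
  have h₃ := W.standardSpace_aSharp_domEqv (A₀ := A₀) (A₁ := A₁) (θ := 1) hr ha (η := 1) (by ring)
  set ρ := rhoFun θ₀ (fun t => a₀ t * T t) X with hρ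
  have haρ : RegVar 0 (fun t => a (ρ t)) := ha.comp W.rho_regVar
  have eω : ∀ k (z : ℝ≥0∞), sample (fun t => ρ t ^ (-(1 : ℝ)) * a (ρ t)) k * (sample ρ k * z) =
      sample (a ∘ ρ) k * z := fun k z => by
    have h1 := W.rho_regVar.1 _ (two_zpow_pos k)
    have h2 := haρ.1 _ (two_zpow_pos k)
    rw [← mul_assoc]
    congr 1
    unfold sample
    rw [← ENNReal.ofReal_mul (mul_nonneg (Real.rpow_nonneg h1.le _) h2.le)]
    congr 1
    rw [Real.rpow_neg_one, mul_right_comm, inv_mul_cancel₀ h1.ne', one_mul]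
    rfl
  have e4 : ∀ k (z : ℝ≥0∞), sample (fun t => ρ t ^ (-(1 : ℝ)) * a (ρ t)) k *
      (sample ρ k * (sample H k * z)) = sample (fun t => H t * a (ρ t)) k * z := fun k z => by
    rw [eω, sample_mul (w := H) (W.regVar_H.1 _ (two_zpow_pos k)).le]
    change sample (fun t => a (ρ t)) k * _ = _
    ring
  have hZ := h₃.max
    ((spaceR_domEqv (X₀ := A₀) (X₁ := A₁) (θ := 1) hr W.q₁_pos (W.regVar_H.mul haρ)
      W.regVar_a₁).max (spaceRR_domEqv (X₀ := A₀) (X₁ := A₁) (θ := 1) (c := a ∘ ρ) hr W.r₁_pos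
      W.q₁_pos haρ W.regVar_b₁ W.regVar_a₁))
  simp only [← e4] at hZ
  simp only [← eω] at hZ
  refine DomEqv.sameSpace ((W.standardSpace_domEqv_holm hA₀ hA₁ hr ha 1).trans
    (DomEqv.trans ⟨?_, ?_⟩ hZ.symm))
  -- For `θ = 1` the weight `ωρ = a ∘ ρ` has index `0`: only the head pieces are absorbed, and the
  -- other three match the three spaces of the intersection.
  · exact seqNorm_holm_dom _
      ((W.hardy_head_head ha hr one_pos _).trans (Dom.of_le fun f => le_max_left _ _))
      ((W.hardy_T_head ha hr one_pos _).trans (Dom.of_le fun f => le_max_left _ _))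
      (Dom.of_le fun f => le_max_left _ _)
      (Dom.of_le fun f => (le_max_left _ _).trans (le_max_right _ _))
      (Dom.of_le fun f => (le_max_right _ _).trans (le_max_right _ _))
  · refine Dom.max ?_ (Dom.max ?_ ?_)
    · refine (Dom₂.of_le fun f k => mul_le_mul' le_rfl ?_).seqNorm hr
      exact le_trans (mul_le_mul' le_rfl (le_self_add.trans le_self_add)) le_add_self
    · refine (Dom₂.of_le fun f k => mul_le_mul' le_rfl ?_).seqNorm hr
      exact le_trans (mul_le_mul' le_rfl (le_add_self.trans le_self_add)) le_add_self
    · refine (Dom₂.of_le fun f k => mul_le_mul' le_rfl ?_).seqNorm hr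
      exact le_trans (mul_le_mul' le_rfl le_add_self) le_add_self

end HolmstedtWeights

end Reiteration

theorem theorem48 {𝕜 : Type*} [RCLike 𝕜] {V : Type*} [AddCommGroup V] [Module 𝕜 V]
    [TopologicalSpace V] [IsTopologicalAddGroup V] [ContinuousSMul 𝕜 V] [T2Space V]
    (A₀ A₁ : V → ℝ≥0∞)
    (hA₀ : IsQuasiBanachIn 𝕜 A₀) (hA₁ : IsQuasiBanachIn 𝕜 A₁)
    (hA : ∃ f : V, f ≠ 0 ∧ A₀ f < ∞ ∧ A₁ f < ∞)
    (θ₀ : ℝ) (hθ₀ : 0 < θ₀) (hθ₀' : θ₀ < 1)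
    (r r₀ q₀ r₁ q₁ : ℝ≥0∞)
    (hr : 0 < r) (hr₀ : 0 < r₀) (hq₀ : 0 < q₀) (hr₁ : 0 < r₁) (hq₁ : 0 < q₁)
    (a a₀ b₀ a₁ b₁ : ℝ → ℝ)
    (ha : SlowlyVarying a) (ha₀ : SlowlyVarying a₀) (hb₀ : SlowlyVarying b₀)
    (ha₁ : SlowlyVarying a₁) (hb₁ : SlowlyVarying b₁)
    (h₀ : weightedNorm r₀ 0 b₀ (fun _ => 1) (Ioi 1) < ∞)
    (h₁ : nestedHead r₁ b₁ q₁ a₁ 1 < ∞)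
    (χ₀ χ₁ ρ : ℝ → ℝ)
    (hχ₀ : χ₀ = chiZero r₀ b₀ a₀)
    (hχ₁ : χ₁ = chiOne r₁ b₁ q₁ a₁)
    (hρ : ρ = rhoFun θ₀ χ₀ χ₁) :
    (∀ θ : ℝ, 0 < θ → θ < 1 →
      SameSpace
        (standardSpace (spaceL A₀ A₁ θ₀ r₀ b₀ q₀ a₀) (spaceR A₀ A₁ 1 r₁ b₁ q₁ a₁) θ r a)
        (standardSpace A₀ A₁ ((1 - θ) * θ₀ + θ) r (aSharp θ χ₀ χ₁ a ρ))) ∧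
    (weightedNorm r 0 a (fun _ => 1) (Ioi 1) < ∞ →
      SameSpace
        (standardSpace (spaceL A₀ A₁ θ₀ r₀ b₀ q₀ a₀) (spaceR A₀ A₁ 1 r₁ b₁ q₁ a₁) 0 r a)
        (interSpace
          (spaceL A₀ A₁ θ₀ r (fun t => tailAt r₀ b₀ t * a (ρ t)) q₀ a₀)
          (spaceLL A₀ A₁ θ₀ r (a ∘ ρ) r₀ b₀ q₀ a₀))) ∧
    (weightedNorm r 0 a (fun _ => 1) (Ioo 0 1) < ∞ →
      SameSpace
        (standardSpace (spaceL A₀ A₁ θ₀ r₀ b₀ q₀ a₀) (spaceR A₀ A₁ 1 r₁ b₁ q₁ a₁) 1 r a)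
        (interSpace
          (standardSpace A₀ A₁ 1 r (aSharp 1 χ₀ χ₁ a ρ))
          (interSpace
            (spaceR A₀ A₁ 1 r (fun t => headAt r₁ b₁ t * a (ρ t)) q₁ a₁)
            (spaceRR A₀ A₁ 1 r (a ∘ ρ) r₁ b₁ q₁ a₁)))) := by
  have W := holmstedtWeights_of_slowlyVarying hθ₀ hθ₀' hr₀ hq₀ hr₁ hq₁ ha₀ hb₀ ha₁ hb₁ h₀ h₁
  subst hρ hχ₀ hχ₁
  exact ⟨fun _ hθ hθ' => W.reiteration_of_pos_of_lt_one hA₀ hA₁ hr ha.regVar hθ hθ',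
    fun _ => W.reiteration_zero hA₀ hA₁ hr ha.regVar,
    fun _ => W.reiteration_one hA₀ hA₁ hr ha.regVar⟩
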